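/- **Setting.** A schema has finitely many relation symbols, each declared *static* or *dynamic*; the domain of data values is $\mathbb N$. A conjunctive query $Q$ has a finite set of body atoms $R(X_1,\dots,X_k)$ (symbols may repeat) and a tuple of free variables, all of which occur in the body; its result on a database is evaluated under set semantics. The static (dynamic) sub-query $\mathit{stat}(Q)$ ($\mathit{dyn}(Q)$) consists of the body atoms over static (dynamic) relations. The fractional edge cover number $\rho^*(Q)$ is the minimum of $\sum_{a}\lambda_a$ over all weights $\lambda_a\in[0,1]$ of the body atoms $a$ with $\sum_{a\ni X}\lambda_a\ge 1$ for every variable $X$ of $Q$. A *path* in $Q$ is a nonempty sequence of distinct variables such that any two consecutive ones occur together in a body atom; it connects two variable sets if its first variable lies in the first and its last variable lies in the second set. $Q$ is *well-behaved* if (i) for all dynamic body atoms with variable sets $\mathbf X,\mathbf Y$, every path connecting $\mathbf X$ and $\mathbf Y$ contains a variable of $\mathbf X\cap\mathbf Y$, and (ii) for every dynamic body atom with variable set $\mathbf X$, every path connecting $\mathbf X$ and the set $\mathit{free}(Q)$ of free variables contains a variable of $\mathbf X\cap\mathit{free}(Q)$. The class $\mathcal C_{\mathrm{exp}}$ consists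 of the well-behaved queries and of the queries in which every variable of a dynamic atom also occurs in a static atom. The machine model is the uniform-cost random access machine over natural numbers with zero-initialised registers and with arrays addressed by tuples of numbers (so that a tuple can be looked up in one step); its operations are constants, addition, truncated subtraction, comparison, array access, and output of a tuple. A maintenance algorithm consists of three fixed programs. *Preprocessing* starts from a list of the tuples of each relation of the initial database. Afterwards arbitrary sequences of requests are served: *updates* (insert or delete of one tuple in a dynamic relation) and *enumerations*, which output every tuple of the current query result exactly once and which may be abandoned before they are complete. The update time is the maximal number of steps for one update. The enumeration delay is the maximal number of steps before the first output, between two consecutive outputs, and between the last output and the end of the enumeration. **Theorem.** Let $Q\in\mathcal C_{\mathrm{exp}}$. There are a maintenance algorithm for $Q$, a function $p:\mathbb N\to\mathbb N$ with $p(N)=O\bigl(N^{\rho^*(\mathit{stat}(Q))}\bigr)$, and a constant $c$, all depending only on the query $Q$ and its schema, such that on every initial database with $N$ tuples in the static and $M$ tuples in the dynamic relations the preprocessing takes at most $2^{p(N)}\cdot p(N)^2+c\cdot M$ steps, and, at any time, every update takes at most $c$ steps and the query result is enumerated with delay at most $c$. In particular, the preprocessing takes at most $2^{p(N)}\cdot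 p(N)^2$ steps if the dynamic relations are initially empty. -/

import Mathlib

open Asymptotics Filter

/-! ### Schemas, databases, updates -/

/-- A finite relational schema. Every relation symbol is either dynamic or static. -/
structure Schema where
  numRel : ℕ
  arity : Fin numRel → ℕ
  isDyn : Fin numRel → Bool

/-- Tuples over a relation symbol; the (infinite) domain of data values is `ℕ`. -/
abbrev Schema.Tuple (S : Schema) (r : Fin S.numRel) : Type := Fin (S.arity r) → ℕ

/-- A database: a finite relation for every relation symbol. -/
abbrev Database (S : Schema) : Type := (r : Fin S.numRel) → Finset (S.Tuple r)

/-- The number of tuples in the static relations. -/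
def Database.staticSize {S : Schema} (D : Database S) : ℕ :=
  ∑ r with S.isDyn r = false, (D r).card

/-- The number of tuples in the dynamic relations. -/
def Database.dynamicSize {S : Schema} (D : Database S) : ℕ :=
  ∑ r with S.isDyn r = true, (D r).card

/-- A single-tuple update (insert or delete) to a dynamic relation. -/
structure Update (S : Schema) where
  rel : Fin S.numRel
  dyn : S.isDyn rel = true
  insert : Bool
  tuple : S.Tuple rel

/-- The effect of an update under set semantics. -/
def Update.apply {S : Schema} (u : Update S) (D : Database S) : Database S :=
  Function.update D u.rel
    (if u.insert then Insert.insert u.tuple (D u.rel) else (D u.rel).erase u.tuple)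

/-! ### Conjunctive queries -/

/-- An atom `R(X₁, …, X_k)`; variables are natural numbers. -/
structure Atom (S : Schema) where
  rel : Fin S.numRel
  args : Fin (S.arity rel) → ℕ

/-- The set of variables of an atom. -/
def Atom.vars {S : Schema} (a : Atom S) : Finset ℕ := Finset.univ.image a.args

/-- A conjunctive query: a finite set of body atoms and a tuple of free variables,
each of which occurs in the body. Relation symbols may repeat. -/
structure CQ (S : Schema) where
  body : Finset (Atom S)
  head : List ℕ
  head_subset : ∀ x ∈ head, ∃ a ∈ body, x ∈ a.vars

namespace CQ

variable {S : Schema}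

/-- All variables of the query. -/
def vars (Q : CQ S) : Finset ℕ := Q.body.biUnion Atom.vars

/-- The free variables of the query. -/
def free (Q : CQ S) : Finset ℕ := Q.head.toFinset

/-- The result of the query on a database, as a set of tuples over the head. -/
def result (Q : CQ S) (D : Database S) : Set (List ℕ) :=
  {t | ∃ ν : ℕ → ℕ, (∀ a ∈ Q.body, (fun j => ν (a.args j)) ∈ D a.rel) ∧ t = Q.head.map ν}

/-- The sub-query made of the body atoms over dynamic (`b = true`) or static (`b = false`)
relations; its free variables are the free variables of the query that occur in these atoms. -/
def sub (Q : CQ S) (b : Bool) : CQ S where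
  body := Q.body.filter fun a => S.isDyn a.rel = b
  head := Q.head.filter fun x => x ∈ (Q.body.filter fun a => S.isDyn a.rel = b).biUnion Atom.vars
  head_subset := by
    intro x hx
    simpa using (List.mem_filter.1 hx).2

/-- The static sub-query. -/
def stat (Q : CQ S) : CQ S := Q.sub false

/-- The dynamic sub-query. -/
def dyn (Q : CQ S) : CQ S := Q.sub true

/-- `w` is a fractional edge cover of the variable set `F` by the body atoms of the query. -/
def IsFractionalEdgeCover (Q : CQ S) (F : Finset ℕ) (w : Atom S → ℝ) : Prop :=
  (∀ a ∈ Q.body, 0 ≤ w a ∧ w a ≤ 1) ∧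
    ∀ x ∈ F, 1 ≤ ∑ a ∈ Q.body.filter (fun a => x ∈ a.vars), w a

/-- The fractional edge cover number of a variable set `F`: the optimal value of the linear
program. For `F ⊆ vars(Q)` the program is feasible (all weights `1`) and bounded below by `0`. -/
noncomputable def rhoStarOn (Q : CQ S) (F : Finset ℕ) : ℝ :=
  sInf {s | ∃ w, Q.IsFractionalEdgeCover F w ∧ s = ∑ a ∈ Q.body, w a}

/-- The fractional edge cover number of the query. -/
noncomputable def rhoStar (Q : CQ S) : ℝ := Q.rhoStarOn Q.vars

/-- A path: a nonempty sequence of distinct variables in which any two consecutive variables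
occur together in a body atom. -/
def IsPath (Q : CQ S) (P : List ℕ) : Prop :=
  P ≠ [] ∧ P.Nodup ∧ P.IsChain fun x y => ∃ a ∈ Q.body, x ∈ a.vars ∧ y ∈ a.vars

/-- The path `P` connects the variable sets `X` and `Y`: it starts in `X` and ends in `Y`. -/
def Connects (Q : CQ S) (P : List ℕ) (X Y : Finset ℕ) : Prop :=
  Q.IsPath P ∧ (∃ x ∈ P.head?, x ∈ X) ∧ ∃ y ∈ P.getLast?, y ∈ Y

/-- Every path connecting two dynamic body atoms contains a common variable of the two atoms, and
every path connecting a dynamic body atom with the head contains a free variable of the atom. -/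
def WellBehaved (Q : CQ S) : Prop :=
  (∀ a ∈ Q.dyn.body, ∀ b ∈ Q.dyn.body, ∀ P, Q.Connects P a.vars b.vars →
    ∃ z ∈ P, z ∈ a.vars ∧ z ∈ b.vars) ∧
  ∀ a ∈ Q.dyn.body, ∀ P, Q.Connects P a.vars Q.free → ∃ z ∈ P, z ∈ a.vars ∧ z ∈ Q.free

/-- The class `C_poly`: the well-behaved queries. -/
def Cpoly : Set (CQ S) := {Q | Q.WellBehaved}

/-- The class `C_exp`: the queries in `C_poly`, and the queries in which every variable of a
dynamic atom also occurs in a static atom. -/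
def Cexp : Set (CQ S) := Cpoly ∪ {Q | Q.dyn.vars ⊆ Q.stat.vars}

end CQ

/-! ### The machine model

A random access machine in the uniform cost model. Memory cells hold natural numbers. There are
registers, and arrays that are addressed by tuples of data values; all cells are initially `0`. -/

/-- Programs. Registers and arrays are named by natural numbers. -/
inductive Prog where
  /-- set register `x` to the fixed number `n` -/
  | const (x n : ℕ)
  /-- `x := y + z` on registers -/
  | add (x y z : ℕ)
  /-- `x := y - z` on registers, truncated at `0` -/
  | sub (x y z : ℕ)
  /-- `x := A[i₁, …, i_k]`, where the indices are the contents of the registers `is` -/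
  | load (x A : ℕ) (is : List ℕ)
  /-- `A[i₁, …, i_k] := x`, where the indices are the contents of the registers `is` -/
  | store (A : ℕ) (is : List ℕ) (x : ℕ)
  /-- output the tuple of the contents of the registers `xs` -/
  | emit (xs : List ℕ)
  | seq (p q : Prog)
  /-- if register `x` < register `y` then `p` else `q` -/
  | ite (x y : ℕ) (p q : Prog)
  /-- while register `x` < register `y` do `p` -/
  | whl (x y : ℕ) (p : Prog)

/-- Memory contents. -/
structure Mem where
  reg : ℕ → ℕ
  arr : ℕ → List ℕ → ℕ

def Mem.setReg (σ : Mem) (x v : ℕ) : Mem := { σ with reg := Function.update σ.reg x v }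

def Mem.setArr (σ : Mem) (A : ℕ) (i : List ℕ) (v : ℕ) : Mem :=
  { σ with arr := Function.update σ.arr A (Function.update (σ.arr A) i v) }

/-- What is visible of one step: `some t` if the tuple `t` is output, `none` otherwise. -/
abbrev Event : Type := Option (List ℕ)

/-- One step, on a stack of programs still to be executed. Every step has cost `1`. -/
def Prog.step : List Prog → Mem → Option (Event × List Prog × Mem)
  | [], _ => none
  | .const x n :: k, σ => some (none, k, σ.setReg x n)
  | .add x y z :: k, σ => some (none, k, σ.setReg x (σ.reg y + σ.reg z))
  | .sub x y z :: k, σ => some (none, k, σ.setReg x (σ.reg y - σ.reg z))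
  | .load x A is :: k, σ => some (none, k, σ.setReg x (σ.arr A (is.map σ.reg)))
  | .store A is x :: k, σ => some (none, k, σ.setArr A (is.map σ.reg) (σ.reg x))
  | .emit xs :: k, σ => some (some (xs.map σ.reg), k, σ)
  | .seq p q :: k, σ => some (none, p :: q :: k, σ)
  | .ite x y p q :: k, σ => some (none, (if σ.reg x < σ.reg y then p else q) :: k, σ)
  | .whl x y p :: k, σ =>
      some (none, if σ.reg x < σ.reg y then p :: .whl x y p :: k else k, σ)

/-- `Run k σ tr k' σ'`: starting from stack `k` and memory `σ`, the machine arrives after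
`tr.length` steps at stack `k'` and memory `σ'`; `tr` is the sequence of the events on the way.
The execution is complete if `k' = []`. -/
inductive Run : List Prog → Mem → List Event → List Prog → Mem → Prop
  | refl (k : List Prog) (σ : Mem) : Run k σ [] k σ
  | head {k k₁ k₂ : List Prog} {σ σ₁ σ₂ : Mem} {e : Event} {tr : List Event} :
      Prog.step k σ = some (e, k₁, σ₁) → Run k₁ σ₁ tr k₂ σ₂ → Run k σ (e :: tr) k₂ σ₂

/-! ### Dynamic query evaluation -/

/-- A duplicate-free listing, in arbitrary order, of the tuples of every relation. -/
structure Listing (S : Schema) where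
  list : (r : Fin S.numRel) → List (S.Tuple r)
  nodup : ∀ r, (list r).Nodup

/-- The database that is listed. -/
def Listing.db {S : Schema} (L : Listing S) : Database S := fun r => (L.list r).toFinset

/-- The input of the preprocessing. Array `r` holds the tuples of the `r`-th relation: cell `[]`
is their number, cell `[i, j]` is component `j` of tuple `i` (counted from `0`). All other cells
and all registers are `0`. -/
def Listing.initMem {S : Schema} (L : Listing S) : Mem where
  reg _ := 0
  arr r idx :=
    if hr : r < S.numRel then
      match idx with
      | [] => (L.list ⟨r, hr⟩).length
      | [i, j] =>
          if hj : j < S.arity ⟨r, hr⟩ then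
            if hi : i < (L.list ⟨r, hr⟩).length then (L.list ⟨r, hr⟩)[i] ⟨j, hj⟩ else 0
          else 0
      | _ => 0
    else 0

/-- The request for an update is written into the first registers: `1` for an insert and `0` for a
delete, the number of the relation, and the components of the tuple. The rest of the memory is
as the previous request left it. -/
def Update.request {S : Schema} (u : Update S) (σ : Mem) : Mem :=
  { σ with
    reg := fun x =>
      ((if u.insert then 1 else 0) :: u.rel.val :: List.ofFn u.tuple).getD x (σ.reg x) }

/-- A maintenance algorithm: the programs for preprocessing, updates and enumeration. -/
structure Maintenance where
  prep : Prog
  upd : Prog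
  enum : Prog

namespace Maintenance

variable {S : Schema}

/-- `A.Reachable L D σ`: after preprocessing the input `L` and serving some finite sequence of
requests, the current database is `D` and the memory is `σ`. A request is an update or an
enumeration of the query result; an enumeration may be abandoned before it is complete. -/
inductive Reachable (A : Maintenance) (L : Listing S) : Database S → Mem → Prop
  | prep {tr : List Event} {σ : Mem} :
      Run [A.prep] L.initMem tr [] σ → Reachable A L L.db σ
  | update {D : Database S} {σ σ' : Mem} {tr : List Event} (u : Update S) :
      Reachable A L D σ → Run [A.upd] (u.request σ) tr [] σ' → Reachable A L (u.apply D) σ'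
  | enum {D : Database S} {σ σ' : Mem} {tr : List Event} {k : List Prog} :
      Reachable A L D σ → Run [A.enum] σ tr k σ' → Reachable A L D σ'

/-- The preprocessing of every input terminates within `f` steps, where `f` depends on the sizes
of the static and of the dynamic part of the initial database. -/
def PreprocessingTime (S : Schema) (A : Maintenance) (f : ℕ → ℕ → ℕ) : Prop :=
  ∀ L : Listing S, ∃ tr σ, Run [A.prep] L.initMem tr [] σ ∧
    tr.length ≤ f L.db.staticSize L.db.dynamicSize

/-- At any time, every single-tuple update is processed within `c` steps. -/
def UpdateTime (S : Schema) (A : Maintenance) (c : ℕ) : Prop :=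
  ∀ (L : Listing S) (D : Database S) (σ : Mem), A.Reachable L D σ →
    ∀ u : Update S, ∃ tr σ', Run [A.upd] (u.request σ) tr [] σ' ∧ tr.length ≤ c

/-- At any time, the enumeration outputs exactly the tuples in the result of the query on the
current database, each once, and there are at most `c` consecutive steps without an output (before
the first output, between two outputs, and between the last output and the end). -/
def EnumerationDelay (A : Maintenance) (Q : CQ S) (c : ℕ) : Prop :=
  ∀ (L : Listing S) (D : Database S) (σ : Mem), A.Reachable L D σ →
    ∃ tr σ', Run [A.enum] σ tr [] σ' ∧
      (tr.filterMap id).Nodup ∧ {t | t ∈ tr.filterMap id} = Q.result D ∧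
      ∀ w, w <:+: tr → (∀ e ∈ w, e = none) → w.length ≤ c

end Maintenance

/-!
The two kinds of queries in the class are maintained by different data structures.

*Well-behaved queries.* Such a query has a plan (`Plan`): a tree whose inner nodes either join
independent parts or bind a variable, whose value may depend on the values bound further up, and whose
leaves are dynamic atoms or tries of static tuples. It is found by recursion (`CQ.exists_plan`). Atoms
that fall into parts without common unbound variables are joined, and purely static parts are
projected to their free and bound variables and stored in a trie. Otherwise the part is connected,
and by the path conditions its dynamic atoms have a common unbound variable, free if a free variable
is left (`CQ.exists_common_var`), which is bound next. So free variables are bound above the others, and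
all variables above a dynamic leaf are arguments of its atom.

For every variable node, and for all values of the variables it depends on, the values that have a
solution below are kept in an array without gaps, together with an array of their positions
(`SetRep`). A single tuple that is inserted or deleted concerns one value at each of the nodes above
its leaf, and whether this value has a solution below can be read off from the children. Hence
constantly many operations restore the arrays (`Plan.refresh_inv`). As every stored value extends to a
solution, nested loops over the stored values of the free variables never run into a dead end, and the
delay is constant (`Plan.enum_exec`, `Plan.answerCode_exec`).

*Queries whose dynamic variables occur in static atoms.* Only those dynamic tuples matter that are
compatible with a match of the static sub-query, and by the bound of Atserias, Grohe and Marx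
(`card_le_prod_rpow`, from a form of Hölder's inequality) there are `m = O(N ^ ρ*)` of them. They get
the powers of two below `2 ^ m` as weights. The sum of the weights of the tuples that are present is
the current state, which an update changes by an addition or a subtraction. For each of the `2 ^ m`
states the preprocessing stores all answers in a trie, whose first level is the number of the state
(`statesCode_exec`), and an enumeration walks through the branch of the current state.

Both data structures are initialized for empty dynamic relations by loops over all combinations of
tuples for the static atoms, and the initial dynamic tuples are then inserted one by one
(`exists_maintenance`). As no relation of a static atom has more than about `N ^ ρ*` tuples
(`CQ.card_le_sizeBound`), the loops take a number of steps that is polynomial in `N ^ ρ*`, times `2 ^ m` in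
the second case. Such a number is at most `2 ^ p N` for some `p` of the order of `N ^ ρ*`
(`CQ.exists_time_bound`).
-/

/-! ### Runs of the machine -/

theorem Run.trans {k₁ k₂ k₃ : List Prog} {σ₁ σ₂ σ₃ : Mem} {t₁ t₂ : List Event}
    (h₁ : Run k₁ σ₁ t₁ k₂ σ₂) (h₂ : Run k₂ σ₂ t₂ k₃ σ₃) : Run k₁ σ₁ (t₁ ++ t₂) k₃ σ₃ := by
  induction h₁ with
  | refl => exact h₂
  | head hs _ ih => exact .head hs (ih h₂)

theorem Run.single {k₁ k₂ : List Prog} {σ₁ σ₂ : Mem} {e : Event}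
    (h : Prog.step k₁ σ₁ = some (e, k₂, σ₂)) : Run k₁ σ₁ [e] k₂ σ₂ :=
  .head h (.refl _ _)

/-- A run up to the end of the program is determined by its starting point. -/
theorem Run.unique {k : List Prog} {σ σ₁ σ₂ : Mem} {t₁ t₂ : List Event}
    (h₁ : Run k σ t₁ [] σ₁) (h₂ : Run k σ t₂ [] σ₂) : t₁ = t₂ ∧ σ₁ = σ₂ := by
  generalize hk : ([] : List Prog) = k' at h₁
  induction h₁ generalizing t₂ with
  | refl k σ =>
    subst hk
    cases h₂ with
    | refl => exact ⟨rfl, rfl⟩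
    | head hs _ => simp [Prog.step] at hs
  | head hs _ ih =>
    cases h₂ with
    | refl => simp [Prog.step] at hs
    | head hs' h' =>
      rw [hs] at hs'
      simp only [Option.some.injEq, Prod.mk.injEq] at hs'
      obtain ⟨rfl, rfl, rfl⟩ := hs'
      obtain ⟨rfl, rfl⟩ := ih h' hk
      exact ⟨rfl, rfl⟩

namespace Prog

/-- `p.Exec σ tr σ'`: the program `p`, started in memory `σ`, runs to its end, with events `tr` and
final memory `σ'`, whatever remains to be executed afterwards. -/
def Exec (p : Prog) (σ : Mem) (tr : List Event) (σ' : Mem) : Prop :=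
  ∀ k, Run (p :: k) σ tr k σ'

/-- The registers that occur as a target of an assignment in the program. -/
def Writes : Prog → ℕ → Prop
  | const x _, y => y = x
  | add x _ _, y => y = x
  | sub x _ _, y => y = x
  | load x _ _, y => y = x
  | store _ _ _, _ => False
  | emit _, _ => False
  | seq p q, y => p.Writes y ∨ q.Writes y
  | ite _ _ p q, y => p.Writes y ∨ q.Writes y
  | whl _ _ p, y => p.Writes y

/-- The arrays that occur as a target of an assignment in the program. -/
def Stores : Prog → ℕ → Prop
  | store A _ _, B => B = A
  | seq p q, B => p.Stores B ∨ q.Stores B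
  | ite _ _ p q, B => p.Stores B ∨ q.Stores B
  | whl _ _ p, B => p.Stores B
  | _, _ => False

/-- Programs without loops and without output. -/
def Simple : Prog → Prop
  | emit _ => False
  | whl _ _ _ => False
  | seq p q => p.Simple ∧ q.Simple
  | ite _ _ p q => p.Simple ∧ q.Simple
  | _ => True

/-- The effect on the memory of a program without loops (loops are treated as doing nothing). -/
def eval : Prog → Mem → Mem
  | const x n, σ => σ.setReg x n
  | add x y z, σ => σ.setReg x (σ.reg y + σ.reg z)
  | sub x y z, σ => σ.setReg x (σ.reg y - σ.reg z)
  | load x A is, σ => σ.setReg x (σ.arr A (is.map σ.reg))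
  | store A is x, σ => σ.setArr A (is.map σ.reg) (σ.reg x)
  | emit _, σ => σ
  | seq p q, σ => q.eval (p.eval σ)
  | ite x y p q, σ => if σ.reg x < σ.reg y then p.eval σ else q.eval σ
  | whl _ _ _, σ => σ

/-- The number of instructions of a program. -/
def size : Prog → ℕ
  | seq p q => p.size + q.size + 1
  | ite _ _ p q => p.size + q.size + 1
  | whl _ _ p => p.size + 1
  | _ => 1

end Prog

theorem Run.reg_eq {k k' : List Prog} {σ σ' : Mem} {tr : List Event} {x : ℕ}
    (h : Run k σ tr k' σ') (hx : ∀ p ∈ k, ¬ p.Writes x) : σ'.reg x = σ.reg x := by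
  induction h with
  | refl => rfl
  | @head k _ _ σ _ _ _ _ hs _ ih =>
    cases k with
    | nil => simp [Prog.step] at hs
    | cons p k =>
      simp only [List.mem_cons, forall_eq_or_imp] at hx
      obtain ⟨hp, hk⟩ := hx
      cases p <;> simp only [Prog.step, Option.some.injEq, Prod.mk.injEq] at hs <;>
        obtain ⟨rfl, rfl, rfl⟩ := hs <;> simp only [Prog.Writes] at hp
      case seq =>
        rw [ih]
        simp only [List.mem_cons, forall_eq_or_imp]
        tauto
      case ite =>
        rw [ih]
        simp only [List.mem_cons, forall_eq_or_imp]
        split_ifs <;> tauto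
      case whl =>
        rw [ih]
        split_ifs
        · simp only [List.mem_cons, forall_eq_or_imp, Prog.Writes]
          tauto
        · exact hk
      all_goals
        simp [ih hk, Mem.setReg, Mem.setArr, hp]

theorem Run.arr_eq {k k' : List Prog} {σ σ' : Mem} {tr : List Event} {A : ℕ}
    (h : Run k σ tr k' σ') (hx : ∀ p ∈ k, ¬ p.Stores A) : σ'.arr A = σ.arr A := by
  induction h with
  | refl => rfl
  | @head k _ _ σ _ _ _ _ hs _ ih =>
    cases k with
    | nil => simp [Prog.step] at hs
    | cons p k =>
      simp only [List.mem_cons, forall_eq_or_imp] at hx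
      obtain ⟨hp, hk⟩ := hx
      cases p <;> simp only [Prog.step, Option.some.injEq, Prod.mk.injEq] at hs <;>
        obtain ⟨rfl, rfl, rfl⟩ := hs <;> simp only [Prog.Stores] at hp
      case seq =>
        rw [ih]
        simp only [List.mem_cons, forall_eq_or_imp]
        tauto
      case ite =>
        rw [ih]
        simp only [List.mem_cons, forall_eq_or_imp]
        split_ifs <;> tauto
      case whl =>
        rw [ih]
        split_ifs
        · simp only [List.mem_cons, forall_eq_or_imp, Prog.Stores]
          tauto
        · exact hk
      all_goals
        simp [ih hk, Mem.setReg, Mem.setArr, hp]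

namespace Prog

theorem Exec.run {p : Prog} {σ σ' : Mem} {tr : List Event} (h : p.Exec σ tr σ') :
    Run [p] σ tr [] σ' := h []

theorem Exec.reg_eq {p : Prog} {σ σ' : Mem} {tr : List Event} {x : ℕ} (h : p.Exec σ tr σ')
    (hx : ¬ p.Writes x) : σ'.reg x = σ.reg x :=
  h.run.reg_eq (by simpa using hx)

theorem Exec.arr_eq {p : Prog} {σ σ' : Mem} {tr : List Event} {A : ℕ} (h : p.Exec σ tr σ')
    (hx : ¬ p.Stores A) : σ'.arr A = σ.arr A :=
  h.run.arr_eq (by simpa using hx)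

theorem Exec.seq {p q : Prog} {σ σ₁ σ₂ : Mem} {t₁ t₂ : List Event} (hp : p.Exec σ t₁ σ₁)
    (hq : q.Exec σ₁ t₂ σ₂) : (p.seq q).Exec σ (none :: (t₁ ++ t₂)) σ₂ :=
  fun k => .head rfl ((hp _).trans (hq k))

theorem Exec.ite_pos {x y : ℕ} {p q : Prog} {σ σ' : Mem} {tr : List Event}
    (h : σ.reg x < σ.reg y) (hp : p.Exec σ tr σ') : (ite x y p q).Exec σ (none :: tr) σ' :=
  fun k => .head (by simp only [step, if_pos h]) (hp k)

theorem Exec.ite_neg {x y : ℕ} {p q : Prog} {σ σ' : Mem} {tr : List Event}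
    (h : ¬ σ.reg x < σ.reg y) (hp : q.Exec σ tr σ') : (ite x y p q).Exec σ (none :: tr) σ' :=
  fun k => .head (by simp only [step, if_neg h]) (hp k)

theorem Exec.whl_pos {x y : ℕ} {p : Prog} {σ σ₁ σ₂ : Mem} {t₁ t₂ : List Event}
    (h : σ.reg x < σ.reg y) (hp : p.Exec σ t₁ σ₁) (hw : (whl x y p).Exec σ₁ t₂ σ₂) :
    (whl x y p).Exec σ (none :: (t₁ ++ t₂)) σ₂ :=
  fun k => .head (by simp only [step, if_pos h]) ((hp _).trans (hw k))

theorem Exec.whl_neg {x y : ℕ} {p : Prog} {σ : Mem} (h : ¬ σ.reg x < σ.reg y) :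
    (whl x y p).Exec σ [none] σ :=
  fun k => .head (by simp only [step, if_neg h]) (.refl _ _)

theorem Simple.exec {p : Prog} (hp : p.Simple) (σ : Mem) :
    ∃ n ≤ p.size, p.Exec σ (List.replicate n none) (p.eval σ) := by
  induction p generalizing σ with
  | emit | whl => exact hp.elim
  | seq p q ihp ihq =>
    obtain ⟨n, hn, h⟩ := ihp hp.1 σ
    obtain ⟨n', hn', h'⟩ := ihq hp.2 (p.eval σ)
    refine ⟨n + n' + 1, by simp only [size]; omega, ?_⟩
    rw [List.replicate_succ, List.replicate_add]
    exact h.seq h'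
  | ite x y p q ihp ihq =>
    by_cases hc : σ.reg x < σ.reg y
    · obtain ⟨n, hn, h⟩ := ihp hp.1 σ
      refine ⟨n + 1, by simp only [size]; omega, ?_⟩
      rw [List.replicate_succ, eval, if_pos hc]
      exact h.ite_pos hc
    · obtain ⟨n, hn, h⟩ := ihq hp.2 σ
      refine ⟨n + 1, by simp only [size]; omega, ?_⟩
      rw [List.replicate_succ, eval, if_neg hc]
      exact h.ite_neg hc
  | _ => exact ⟨1, le_rfl, fun k => .single rfl⟩

theorem Simple.eval_reg {p : Prog} (hp : p.Simple) (σ : Mem) {x : ℕ} (hx : ¬ p.Writes x) :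
    (p.eval σ).reg x = σ.reg x := by
  obtain ⟨_, _, h⟩ := hp.exec σ
  exact h.reg_eq hx

theorem Simple.eval_arr {p : Prog} (hp : p.Simple) (σ : Mem) {A : ℕ} (hx : ¬ p.Stores A) :
    (p.eval σ).arr A = σ.arr A := by
  obtain ⟨_, _, h⟩ := hp.exec σ
  exact h.arr_eq hx

/-- The bounded loop: `body` is executed with register `i` running from `0` up to the content of
register `n`, exclusively. The register `o` has to hold the number `1`. -/
def forLoop (o i n : ℕ) (body : Prog) : Prog :=
  seq (const i 0) (whl i n (seq body (add i i o)))

end Prog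

@[simp] theorem Mem.setReg_reg (σ : Mem) (x v y : ℕ) :
    (σ.setReg x v).reg y = if y = x then v else σ.reg y := by
  simp [Mem.setReg, Function.update_apply]

@[simp] theorem Mem.setReg_arr (σ : Mem) (x v : ℕ) : (σ.setReg x v).arr = σ.arr := rfl

@[simp] theorem Mem.setArr_reg (σ : Mem) (A : ℕ) (i : List ℕ) (v : ℕ) :
    (σ.setArr A i v).reg = σ.reg := rfl

@[simp] theorem Mem.setArr_arr_apply (σ : Mem) (A : ℕ) (i : List ℕ) (v B : ℕ) (j : List ℕ) :
    (σ.setArr A i v).arr B j = if B = A ∧ j = i then v else σ.arr B j := by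
  simp only [Mem.setArr, Function.update_apply]
  by_cases h : B = A
  · subst h
    by_cases hj : j = i <;> simp [hj]
  · simp [h]

namespace Prog

theorem Exec.const (x n : ℕ) (σ : Mem) : (const x n).Exec σ [none] (σ.setReg x n) :=
  fun _ => .single rfl

theorem Exec.add (x y z : ℕ) (σ : Mem) :
    (add x y z).Exec σ [none] (σ.setReg x (σ.reg y + σ.reg z)) :=
  fun _ => .single rfl

theorem Exec.load (x A : ℕ) (is : List ℕ) (σ : Mem) :
    (load x A is).Exec σ [none] (σ.setReg x (σ.arr A (is.map σ.reg))) :=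
  fun _ => .single rfl

theorem Exec.emit (xs : List ℕ) (σ : Mem) : (emit xs).Exec σ [some (xs.map σ.reg)] σ :=
  fun _ => .single rfl

/-- Invariant rule for `forLoop`, with a bound on the number of steps. -/
theorem exec_forLoop {o i n : ℕ} {body : Prog} {N T : ℕ} (I : ℕ → Mem → Prop)
    (hio : i ≠ o) (hin : i ≠ n) (hwi : ¬ body.Writes i) (hwn : ¬ body.Writes n)
    (hwo : ¬ body.Writes o)
    (hI : ∀ j σ v, I j σ → I j (σ.setReg i v))
    (hbody : ∀ j < N, ∀ σ, I j σ → σ.reg i = j → σ.reg o = 1 →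
      ∃ tr σ', body.Exec σ tr σ' ∧ tr.length ≤ T ∧ I (j + 1) σ')
    (σ : Mem) (h0 : I 0 σ) (hn : σ.reg n = N) (ho : σ.reg o = 1) :
    ∃ tr σ', (forLoop o i n body).Exec σ tr σ' ∧ tr.length ≤ N * (T + 3) + 3 ∧ I N σ' := by
  have key : ∀ d j σ, d + j = N → I j σ → σ.reg i = j → σ.reg n = N → σ.reg o = 1 →
      ∃ tr σ', (whl i n (seq body (add i i o))).Exec σ tr σ' ∧
        tr.length ≤ d * (T + 3) + 1 ∧ I N σ' := by
    intro d
    induction d with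
    | zero =>
      intro j σ hd hj hi hn _
      obtain rfl : j = N := by omega
      exact ⟨_, _, Exec.whl_neg (by omega), by simp, hj⟩
    | succ d ih =>
      intro j σ hd hj hi hn ho
      obtain ⟨t, σ₁, he, ht, hj'⟩ := hbody j (by omega) σ hj hi ho
      have e1 := he.reg_eq hwi
      have e2 := he.reg_eq hwn
      have e3 := he.reg_eq hwo
      obtain ⟨t', σ₂, he', ht', hN⟩ := ih (j + 1) (σ₁.setReg i (σ₁.reg i + σ₁.reg o)) (by omega)
        (hI _ _ _ hj') (by simp; omega) (by simp [Ne.symm hin]; omega)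
        (by simp [Ne.symm hio]; omega)
      refine ⟨_, _, Exec.whl_pos (by omega) (he.seq (Exec.add _ _ _ _)) he', ?_, hN⟩
      simp only [List.length_cons, List.length_append, List.length_nil]
      nlinarith
  obtain ⟨t, σ', he, ht, hN⟩ := key N 0 (σ.setReg i 0) rfl (hI _ _ _ h0) (by simp)
    (by simp [Ne.symm hin, hn]) (by simp [Ne.symm hio, ho])
  refine ⟨_, _, (Exec.const i 0 σ).seq he, ?_, hN⟩
  simp only [List.length_cons, List.length_append, List.length_nil]
  omega

end Prog

/-! ### Names of registers and arrays -/

/-- The registers used by the maintenance programs besides those that hold a request. -/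
inductive Rg where
  /-- holds the number `1` -/
  | one
  /-- holds the answer of an emptiness test -/
  | ans
  /-- temporary storage -/
  | tmp₁ | tmp₂ | tmp₃
  /-- the number of states, a power of two -/
  | top
  /-- the value of a query variable -/
  | var (x : ℕ)
  /-- position in the list of values of a query variable, and length of that list -/
  | idx (x : ℕ) | bnd (x : ℕ)
  /-- position in the list of tuples of an atom, and length of that list -/
  | aidx (a : ℕ) | abnd (a : ℕ)

/-- The number of a register. Numbers below the base `b` remain free for requests. -/
def Rg.code (b : ℕ) : Rg → ℕ
  | one => b
  | ans => b + 1
  | tmp₁ => b + 2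
  | tmp₂ => b + 3
  | tmp₃ => b + 4
  | top => b + 5
  | var x => b + 6 + 5 * x
  | idx x => b + 7 + 5 * x
  | bnd x => b + 8 + 5 * x
  | aidx x => b + 9 + 5 * x
  | abnd x => b + 10 + 5 * x

theorem Rg.le_code (b : ℕ) (r : Rg) : b ≤ r.code b := by
  cases r <;> simp only [Rg.code] <;> omega

@[simp] theorem Rg.code_inj {b : ℕ} {r r' : Rg} : r.code b = r'.code b ↔ r = r' := by
  refine ⟨fun h => ?_, fun h => h ▸ rfl⟩
  cases r <;> cases r' <;> simp only [Rg.code] at h <;> first | rfl | omega | (congr 1; omega)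

/-- The arrays used by the maintenance programs besides those that hold the input. -/
inductive Ar where
  /-- for a query variable: lists of values, their lengths, and the positions of the values -/
  | list (x : ℕ) | cnt (x : ℕ) | pos (x : ℕ)
  /-- characteristic function of a relation at a leaf of a plan -/
  | bit (a : ℕ)
  /-- weights and presence of the tuples of a dynamic relation -/
  | weight (r : ℕ) | pres (r : ℕ)
  /-- the number of the current state -/
  | state
  /-- halves of powers of two, and binary digits of a number -/
  | half | digit

/-- The number of an array. Numbers below the base `b` remain free for the input. -/
def Ar.code (b : ℕ) : Ar → ℕ
  | state => b
  | half => b + 1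
  | digit => b + 2
  | list x => b + 3 + 6 * x
  | cnt x => b + 4 + 6 * x
  | pos x => b + 5 + 6 * x
  | bit x => b + 6 + 6 * x
  | weight x => b + 7 + 6 * x
  | pres x => b + 8 + 6 * x

theorem Ar.le_code (b : ℕ) (r : Ar) : b ≤ r.code b := by
  cases r <;> simp only [Ar.code] <;> omega

@[simp] theorem Ar.code_inj {b : ℕ} {r r' : Ar} : r.code b = r'.code b ↔ r = r' := by
  refine ⟨fun h => ?_, fun h => h ▸ rfl⟩
  cases r <;> cases r' <;> simp only [Ar.code] at h <;> first | rfl | omega | (congr 1; omega)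

/-- The valuation of the query variables that is stored in the registers. -/
def Mem.env (b : ℕ) (σ : Mem) (x : ℕ) : ℕ := σ.reg ((Rg.var x).code b)

/-- The registers of a list of variables. -/
def vregs (b : ℕ) (l : List ℕ) : List ℕ := l.map fun x => (Rg.var x).code b

@[simp] theorem map_vregs (b : ℕ) (l : List ℕ) (σ : Mem) :
    (vregs b l).map σ.reg = l.map (σ.env b) := by
  simp [vregs, Mem.env, Function.comp_def]

@[simp] theorem Mem.env_setReg (b : ℕ) (σ : Mem) (r : Rg) (v : ℕ) (h : ∀ x, r ≠ .var x) :
    (σ.setReg (r.code b) v).env b = σ.env b := by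
  funext x
  simp [Mem.env, (h x).symm]

@[simp] theorem Mem.env_setReg_var (b : ℕ) (σ : Mem) (x v : ℕ) :
    (σ.setReg ((Rg.var x).code b) v).env b = Function.update (σ.env b) x v := by
  funext y
  simp [Mem.env, Function.update_apply]

@[simp] theorem Mem.env_setArr (b : ℕ) (σ : Mem) (A : ℕ) (i : List ℕ) (v : ℕ) :
    (σ.setArr A i v).env b = σ.env b := rfl

/-! ### Indexed sets with constant-time insertion and removal -/

infixr:60 " ;; " => Prog.seq

/-- The arrays of the variable `x` represent, at the key `k`, the finite set `s`: the cells
`[k, 0], …, [k, n - 1]` of `list x`, where `n` is cell `k` of `cnt x`, enumerate `s` without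
repetition, and cell `[k, v]` of `pos x` is `0` if `v ∉ s` and `i + 1` if `v` has position `i`. -/
structure SetRep (b : ℕ) (m : ℕ → List ℕ → ℕ) (x : ℕ) (k : List ℕ) (s : Set ℕ) : Prop where
  mem_iff : ∀ v, v ∈ s ↔ m ((Ar.pos x).code b) (k ++ [v]) ≠ 0
  pos_iff : ∀ v i, m ((Ar.pos x).code b) (k ++ [v]) = i + 1 ↔
    i < m ((Ar.cnt x).code b) k ∧ m ((Ar.list x).code b) (k ++ [i]) = v

namespace SetRep

variable {b : ℕ} {m m' : ℕ → List ℕ → ℕ} {x : ℕ} {k : List ℕ} {s : Set ℕ}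

theorem mem_iff_exists (h : SetRep b m x k s) (v : ℕ) :
    v ∈ s ↔ ∃ i < m ((Ar.cnt x).code b) k, m ((Ar.list x).code b) (k ++ [i]) = v := by
  rw [h.mem_iff]
  refine ⟨fun h0 => ?_, fun ⟨i, hi⟩ => ?_⟩
  · obtain ⟨i, hi⟩ := Nat.exists_eq_add_one_of_ne_zero h0
    exact ⟨i, (h.pos_iff v i).1 hi⟩
  · have := (h.pos_iff v i).2 hi
    omega

theorem list_inj (h : SetRep b m x k s) {i j : ℕ} (hi : i < m ((Ar.cnt x).code b) k)
    (hj : j < m ((Ar.cnt x).code b) k)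
    (hij : m ((Ar.list x).code b) (k ++ [i]) = m ((Ar.list x).code b) (k ++ [j])) : i = j := by
  have h₁ := (h.pos_iff _ _).2 ⟨hi, rfl⟩
  have h₂ := (h.pos_iff _ _).2 ⟨hj, rfl⟩
  rw [hij] at h₁
  omega

theorem cnt_ne_zero_iff (h : SetRep b m x k s) : m ((Ar.cnt x).code b) k ≠ 0 ↔ s.Nonempty := by
  constructor
  · intro h0
    exact ⟨_, (h.mem_iff_exists _).2 ⟨0, Nat.pos_of_ne_zero h0, rfl⟩⟩
  · rintro ⟨v, hv⟩
    obtain ⟨i, hi, _⟩ := (h.mem_iff_exists v).1 hv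
    omega

theorem congr (h : SetRep b m x k s) (hp : m' ((Ar.pos x).code b) = m ((Ar.pos x).code b))
    (hc : m' ((Ar.cnt x).code b) = m ((Ar.cnt x).code b))
    (hl : m' ((Ar.list x).code b) = m ((Ar.list x).code b)) : SetRep b m' x k s :=
  ⟨fun v => by rw [hp]; exact h.mem_iff v, fun v i => by rw [hp, hc, hl]; exact h.pos_iff v i⟩

theorem empty (hp : ∀ l, m ((Ar.pos x).code b) l = 0) (hc : ∀ l, m ((Ar.cnt x).code b) l = 0) :
    SetRep b m x k ∅ :=
  ⟨by simp [hp], by simp [hp, hc]⟩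

end SetRep

/-- An instruction without relevant effect. -/
def skipCode (b : ℕ) : Prog := .const (Rg.tmp₁.code b) 0

/-- Append the value of `x` to the set of `x` at the key. -/
def insertCode (b x : ℕ) (key : List ℕ) : Prog :=
  .load (Rg.tmp₂.code b) ((Ar.cnt x).code b) (vregs b key) ;;
  .store ((Ar.list x).code b) (vregs b key ++ [Rg.tmp₂.code b]) ((Rg.var x).code b) ;;
  .add (Rg.tmp₂.code b) (Rg.tmp₂.code b) (Rg.one.code b) ;;
  .store ((Ar.cnt x).code b) (vregs b key) (Rg.tmp₂.code b) ;;
  .store ((Ar.pos x).code b) (vregs b key ++ [(Rg.var x).code b]) (Rg.tmp₂.code b)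

/-- Remove the value of `x` from the set of `x` at the key: the last element takes its place.
Register `tmp₁` has to hold the entry of the value in the array `pos x`. -/
def removeCode (b x : ℕ) (key : List ℕ) : Prog :=
  .load (Rg.tmp₂.code b) ((Ar.cnt x).code b) (vregs b key) ;;
  .sub (Rg.tmp₂.code b) (Rg.tmp₂.code b) (Rg.one.code b) ;;
  .store ((Ar.cnt x).code b) (vregs b key) (Rg.tmp₂.code b) ;;
  .load (Rg.tmp₃.code b) ((Ar.list x).code b) (vregs b key ++ [Rg.tmp₂.code b]) ;;
  .store ((Ar.pos x).code b) (vregs b key ++ [Rg.tmp₃.code b]) (Rg.tmp₁.code b) ;;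
  .sub (Rg.tmp₁.code b) (Rg.tmp₁.code b) (Rg.one.code b) ;;
  .store ((Ar.list x).code b) (vregs b key ++ [Rg.tmp₁.code b]) (Rg.tmp₃.code b) ;;
  .const (Rg.tmp₁.code b) 0 ;;
  .store ((Ar.pos x).code b) (vregs b key ++ [(Rg.var x).code b]) (Rg.tmp₁.code b)

/-- Make the value of `x` a member of the set of `x` at the key if register `ans` is not `0`, and
a non-member otherwise. -/
def syncCode (b x : ℕ) (key : List ℕ) : Prog :=
  .load (Rg.tmp₁.code b) ((Ar.pos x).code b) (vregs b key ++ [(Rg.var x).code b]) ;;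
  .ite (Rg.ans.code b) (Rg.one.code b)
    (.ite (Rg.tmp₁.code b) (Rg.one.code b) (skipCode b) (removeCode b x key))
    (.ite (Rg.tmp₁.code b) (Rg.one.code b) (insertCode b x key) (skipCode b))

theorem syncCode_simple (b x : ℕ) (key : List ℕ) : (syncCode b x key).Simple := by
  simp [syncCode, Prog.Simple, skipCode, removeCode, insertCode]

theorem syncCode_writes {b x : ℕ} {key : List ℕ} {y : ℕ} (h : (syncCode b x key).Writes y) :
    y = Rg.tmp₁.code b ∨ y = Rg.tmp₂.code b ∨ y = Rg.tmp₃.code b := by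
  simp only [syncCode, Prog.Writes, skipCode, removeCode, insertCode] at h
  tauto

theorem syncCode_stores {b x : ℕ} {key : List ℕ} {A : ℕ} (h : (syncCode b x key).Stores A) :
    A = (Ar.pos x).code b ∨ A = (Ar.cnt x).code b ∨ A = (Ar.list x).code b := by
  simp only [syncCode, Prog.Stores, skipCode, removeCode, insertCode] at h
  tauto

theorem insertCode_setRep {b x : ℕ} {key : List ℕ} {σ : Mem} {s : Set ℕ}
    (h1 : σ.reg (Rg.one.code b) = 1) (hs : SetRep b σ.arr x (key.map (σ.env b)) s)
    (hx : σ.env b x ∉ s) :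
    SetRep b ((insertCode b x key).eval σ).arr x (key.map (σ.env b)) (insert (σ.env b x) s) := by
  obtain ⟨hA, hB⟩ := hs
  have h0 : σ.arr ((Ar.pos x).code b) (key.map (σ.env b) ++ [σ.env b x]) = 0 := by
    simpa using (hA _).not.1 hx
  have hv : σ.reg ((Rg.var x).code b) = σ.env b x := rfl
  constructor
  · intro v
    have := hA v
    by_cases hvx : v = σ.env b x <;> simp [insertCode, Prog.eval, hv, hvx, this, h1]
  · intro v i
    have := hB v i
    have := hB v (σ.arr ((Ar.cnt x).code b) (key.map (σ.env b)))
    by_cases hvx : v = σ.env b x <;>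
      by_cases hi : i = σ.arr ((Ar.cnt x).code b) (key.map (σ.env b)) <;>
      simp [insertCode, Prog.eval, hv, hvx, hi, h1] <;> grind

theorem removeCode_setRep {b x : ℕ} {key : List ℕ} {σ : Mem} {s : Set ℕ}
    (h1 : σ.reg (Rg.one.code b) = 1) (hs : SetRep b σ.arr x (key.map (σ.env b)) s)
    (hx : σ.env b x ∈ s)
    (ht : σ.reg (Rg.tmp₁.code b) =
      σ.arr ((Ar.pos x).code b) (key.map (σ.env b) ++ [σ.env b x])) :
    SetRep b ((removeCode b x key).eval σ).arr x (key.map (σ.env b)) (s \ {σ.env b x}) := by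
  obtain ⟨hA, hB⟩ := hs
  have h0 := (hA _).1 hx
  obtain ⟨p, hp⟩ := Nat.exists_eq_add_one_of_ne_zero h0
  obtain ⟨hp₁, hp₂⟩ := (hB _ _).1 hp
  have hv : σ.reg ((Rg.var x).code b) = σ.env b x := rfl
  rw [hp] at ht
  obtain ⟨n, hn⟩ : ∃ n, σ.arr ((Ar.cnt x).code b) (key.map (σ.env b)) = n + 1 :=
    ⟨_, (Nat.succ_pred_eq_of_pos (by omega)).symm⟩
  have hlast := (hB (σ.arr ((Ar.list x).code b) (key.map (σ.env b) ++ [n])) n).2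
    ⟨by omega, rfl⟩
  constructor
  · intro v
    have := hA v
    simp [removeCode, Prog.eval, hv, this, ht, h1, hn]
    grind
  · intro v i
    have := hB v i
    have := hB v p
    have := hB v n
    simp [removeCode, Prog.eval, hv, ht, h1, hn]
    grind

/-- `syncCode` inserts or removes the current value, as register `ans` says. -/
theorem syncCode_setRep {b x : ℕ} {key : List ℕ} {σ : Mem} {s s' : Set ℕ}
    (h1 : σ.reg (Rg.one.code b) = 1) (hs : SetRep b σ.arr x (key.map (σ.env b)) s)
    (hx : σ.env b x ∈ s' ↔ σ.reg (Rg.ans.code b) ≠ 0)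
    (hs' : ∀ v, v ≠ σ.env b x → (v ∈ s' ↔ v ∈ s)) :
    SetRep b ((syncCode b x key).eval σ).arr x (key.map (σ.env b)) s' := by
  have hv : σ.reg ((Rg.var x).code b) = σ.env b x := rfl
  have hm := hs.mem_iff (σ.env b x)
  set σ₁ := σ.setReg (Rg.tmp₁.code b)
    (σ.arr ((Ar.pos x).code b) (key.map (σ.env b) ++ [σ.env b x])) with hσ₁
  have e₁ : σ₁.env b = σ.env b := by simp [hσ₁]
  have hs₁ : SetRep b σ₁.arr x (key.map (σ₁.env b)) s := by rw [e₁]; exact hs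
  by_cases ha : σ.reg (Rg.ans.code b) = 0 <;> by_cases hp : σ.env b x ∈ s
  · have : s' = s \ {σ.env b x} := by ext v; grind
    have key' := removeCode_setRep (by simp [hσ₁, h1]) hs₁ (by rwa [e₁]) (by simp [hσ₁])
    have h0 := hm.1 hp
    rw [e₁] at key'
    simpa [syncCode, Prog.eval, ha, h1, hv, h0, this] using key'
  · have : s' = s := by ext v; grind
    have h0 := hm.not.1 hp
    simp only [ne_eq, not_not] at h0
    simpa [syncCode, skipCode, Prog.eval, ha, h1, hv, h0, this] using hs
  · have : s' = s := by ext v; grind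
    have h0 := hm.1 hp
    simpa [syncCode, skipCode, Prog.eval, ha, h1, hv, h0, this] using hs
  · have : s' = insert (σ.env b x) s := by ext v; grind
    have key' := insertCode_setRep (by simp [hσ₁, h1]) hs₁ (by rwa [e₁])
    have h0 := hm.not.1 hp
    simp only [ne_eq, not_not] at h0
    rw [e₁, hσ₁, h0] at key'
    simpa [syncCode, Prog.eval, ha, h1, hv, h0, this] using key'

theorem syncCode_setRep_of_ne {b x : ℕ} {key k : List ℕ} {σ : Mem} {s : Set ℕ}
    (hk : k.length = key.length) (hne : k ≠ key.map (σ.env b)) (hs : SetRep b σ.arr x k s) :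
    SetRep b ((syncCode b x key).eval σ).arr x k s := by
  have hne' : ∀ v w, k ++ [v] ≠ key.map (σ.env b) ++ [w] := fun v w h =>
    hne (List.append_inj_left h (by simpa using hk))
  have e : ∀ v, ((syncCode b x key).eval σ).arr ((Ar.pos x).code b) (k ++ [v]) =
        σ.arr ((Ar.pos x).code b) (k ++ [v]) ∧
      ((syncCode b x key).eval σ).arr ((Ar.list x).code b) (k ++ [v]) =
        σ.arr ((Ar.list x).code b) (k ++ [v]) ∧
      ((syncCode b x key).eval σ).arr ((Ar.cnt x).code b) k =
        σ.arr ((Ar.cnt x).code b) k := by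
    intro v
    by_cases h₁ : σ.reg (Rg.ans.code b) < σ.reg (Rg.one.code b) <;>
      by_cases h₂ : σ.arr ((Ar.pos x).code b)
        (key.map (σ.env b) ++ [σ.reg ((Rg.var x).code b)]) < σ.reg (Rg.one.code b) <;>
      simp [syncCode, Prog.eval, skipCode, removeCode, insertCode, h₁, h₂, hne', hne]
  refine ⟨fun v => ?_, fun v i => ?_⟩
  · rw [(e v).1]; exact hs.mem_iff v
  · rw [(e v).1, (e i).2.1, (e i).2.2]; exact hs.pos_iff v i

/-! ### Plans -/

/-- A plan describes how a query is evaluated along nested variables. A leaf is a stored relation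
`a` with a list of arguments; `bind fr x key p` stands for the values of the variable `x`, free in
the query or not according to `fr`, for which `p` has a solution. These values depend on those of
the variables `key`, and they are stored in the arrays of `x`. -/
inductive Plan where
  | leaf (a : ℕ) (args : List ℕ)
  | join (p q : Plan)
  | bind (fr : Bool) (x : ℕ) (key : List ℕ) (p : Plan)

namespace Plan

/-- The variables whose values have to be given. -/
def fv : Plan → List ℕ
  | leaf _ args => args
  | join p q => p.fv ++ q.fv
  | bind _ _ key _ => key

/-- The variables that are bound in the plan. -/
def bvars : Plan → List ℕ
  | leaf _ _ => []
  | join p q => p.bvars ++ q.bvars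
  | bind _ x _ p => x :: p.bvars

/-- The variables for which the plan produces values: no value is produced below a variable that
is not free in the query. -/
def outs : Plan → List ℕ
  | leaf _ _ => []
  | join p q => p.outs ++ q.outs
  | bind true x _ p => x :: p.outs
  | bind false _ _ _ => []

/-- The names of the leaves. -/
def leaves : Plan → List ℕ
  | leaf a _ => [a]
  | join p q => p.leaves ++ q.leaves
  | bind _ _ _ p => p.leaves

/-- Well-formedness: the scopes of variables are respected, and no variable and no leaf name is used
twice. -/
def WF : Plan → Prop
  | leaf _ _ => True
  | join p q => p.WF ∧ q.WF ∧ p.bvars.Disjoint q.bvars ∧ p.bvars.Disjoint q.fv ∧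
      q.bvars.Disjoint p.fv ∧ p.leaves.Disjoint q.leaves
  | bind _ x key p => p.WF ∧ p.fv ⊆ x :: key ∧ x ∉ key ∧ x ∉ p.bvars ∧ key.Disjoint p.bvars

/-- The plan has a solution under the valuation `ν` of its given variables. -/
def Holds (b : ℕ) (m : ℕ → List ℕ → ℕ) : Plan → (ℕ → ℕ) → Prop
  | leaf a args, ν => m ((Ar.bit a).code b) (args.map ν) ≠ 0
  | join p q, ν => p.Holds b m ν ∧ q.Holds b m ν
  | bind _ x _ p, ν => ∃ v, p.Holds b m (Function.update ν x v)

/-- The valuation `μ`, restricted to the given variables and the output variables, is a solution. -/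
def Sat (b : ℕ) (m : ℕ → List ℕ → ℕ) : Plan → (ℕ → ℕ) → Prop
  | leaf a args, μ => m ((Ar.bit a).code b) (args.map μ) ≠ 0
  | join p q, μ => p.Sat b m μ ∧ q.Sat b m μ
  | bind true _ _ p, μ => p.Sat b m μ
  | bind false x key p, μ => (bind false x key p).Holds b m μ

/-- At every variable node, the arrays represent the values for which there is a solution below. -/
def Inv (b : ℕ) (m : ℕ → List ℕ → ℕ) : Plan → Prop
  | leaf _ _ => True
  | join p q => p.Inv b m ∧ q.Inv b m
  | bind _ x key p => p.Inv b m ∧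
      ∀ ν : ℕ → ℕ, SetRep b m x (key.map ν) {v | p.Holds b m (Function.update ν x v)}

variable {b : ℕ} {m m' : ℕ → List ℕ → ℕ}

theorem map_congr_of_agree {l : List ℕ} {μ ν : ℕ → ℕ} (h : ∀ x ∈ l, μ x = ν x) :
    l.map μ = l.map ν := List.map_congr_left h

theorem holds_congr_env {p : Plan} (hp : p.WF) {μ ν : ℕ → ℕ} (h : ∀ x ∈ p.fv, μ x = ν x) :
    p.Holds b m μ ↔ p.Holds b m ν := by
  induction p generalizing μ ν with
  | leaf a args => exact iff_of_eq (congrArg (fun l => m ((Ar.bit a).code b) l ≠ 0) (map_congr_of_agree h))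
  | join p q ihp ihq =>
    simp only [fv, List.mem_append] at h
    simp only [Holds, ihp hp.1 fun x hx => h x (.inl hx), ihq hp.2.1 fun x hx => h x (.inr hx)]
  | bind fr x key p ih =>
    obtain ⟨hw, hfv, -, -, -⟩ := hp
    refine exists_congr fun v => ih hw fun y hy => ?_
    rcases List.mem_cons.1 (hfv hy) with rfl | hy
    · simp
    · simp only [Function.update_apply]
      split_ifs
      · rfl
      · exact h y hy

theorem holds_congr_arr {p : Plan} {ν : ℕ → ℕ}
    (h : ∀ a ∈ p.leaves, m' ((Ar.bit a).code b) = m ((Ar.bit a).code b)) :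
    p.Holds b m' ν ↔ p.Holds b m ν := by
  induction p generalizing ν with
  | leaf a args => simp only [Holds, h a (by simp [leaves])]
  | join p q ihp ihq =>
    simp only [leaves, List.mem_append] at h
    simp only [Holds, ihp fun x hx => h x (.inl hx), ihq fun x hx => h x (.inr hx)]
  | bind fr x key p ih => exact exists_congr fun v => ih h

theorem inv_congr_arr {p : Plan}
    (h : ∀ a ∈ p.leaves, m' ((Ar.bit a).code b) = m ((Ar.bit a).code b))
    (h' : ∀ x ∈ p.bvars, m' ((Ar.pos x).code b) = m ((Ar.pos x).code b) ∧
      m' ((Ar.cnt x).code b) = m ((Ar.cnt x).code b) ∧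
      m' ((Ar.list x).code b) = m ((Ar.list x).code b))
    (hm : p.Inv b m) : p.Inv b m' := by
  induction p with
  | leaf a args => trivial
  | join p q ihp ihq =>
    simp only [leaves, bvars, List.mem_append] at h h'
    exact ⟨ihp (fun x hx => h x (.inl hx)) (fun x hx => h' x (.inl hx)) hm.1,
      ihq (fun x hx => h x (.inr hx)) (fun x hx => h' x (.inr hx)) hm.2⟩
  | bind fr x key p ih =>
    simp only [bvars, List.mem_cons, forall_eq_or_imp] at h'
    refine ⟨ih h h'.2 hm.1, fun ν => ?_⟩
    simp only [holds_congr_arr (p := p) h]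
    exact (hm.2 ν).congr h'.1.1 h'.1.2.1 h'.1.2.2

/-! ### The emptiness test -/

/-- Set register `ans` to a nonzero value if the plan has a solution, and to `0` otherwise. -/
def status (b : ℕ) : Plan → Prog
  | leaf a args => .load (Rg.ans.code b) ((Ar.bit a).code b) (vregs b args)
  | join p q => p.status b ;;
      .ite (Rg.ans.code b) (Rg.one.code b) (skipCode b) (q.status b)
  | bind _ x key _ => .load (Rg.ans.code b) ((Ar.cnt x).code b) (vregs b key)

theorem status_simple (b : ℕ) (p : Plan) : (p.status b).Simple := by
  induction p <;> simp_all [status, Prog.Simple, skipCode]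

theorem status_writes {p : Plan} {y : ℕ} (h : (p.status b).Writes y) :
    y = Rg.tmp₁.code b ∨ y = Rg.ans.code b := by
  induction p with
  | join p q ihp ihq =>
    simp only [status, Prog.Writes, skipCode] at h
    tauto
  | _ => simp only [status, Prog.Writes] at h; tauto

theorem status_stores {p : Plan} {A : ℕ} : ¬ (p.status b).Stores A := by
  induction p <;> simp_all [status, Prog.Stores, skipCode]

theorem status_arr (p : Plan) (σ : Mem) : ((p.status b).eval σ).arr = σ.arr :=
  funext fun _ => (status_simple b p).eval_arr σ status_stores

theorem status_reg (p : Plan) (σ : Mem) {r : Rg} (h₁ : r ≠ .tmp₁) (h₂ : r ≠ .ans) :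
    ((p.status b).eval σ).reg (r.code b) = σ.reg (r.code b) :=
  (status_simple b p).eval_reg σ fun h => by
    rcases status_writes h with h | h <;> simp_all

theorem status_env (p : Plan) (σ : Mem) : ((p.status b).eval σ).env b = σ.env b :=
  funext fun _ => status_reg p σ (by simp) (by simp)

theorem status_ans {p : Plan} {σ : Mem} (h1 : σ.reg (Rg.one.code b) = 1)
    (hp : p.Inv b σ.arr) :
    ((p.status b).eval σ).reg (Rg.ans.code b) ≠ 0 ↔ p.Holds b σ.arr (σ.env b) := by
  induction p generalizing σ with
  | leaf a args => simp [status, Prog.eval, Holds]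
  | bind fr x key p ih =>
    simp only [status, Prog.eval, map_vregs, Mem.setReg_reg, if_true]
    exact (hp.2 (σ.env b)).cnt_ne_zero_iff
  | join p q ihp ihq =>
    have ip := ihp h1 hp.1
    have iq := ihq (σ := (p.status b).eval σ)
      (by rw [status_reg p σ (by simp) (by simp), h1]) (by rw [status_arr]; exact hp.2)
    rw [status_arr, status_env] at iq
    have e : ((p.status b).eval σ).reg (Rg.one.code b) = 1 := by
      rw [status_reg p σ (by simp) (by simp), h1]
    simp only [status, Prog.eval, e, Holds, Nat.lt_one_iff]
    split_ifs with h0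
    · simp [skipCode, Prog.eval, h0, ← ip]
    · rw [iq, ← ip]
      simp [h0]

/-! ### Updates of a leaf -/

/-- Restore the invariant after a change at leaf `a`, for the current values of the variables:
the nodes above the leaf are treated from the bottom to the top. -/
def refresh (b a : ℕ) : Plan → Prog
  | leaf _ _ => skipCode b
  | join p q => if a ∈ p.leaves then p.refresh b a else q.refresh b a
  | bind _ x key p => p.refresh b a ;; p.status b ;; syncCode b x key

/-- All variable nodes above leaf `a` have their variables among the arguments of the leaf. -/
def Path (a : ℕ) (args : List ℕ) : Plan → Prop
  | leaf a' args' => a' = a → args' = args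
  | join p q => p.Path a args ∧ q.Path a args
  | bind _ x key p => p.Path a args ∧ (a ∈ p.leaves → x ∈ args ∧ key ⊆ args)

theorem refresh_simple (b a : ℕ) (p : Plan) : (p.refresh b a).Simple := by
  induction p with
  | leaf => trivial
  | join p q ihp ihq =>
    simp only [refresh]
    split_ifs <;> assumption
  | bind fr x key p ih => exact ⟨ih, status_simple b p, syncCode_simple b x key⟩

theorem refresh_writes {a : ℕ} {p : Plan} {y : ℕ} (h : (p.refresh b a).Writes y) :
    y = Rg.tmp₁.code b ∨ y = Rg.tmp₂.code b ∨ y = Rg.tmp₃.code b ∨ y = Rg.ans.code b := by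
  induction p with
  | leaf => simp only [refresh, skipCode, Prog.Writes] at h; tauto
  | join p q ihp ihq =>
    simp only [refresh] at h
    split_ifs at h <;> tauto
  | bind fr x key p ih =>
    rcases h with h | h | h
    · exact ih h
    · have := status_writes h; tauto
    · have := syncCode_writes h; tauto

theorem refresh_stores {a : ℕ} {p : Plan} {A : ℕ} (h : (p.refresh b a).Stores A) :
    ∃ x ∈ p.bvars, A = (Ar.pos x).code b ∨ A = (Ar.cnt x).code b ∨ A = (Ar.list x).code b := by
  induction p with
  | leaf => simp only [refresh, skipCode, Prog.Stores] at h
  | join p q ihp ihq =>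
    simp only [refresh] at h
    split_ifs at h
    · obtain ⟨x, hx, h⟩ := ihp h
      exact ⟨x, by simp [bvars, hx], h⟩
    · obtain ⟨x, hx, h⟩ := ihq h
      exact ⟨x, by simp [bvars, hx], h⟩
  | bind fr x key p ih =>
    rcases h with h | h | h
    · obtain ⟨y, hy, h⟩ := ih h
      exact ⟨y, by simp [bvars, hy], h⟩
    · exact (status_stores h).elim
    · exact ⟨x, by simp [bvars], syncCode_stores h⟩

theorem refresh_reg (a : ℕ) (p : Plan) (σ : Mem) {r : Rg} (h₁ : r ≠ .tmp₁) (h₂ : r ≠ .ans)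
    (h₃ : r ≠ .tmp₂) (h₄ : r ≠ .tmp₃) :
    ((p.refresh b a).eval σ).reg (r.code b) = σ.reg (r.code b) :=
  (refresh_simple b a p).eval_reg σ fun h => by
    rcases refresh_writes h with h | h | h | h <;> simp_all

theorem refresh_env (a : ℕ) (p : Plan) (σ : Mem) : ((p.refresh b a).eval σ).env b = σ.env b :=
  funext fun _ => refresh_reg a p σ (by simp) (by simp) (by simp) (by simp)

theorem refresh_arr (a : ℕ) (p : Plan) (σ : Mem) {A : Ar}
    (h : ∀ x ∈ p.bvars, A ≠ .pos x ∧ A ≠ .cnt x ∧ A ≠ .list x) :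
    ((p.refresh b a).eval σ).arr (A.code b) = σ.arr (A.code b) :=
  (refresh_simple b a p).eval_arr σ fun hs => by
    obtain ⟨x, hx, hs⟩ := refresh_stores hs
    have := h x hx
    simp only [Ar.code_inj] at hs
    tauto

/-- A change of leaf `a` at the values `ν` of its arguments does not affect valuations that differ
from `ν` at one of the arguments. -/
theorem holds_of_ne {p : Plan} {a : ℕ} {args : List ℕ} {ν μ : ℕ → ℕ} {y : ℕ}
    (hpath : p.Path a args) (hbit : ∀ a' l, (a' = a → l ≠ args.map ν) →
      m' ((Ar.bit a').code b) l = m ((Ar.bit a').code b) l)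
    (hy : y ∈ args) (hyb : y ∉ p.bvars) (hne : μ y ≠ ν y) :
    p.Holds b m' μ ↔ p.Holds b m μ := by
  induction p generalizing μ with
  | leaf a' args' =>
    simp only [Holds]
    rw [hbit]
    rintro rfl h
    rw [hpath rfl] at h
    exact hne (List.map_inj_left.1 h y hy)
  | join p q ihp ihq =>
    simp only [bvars, List.mem_append, not_or] at hyb
    simp only [Holds, ihp hpath.1 hyb.1 hne, ihq hpath.2 hyb.2 hne]
  | bind fr x key p ih =>
    simp only [bvars, List.mem_cons, not_or] at hyb
    exact exists_congr fun v => ih hpath.1 hyb.2 (by simp [hyb.1, hne])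

/-- `refresh` restores the invariant after a change of leaf `a` at the current values. One value per
variable node suffices: the variables of the nodes above the leaf are arguments of the leaf, so that
the change is visible for a single key and a single value only (`holds_of_ne`). -/
theorem refresh_inv {p : Plan} {a : ℕ} {args : List ℕ} {σ : Mem} (hw : p.WF)
    (hpath : p.Path a args) (ha : a ∈ p.leaves) (h1 : σ.reg (Rg.one.code b) = 1)
    (hm : p.Inv b m)
    (hbit : ∀ a' l, (a' = a → l ≠ args.map (σ.env b)) →
      σ.arr ((Ar.bit a').code b) l = m ((Ar.bit a').code b) l)
    (hset : ∀ x ∈ p.bvars, σ.arr ((Ar.pos x).code b) = m ((Ar.pos x).code b) ∧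
      σ.arr ((Ar.cnt x).code b) = m ((Ar.cnt x).code b) ∧
      σ.arr ((Ar.list x).code b) = m ((Ar.list x).code b)) :
    p.Inv b ((p.refresh b a).eval σ).arr := by
  induction p with
  | leaf => trivial
  | join p q ihp ihq =>
    obtain ⟨hwp, hwq, hbb, -, -, hl⟩ := hw
    simp only [bvars, leaves, List.mem_append] at hset ha
    simp only [refresh]
    split_ifs with hap
    · refine ⟨ihp hwp hpath.1 hap hm.1 fun x hx => hset x (.inl hx), ?_⟩
      refine inv_congr_arr (m := m) ?_ ?_ hm.2
      · intro a' ha'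
        rw [refresh_arr a p σ (by simp)]
        funext l
        refine hbit a' l fun h => ?_
        subst h
        exact (hl hap ha').elim
      · intro x hx
        rw [refresh_arr a p σ, refresh_arr a p σ, refresh_arr a p σ]
        · exact hset x (.inr hx)
        all_goals
          intro y hy
          have hxy : x ≠ y := fun h => hbb (h ▸ hy) hx
          simp [hxy]
    · have haq := ha.resolve_left hap
      refine ⟨?_, ihq hwq hpath.2 haq hm.2 fun x hx => hset x (.inr hx)⟩
      refine inv_congr_arr (m := m) ?_ ?_ hm.1
      · intro a' ha'
        rw [refresh_arr a q σ (by simp)]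
        funext l
        refine hbit a' l fun h => ?_
        subst h
        exact (hap ha').elim
      · intro x hx
        rw [refresh_arr a q σ, refresh_arr a q σ, refresh_arr a q σ]
        · exact hset x (.inl hx)
        all_goals
          intro y hy
          have hxy : x ≠ y := fun h => hbb hx (h ▸ hy)
          simp [hxy]
  | bind fr x key p ih =>
    obtain ⟨hwp, hfv, hxk, hxb, hkb⟩ := hw
    simp only [bvars, List.mem_cons, forall_eq_or_imp] at hset
    obtain ⟨hxa, hka⟩ := hpath.2 ha
    set σ₁ := (p.refresh b a).eval σ with hσ₁
    set σ₂ := (p.status b).eval σ₁ with hσ₂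
    have i₁ : p.Inv b σ₁.arr := ih hwp hpath.1 ha hm.1 hset.2
    have o₁ : σ₁.reg (Rg.one.code b) = 1 := by
      rw [hσ₁, refresh_reg a p σ (by simp) (by simp) (by simp) (by simp), h1]
    have e₁ : σ₁.env b = σ.env b := refresh_env a p σ
    have st := status_ans o₁ i₁
    have o₂ : σ₂.reg (Rg.one.code b) = 1 := by
      rw [hσ₂, status_reg p σ₁ (by simp) (by simp), o₁]
    have e₂ : σ₂.env b = σ.env b := by rw [hσ₂, status_env, e₁]
    have m₂ : σ₂.arr = σ₁.arr := status_arr p σ₁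
    have hx₁ : ∀ ν : ℕ → ℕ, SetRep b σ₂.arr x (key.map ν)
        {v | p.Holds b m (Function.update ν x v)} := by
      intro ν
      refine (hm.2 ν).congr ?_ ?_ ?_ <;> rw [m₂, hσ₁, refresh_arr a p σ]
      · exact hset.1.1
      rotate_left
      · exact hset.1.2.1
      rotate_left
      · exact hset.1.2.2
      all_goals
        intro y hy
        have hxy : x ≠ y := fun h => hxb (h ▸ hy)
        simp [hxy]
    have bit₁ : ∀ a', σ₁.arr ((Ar.bit a').code b) = σ.arr ((Ar.bit a').code b) := fun a' =>
      refresh_arr a p σ (by simp)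
    set σ₃ := (syncCode b x key).eval σ₂ with hσ₃
    have frame : ∀ A : Ar, A ≠ .pos x → A ≠ .cnt x → A ≠ .list x →
        σ₃.arr (A.code b) = σ₁.arr (A.code b) := by
      intro A h₁ h₂ h₃
      rw [hσ₃, ← m₂]
      refine (syncCode_simple b x key).eval_arr σ₂ fun h => ?_
      have := syncCode_stores h
      simp only [Ar.code_inj] at this
      tauto
    have bit₃ : ∀ ν, p.Holds b σ₃.arr ν ↔ p.Holds b σ₁.arr ν := fun ν =>
      holds_congr_arr fun a' _ => frame _ (by simp) (by simp) (by simp)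
    change p.Inv b σ₃.arr ∧ ∀ ν : ℕ → ℕ,
      SetRep b σ₃.arr x (key.map ν) {v | p.Holds b σ₃.arr (Function.update ν x v)}
    refine ⟨inv_congr_arr (fun a' _ => frame _ (by simp) (by simp) (by simp)) ?_ i₁, fun ν => ?_⟩
    · intro y hy
      have hyx : y ≠ x := fun h => hxb (h ▸ hy)
      refine ⟨frame _ ?_ ?_ ?_, frame _ ?_ ?_ ?_, frame _ ?_ ?_ ?_⟩ <;> simp [hyx]
    · simp only [bit₃]
      -- the change of the leaf is not visible at other keys or other values of `x`
      have hloc : ∀ μ : ℕ → ℕ, (∃ y ∈ x :: key, μ y ≠ σ.env b y) →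
          (p.Holds b σ₁.arr μ ↔ p.Holds b m μ) := by
        rintro μ ⟨y, hy, hne⟩
        refine holds_of_ne (a := a) (args := args) (ν := σ.env b) (y := y) hpath.1 ?_ ?_ ?_ hne
        · intro a' l h
          rw [bit₁]
          exact hbit a' l h
        · rcases List.mem_cons.1 hy with rfl | hy
          exacts [hxa, hka hy]
        · rcases List.mem_cons.1 hy with rfl | hy
          exacts [hxb, fun h => hkb hy h]
      by_cases hk : key.map ν = key.map (σ.env b)
      · have hk' : ∀ y ∈ key, ν y = σ.env b y := List.map_inj_left.1 hk
        rw [hk, ← e₂]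
        have hupd : ∀ v, p.Holds b σ₁.arr (Function.update ν x v) ↔
            p.Holds b σ₁.arr (Function.update (σ.env b) x v) := fun v =>
          holds_congr_env hwp fun y hy => by
            simp only [Function.update_apply]
            split_ifs with hyx
            · rfl
            · exact hk' y ((List.mem_cons.1 (hfv hy)).resolve_left hyx)
        refine syncCode_setRep o₂ (hx₁ (σ₂.env b)) ?_ ?_
        · rw [st, e₁, e₂, Set.mem_ofPred_eq, hupd, Function.update_eq_self]
        · intro v hv
          rw [e₂] at hv ⊢
          rw [Set.mem_ofPred_eq, Set.mem_ofPred_eq, hupd]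
          exact hloc _ ⟨x, by simp, by simpa using hv⟩
      · have hne : ∃ y ∈ key, ν y ≠ σ.env b y := by
          by_contra hcon
          push Not at hcon
          exact hk (map_congr_of_agree hcon)
        obtain ⟨y, hy, hne⟩ := hne
        have hyx : y ≠ x := fun h => hxk (h ▸ hy)
        have hset' : {v | p.Holds b σ₁.arr (Function.update ν x v)} =
            {v | p.Holds b m (Function.update ν x v)} := by
          ext v
          exact hloc _ ⟨y, by simp [hy], by simpa [hyx] using hne⟩
        rw [hset']
        exact syncCode_setRep_of_ne (by simp) (by rw [e₂]; exact hk) (hx₁ ν)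

end Plan

/-! ### Traces with bounded gaps -/

/-- The trace has at most `c` consecutive steps without output. -/
def GapLE (c : ℕ) (tr : List Event) : Prop :=
  ∀ w, w <:+: tr → (∀ e ∈ w, e = none) → w.length ≤ c

/-- The trace contains an output and has at most `c` consecutive steps without output. -/
def GoodTrace (c : ℕ) (tr : List Event) : Prop :=
  (∃ e ∈ tr, e ≠ none) ∧ GapLE c tr

theorem GapLE.of_length {c : ℕ} {tr : List Event} (h : tr.length ≤ c) : GapLE c tr :=
  fun _ hw _ => hw.length_le.trans h

theorem infix_append_split {α : Type*} {w s t : List α} (h : w <:+: s ++ t) :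
    ∃ w₁ w₂, w = w₁ ++ w₂ ∧ w₁ <:+: s ∧ w₂ <:+: t ∧ (w₁ = [] ∨ w₂ <+: t) := by
  rcases List.infix_append_iff.1 h with h | h | ⟨w₁, w₂, rfl, h₁, h₂⟩
  · exact ⟨w, [], by simp, h, List.nil_infix, .inr List.nil_prefix⟩
  · exact ⟨[], w, rfl, List.nil_infix, h, .inl rfl⟩
  · exact ⟨w₁, w₂, rfl, h₁.isInfix, h₂.isInfix, .inr h₂⟩

theorem GapLE.append {c d : ℕ} {s t : List Event} (hs : GapLE c s) (ht : GapLE d t) :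
    GapLE (c + d) (s ++ t) := by
  intro w hw he
  obtain ⟨w₁, w₂, rfl, h₁, h₂, -⟩ := infix_append_split hw
  have := hs w₁ h₁ fun e h => he e (by simp [h])
  have := ht w₂ h₂ fun e h => he e (by simp [h])
  simp only [List.length_append]
  omega

/-- Prolonging a trace by few steps at both ends. -/
theorem GoodTrace.wrap {c d k : ℕ} {s t u : List Event} (h : GoodTrace c t) (hs : s.length + u.length ≤ d)
    (hk : c + d ≤ k) : GoodTrace k (s ++ (t ++ u)) := by
  obtain ⟨e, he, h0⟩ := h.1
  refine ⟨⟨e, by simp [he], h0⟩, fun w hw hw' => ?_⟩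
  have := ((GapLE.of_length le_rfl).append (h.2.append (.of_length le_rfl))) w hw hw'
  omega

/-- A trace put together from good traces: the gaps inside have length at most `2 * c`, and the gap
at the beginning has length at most `c`. -/
def ChainTrace (c : ℕ) (tr : List Event) : Prop :=
  GapLE (2 * c) tr ∧ ∀ w, w <+: tr → (∀ e ∈ w, e = none) → w.length ≤ c

theorem GoodTrace.chain {c : ℕ} {s t : List Event} (hs : GoodTrace c s) (ht : ChainTrace c t) :
    ChainTrace c (s ++ t) := by
  constructor
  · intro w hw he
    obtain ⟨w₁, w₂, rfl, h₁, h₂, h₃⟩ := infix_append_split hw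
    have i₁ := hs.2 w₁ h₁ fun e h => he e (by simp [h])
    rcases h₃ with rfl | h₃
    · simpa using ht.1 w₂ h₂ fun e h => he e (by simp [h])
    · have := ht.2 w₂ h₃ fun e h => he e (by simp [h])
      simp only [List.length_append]
      omega
  · intro w hw he
    rcases List.prefix_or_prefix_of_prefix hw (List.prefix_append s t) with h | h
    · exact hs.2 w h.isInfix he
    · obtain ⟨e, hmem, h0⟩ := hs.1
      exact (h0 (he e (h.subset hmem))).elim

namespace Plan

variable {b : ℕ} {m : ℕ → List ℕ → ℕ}

/-! ### Enumeration of the solutions of a plan -/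

/-- Run `body` for every solution of the plan. -/
def enum (b : ℕ) : Plan → Prog → Prog
  | leaf _ _, body => body
  | join p q, body => p.enum b (q.enum b body)
  | bind false _ _ _, body => body
  | bind true x key p, body =>
      .load ((Rg.bnd x).code b) ((Ar.cnt x).code b) (vregs b key) ;;
      .const ((Rg.idx x).code b) 0 ;;
      .whl ((Rg.idx x).code b) ((Rg.bnd x).code b)
        (.load ((Rg.var x).code b) ((Ar.list x).code b) (vregs b key ++ [(Rg.idx x).code b]) ;;
          p.enum b body ;;
          .const (Rg.one.code b) 1 ;;
          .add ((Rg.idx x).code b) ((Rg.idx x).code b) (Rg.one.code b))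

/-- The solutions extending a valuation, in the order of their enumeration. -/
def sols (b : ℕ) (m : ℕ → List ℕ → ℕ) : Plan → (ℕ → ℕ) → List (ℕ → ℕ)
  | leaf _ _, ν => [ν]
  | join p q, ν => (p.sols b m ν).flatMap (q.sols b m)
  | bind false _ _ _, ν => [ν]
  | bind true x key p, ν => (List.range (m ((Ar.cnt x).code b) (key.map ν))).flatMap fun i =>
      p.sols b m (Function.update ν x (m ((Ar.list x).code b) (key.map ν ++ [i])))

/-- A bound for the delay of `enum` in terms of a bound for the loop body. -/
def delay : Plan → ℕ → ℕ
  | leaf _ _, c => c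
  | join p q, c => p.delay (q.delay c)
  | bind false _ _ _, c => c
  | bind true _ _ p, c => 2 * (p.delay c + 8) + 4

theorem outs_subset_bvars (p : Plan) : p.outs ⊆ p.bvars := by
  induction p with
  | leaf => simp [outs]
  | join p q ihp ihq =>
    simp only [outs, bvars, List.append_subset]
    exact ⟨fun x hx => List.mem_append_left _ (ihp hx), fun x hx => List.mem_append_right _ (ihq hx)⟩
  | bind fr x key p ih =>
    cases fr
    · simp [outs]
    · exact List.cons_subset_cons _ ih

theorem sols_agree {p : Plan} {μ ν : ℕ → ℕ} (h : μ ∈ p.sols b m ν) {y : ℕ} (hy : y ∉ p.outs) :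
    μ y = ν y := by
  induction p generalizing μ ν with
  | leaf => simp_all [sols]
  | join p q ihp ihq =>
    simp only [outs, List.mem_append, not_or] at hy
    obtain ⟨μ', h', h⟩ := List.mem_flatMap.1 h
    rw [ihq h hy.2, ihp h' hy.1]
  | bind fr x key p ih =>
    cases fr
    · simp_all [sols]
    · simp only [outs, List.mem_cons, not_or] at hy
      obtain ⟨i, -, h⟩ := List.mem_flatMap.1 h
      rw [ih h hy.2, Function.update_of_ne hy.1]

theorem WF.fv_disjoint {p : Plan} (hw : p.WF) : p.fv.Disjoint p.bvars := by
  induction p with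
  | leaf => simp [bvars]
  | join p q ihp ihq =>
    obtain ⟨hp, hq, -, h₁, h₂, -⟩ := hw
    simp only [fv, bvars, List.disjoint_append_left, List.disjoint_append_right]
    exact ⟨⟨ihp hp, h₁.symm⟩, h₂.symm, ihq hq⟩
  | bind fr x key p ih =>
    obtain ⟨-, -, h₁, -, h₂⟩ := hw
    simp only [fv, bvars, List.disjoint_cons_right]
    exact ⟨h₁, h₂⟩

theorem Sat.holds {p : Plan} {μ : ℕ → ℕ} (h : p.Sat b m μ) : p.Holds b m μ := by
  induction p with
  | leaf => exact h
  | join p q ihp ihq => exact ⟨ihp h.1, ihq h.2⟩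
  | bind fr x key p ih =>
    cases fr
    · exact h
    · exact ⟨μ x, by rw [Function.update_eq_self]; exact ih h⟩

theorem sat_congr {p : Plan} (hw : p.WF) {μ ν : ℕ → ℕ} (h : ∀ x, x ∈ p.fv ∨ x ∈ p.outs → μ x = ν x) :
    p.Sat b m μ ↔ p.Sat b m ν := by
  induction p with
  | leaf => exact holds_congr_env hw fun x hx => h x (.inl hx)
  | join p q ihp ihq =>
    simp only [fv, outs, List.mem_append] at h
    simp only [Sat, ihp hw.1 fun x hx => h x (by tauto), ihq hw.2.1 fun x hx => h x (by tauto)]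
  | bind fr x key p ih =>
    cases fr
    · exact holds_congr_env hw fun x hx => h x (.inl hx)
    · simp only [fv, outs, List.mem_cons] at h
      refine ih hw.1 fun y hy => h y ?_
      rcases hy with hy | hy
      · have := hw.2.1 hy
        simp only [List.mem_cons] at this
        tauto
      · tauto

/-- The enumerated valuations are exactly the solutions that extend the given valuation. -/
theorem mem_sols {p : Plan} (hw : p.WF) (hm : p.Inv b m) {μ ν : ℕ → ℕ} (hν : p.Holds b m ν) :
    μ ∈ p.sols b m ν ↔ (∀ y, y ∉ p.outs → μ y = ν y) ∧ p.Sat b m μ := by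
  induction p generalizing μ ν with
  | leaf a args =>
    simp only [sols, outs, List.mem_singleton, List.not_mem_nil, not_false_eq_true, forall_const,
      ← funext_iff]
    exact ⟨fun h => ⟨h, by rw [h]; exact hν⟩, fun h => h.1⟩
  | join p q ihp ihq =>
    obtain ⟨hp, hq, hbb, h₁, h₂, -⟩ := hw
    have key : ∀ μ', (∀ y, y ∉ p.outs → μ' y = ν y) → q.Holds b m μ' := fun μ' h =>
      (holds_congr_env hq fun y hy => h y fun hy' => h₁ (outs_subset_bvars p hy') hy).2 hν.2
    simp only [sols, List.mem_flatMap]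
    constructor
    · rintro ⟨μ', hμ', hμ⟩
      rw [ihp hp hm.1 hν.1] at hμ'
      rw [ihq hq hm.2 (key μ' hμ'.1)] at hμ
      refine ⟨fun y hy => ?_, ?_, hμ.2⟩
      · simp only [outs, List.mem_append, not_or] at hy
        rw [hμ.1 y hy.2, hμ'.1 y hy.1]
      · refine (sat_congr hp fun y hy => hμ.1 y fun hy' => ?_).2 hμ'.2
        have := outs_subset_bvars q hy'
        rcases hy with hy | hy
        · exact h₂ this hy
        · exact hbb (outs_subset_bvars p hy) this
    · rintro ⟨hμ, hsp, hsq⟩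
      classical
      have hμ' : ∀ y, y ∉ p.outs → (fun y => if y ∈ q.outs then ν y else μ y) y = ν y := by
        intro y hy
        by_cases hyq : y ∈ q.outs
        · simp [hyq]
        · simpa [hyq] using hμ y (by simp [outs, hy, hyq])
      refine ⟨fun y => if y ∈ q.outs then ν y else μ y, ?_, ?_⟩
      · rw [ihp hp hm.1 hν.1]
        refine ⟨hμ', (sat_congr hp fun y hy => if_neg fun hy' => ?_).2 hsp⟩
        have := outs_subset_bvars q hy'
        rcases hy with hy | hy
        · exact h₂ this hy
        · exact hbb (outs_subset_bvars p hy) this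
      · rw [ihq hq hm.2 (key _ hμ')]
        exact ⟨fun y hy => by simp [hy], hsq⟩
  | bind fr x key p ih =>
    cases fr
    · simp only [sols, outs, List.mem_singleton, List.not_mem_nil, not_false_eq_true, forall_const,
        ← funext_iff]
      exact ⟨fun h => ⟨h, by rw [h]; exact hν⟩, fun h => h.1⟩
    · have hset := hm.2 ν
      have hx : x ∉ p.outs := fun h => hw.2.2.2.1 (outs_subset_bvars p h)
      simp only [sols, List.mem_flatMap, List.mem_range, outs, List.mem_cons, not_or, Sat]
      constructor
      · rintro ⟨i, hi, hμ⟩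
        have hh : p.Holds b m _ := (hset.mem_iff_exists _).2 ⟨i, hi, rfl⟩
        rw [ih hw.1 hm.1 hh] at hμ
        exact ⟨fun y hy => by rw [hμ.1 y hy.2, Function.update_of_ne hy.1], hμ.2⟩
      · rintro ⟨hμ, hs⟩
        have hag : ∀ y, y ∉ p.outs → μ y = Function.update ν x (μ x) y := by
          intro y hy
          by_cases hyx : y = x
          · simp [hyx]
          · rw [hμ y ⟨hyx, hy⟩, Function.update_of_ne hyx]
        have hh : p.Holds b m (Function.update ν x (μ x)) :=
          (holds_congr_env hw.1 fun y hy => hag y fun hy' =>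
            hw.1.fv_disjoint hy (outs_subset_bvars p hy')).1 hs.holds
        obtain ⟨i, hi, hv⟩ := (hset.mem_iff_exists (μ x)).1 hh
        refine ⟨i, hi, ?_⟩
        rw [hv, ih hw.1 hm.1 hh]
        exact ⟨hag, hs⟩

theorem sols_nodup {p : Plan} (hw : p.WF) (hm : p.Inv b m) (ν : ℕ → ℕ) : (p.sols b m ν).Nodup := by
  induction p generalizing ν with
  | leaf => simp [sols]
  | join p q ihp ihq =>
    obtain ⟨hp, hq, hbb, -⟩ := hw
    rw [sols, List.nodup_flatMap]
    refine ⟨fun μ _ => ihq hq hm.2 μ, (ihp hp hm.1 ν).imp_of_mem fun {μ₁ μ₂} h₁ h₂ hne => ?_⟩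
    intro μ hμ₁ hμ₂
    refine hne (funext fun y => ?_)
    by_cases hy : y ∈ q.outs
    · have hyp : y ∉ p.outs := fun h => hbb (outs_subset_bvars p h) (outs_subset_bvars q hy)
      rw [sols_agree h₁ hyp, sols_agree h₂ hyp]
    · rw [← sols_agree hμ₁ hy, ← sols_agree hμ₂ hy]
  | bind fr x key p ih =>
    cases fr
    · simp [sols]
    · have hx : x ∉ p.outs := fun h => hw.2.2.2.1 (outs_subset_bvars p h)
      rw [sols, List.nodup_flatMap]
      refine ⟨fun i _ => ih hw.1 hm.1 _, List.nodup_range.imp_of_mem fun {i j} hi hj hne => ?_⟩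
      intro μ hμ₁ hμ₂
      have e₁ := sols_agree hμ₁ hx
      have e₂ := sols_agree hμ₂ hx
      rw [Function.update_self] at e₁ e₂
      exact hne ((hm.2 ν).list_inj (List.mem_range.1 hi) (List.mem_range.1 hj) (e₁ ▸ e₂))

/-- The program writes only to loop registers of variables in `V`. -/
def WritesOnly (b : ℕ) (V : List ℕ) (p : Prog) : Prop :=
  ∀ y, p.Writes y → y = Rg.one.code b ∨
    ∃ z ∈ V, y = (Rg.var z).code b ∨ y = (Rg.idx z).code b ∨ y = (Rg.bnd z).code b

theorem WritesOnly.mono {V W : List ℕ} {p : Prog} (h : WritesOnly b V p) (hVW : V ⊆ W) :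
    WritesOnly b W p := fun y hy => (h y hy).imp_right fun ⟨z, hz, h⟩ => ⟨z, hVW hz, h⟩

theorem enum_writesOnly {p : Plan} {body : Prog} {V : List ℕ} (h : WritesOnly b V body) :
    WritesOnly b (p.outs ++ V) (p.enum b body) := by
  induction p generalizing body V with
  | leaf => simpa [outs, enum] using h
  | join p q ihp ihq => simpa [outs, enum] using ihp (ihq h)
  | bind fr x key p ih =>
    cases fr
    · simpa [outs, enum] using h
    · intro y hy
      simp only [enum, Prog.Writes] at hy
      have : y = Rg.one.code b ∨
          (y = (Rg.var x).code b ∨ y = (Rg.idx x).code b ∨ y = (Rg.bnd x).code b) ∨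
          (p.enum b body).Writes y := by tauto
      rcases this with h' | h' | h'
      · exact .inl h'
      · exact .inr ⟨x, by simp [outs], h'⟩
      · exact (ih h).mono (by simp [outs]) y h'

theorem enum_stores {p : Plan} {body : Prog} {A : ℕ} (h : ¬ body.Stores A) :
    ¬ (p.enum b body).Stores A := by
  induction p generalizing body with
  | leaf => exact h
  | join p q ihp ihq => exact ihp (ihq h)
  | bind fr x key p ih =>
    cases fr
    · exact h
    · simp [enum, Prog.Stores, ih h]

/-- The loop `enum` runs its body once for every solution. If each run of the body outputs something
with bounded gaps, so does the loop. Here `U` contains the variables whose values the body and the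
plan rely on, and `V` those that the body may change. -/
theorem enum_exec {p : Plan} (hw : p.WF) (hm : p.Inv b m) {body : Prog} {U V : List ℕ} {c : ℕ}
    {out : (ℕ → ℕ) → List (List ℕ)} (hbw : WritesOnly b V body) (hbs : ∀ A, ¬ body.Stores A)
    (hU : p.fv ⊆ U) (hUp : U.Disjoint p.bvars) (hVU : V.Disjoint U) (hVp : V.Disjoint p.bvars)
    {ν : ℕ → ℕ} (hν : p.Holds b m ν)
    (hbody : ∀ ν' ∈ p.sols b m ν, ∀ σ : Mem, σ.arr = m →
      (∀ x ∈ U ++ p.outs, σ.env b x = ν' x) →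
      ∃ tr σ', body.Exec σ tr σ' ∧ tr.filterMap id = out ν' ∧ GoodTrace c tr)
    (σ : Mem) (hσ : σ.arr = m) (hσν : ∀ x ∈ U, σ.env b x = ν x) :
    ∃ tr σ', (p.enum b body).Exec σ tr σ' ∧ tr.filterMap id = (p.sols b m ν).flatMap out ∧
      GoodTrace (p.delay c) tr := by
  induction p generalizing body U V c out ν σ with
  | leaf a args =>
    obtain ⟨tr, σ', h⟩ := hbody ν (by simp [sols]) σ hσ (by simpa [outs] using hσν)
    exact ⟨tr, σ', by simpa [enum, sols, delay] using h⟩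
  | join p q ihp ihq =>
    obtain ⟨hp, hq, hbb, h₁, h₂, -⟩ := hw
    simp only [fv, List.append_subset] at hU
    simp only [bvars, List.disjoint_append_right] at hUp hVp
    have hpo := outs_subset_bvars p
    have hqo := outs_subset_bvars q
    have key := ihp hp hm.1 (body := q.enum b body) (U := U) (V := q.outs ++ V) (c := q.delay c)
      (out := fun ν' => (q.sols b m ν').flatMap out) (enum_writesOnly hbw)
      (fun A => enum_stores (hbs A)) hU.1 hUp.1
      (by simp only [List.disjoint_append_left]
          exact ⟨fun x hx hx' => hUp.2 hx' (hqo hx), hVU⟩)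
      (by simp only [List.disjoint_append_left]
          exact ⟨fun x hx hx' => hbb hx' (hqo hx), hVp.1⟩) hν.1 ?_ σ hσ hσν
    · simpa only [enum, sols, delay, List.flatMap_assoc] using key
    intro ν' hν' σ hσ hσν
    refine ihq hq hm.2 (U := U ++ p.outs) (V := V) hbw hbs
      (fun x hx => List.mem_append_left _ (hU.2 hx)) ?_ ?_ hVp.2 ?_ ?_ σ hσ hσν
    · simp only [List.disjoint_append_left]
      exact ⟨hUp.2, fun x hx => hbb (hpo hx)⟩
    · simp only [List.disjoint_append_right]
      exact ⟨hVU, fun x hx hx' => hVp.1 hx (hpo hx')⟩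
    · exact (holds_congr_env hq fun y hy =>
        sols_agree hν' fun hy' => h₁ (hpo hy') hy).2 hν.2
    · intro ν'' hν'' σ hσ hσν
      exact hbody ν'' (List.mem_flatMap.2 ⟨ν', hν', hν''⟩) σ hσ (by
        simpa [outs, List.append_assoc] using hσν)
  | bind fr x key p ih =>
    cases fr
    · obtain ⟨tr, σ', h⟩ := hbody ν (by simp [sols]) σ hσ (by simpa [outs] using hσν)
      exact ⟨tr, σ', by simpa [enum, sols, delay] using h⟩
    obtain ⟨hwp, hfv, hxk, hxb, hkb⟩ := hw
    simp only [bvars, List.disjoint_cons_right] at hUp hVp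
    simp only [fv] at hU
    have hset := hm.2 ν
    set N := m ((Ar.cnt x).code b) (key.map ν) with hN
    set val : ℕ → ℕ := fun i => m ((Ar.list x).code b) (key.map ν ++ [i]) with hval
    set lbody : Prog := .load ((Rg.var x).code b) ((Ar.list x).code b)
        (vregs b key ++ [(Rg.idx x).code b]) ;; p.enum b body ;; .const (Rg.one.code b) 1 ;;
        .add ((Rg.idx x).code b) ((Rg.idx x).code b) (Rg.one.code b) with hlbody
    have hxo : x ∉ p.outs := fun h => hxb (outs_subset_bvars p h)
    -- registers that survive one round of the loop
    have surv : ∀ {σ tr σ'}, (p.enum b body).Exec σ tr σ' →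
        σ'.arr = σ.arr ∧ (∀ y ∈ U, σ'.env b y = σ.env b y) ∧
        σ'.reg ((Rg.idx x).code b) = σ.reg ((Rg.idx x).code b) ∧
        σ'.reg ((Rg.bnd x).code b) = σ.reg ((Rg.bnd x).code b) := by
      intro σ tr σ' he
      have hwo := enum_writesOnly (p := p) hbw
      refine ⟨funext fun A => he.arr_eq (enum_stores (hbs A)), fun y hy => he.reg_eq fun h => ?_,
        he.reg_eq fun h => ?_, he.reg_eq fun h => ?_⟩
      · rcases hwo _ h with h | ⟨z, hz, h⟩
        · simp at h
        · have : y = z := by simpa using h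
          subst this
          rcases List.mem_append.1 hz with hz | hz
          · exact hUp.2 hy (outs_subset_bvars p hz)
          · exact hVU hz hy
      all_goals
        rcases hwo _ h with h | ⟨z, hz, h⟩
        · simp at h
        · have : x = z := by simpa using h
          subst this
          rcases List.mem_append.1 hz with hz | hz
          · exact hxo hz
          · exact hVp.1 hz
    have loop : ∀ d j (σ : Mem), j + d = N → σ.arr = m → (∀ y ∈ U, σ.env b y = ν y) →
        σ.reg ((Rg.idx x).code b) = j → σ.reg ((Rg.bnd x).code b) = N →
        ∃ tr σ', (Prog.whl ((Rg.idx x).code b) ((Rg.bnd x).code b) lbody).Exec σ tr σ' ∧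
          tr.filterMap id = (List.range' j d).flatMap
            (fun i => (p.sols b m (Function.update ν x (val i))).flatMap out) ∧
          ChainTrace (p.delay c + 8) tr ∧ (d ≠ 0 → ∃ e ∈ tr, e ≠ none) := by
      intro d
      induction d with
      | zero =>
        intro j σ hj _ _ hi hn
        refine ⟨_, _, Prog.Exec.whl_neg (by omega), by simp, ⟨?_, ?_⟩, by simp⟩
        · exact .of_length (by simp; omega)
        · exact fun w hw _ => hw.length_le.trans (by simp)
      | succ d ihd =>
        intro j σ hj hσ hσν hi hn
        have hkey : key.map (σ.env b) = key.map ν := map_congr_of_agree fun y hy => hσν y (hU hy)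
        set σ₁ := σ.setReg ((Rg.var x).code b) (val j) with hσ₁
        have e₁ : (Prog.load ((Rg.var x).code b) ((Ar.list x).code b)
            (vregs b key ++ [(Rg.idx x).code b])).Exec σ [none] σ₁ := by
          have := Prog.Exec.load ((Rg.var x).code b) ((Ar.list x).code b)
            (vregs b key ++ [(Rg.idx x).code b]) σ
          simpa [hσ₁, hval, hσ, hkey, hi] using this
        have hh : p.Holds b m (Function.update ν x (val j)) :=
          (hset.mem_iff_exists _).2 ⟨j, by omega, rfl⟩
        obtain ⟨t, σ₂, e₂, ht, hgood⟩ := ih hwp hm.1 (U := x :: U) (V := V) (c := c) (out := out)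
          (ν := Function.update ν x (val j)) hbw hbs
          (fun y hy => by
            rcases List.mem_cons.1 (hfv hy) with h | h
            · simp [h]
            · simp [hU h])
          (by simpa only [List.disjoint_cons_left] using ⟨hxb, hUp.2⟩)
          (by simpa only [List.disjoint_cons_right] using ⟨hVp.1, hVU⟩) hVp.2 hh
          (fun ν' hν' σ hσ hσν => hbody ν' (List.mem_flatMap.2
            ⟨j, List.mem_range.2 (by omega), hν'⟩) σ hσ fun y hy => hσν y (by
              simp only [outs, List.mem_append, List.mem_cons] at hy ⊢; tauto))
          σ₁ hσ (fun y hy => by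
            by_cases hyx : y = x
            · simp [hσ₁, hyx]
            · simp [hσ₁, hyx, hσν y ((List.mem_cons.1 hy).resolve_left hyx)])
        obtain ⟨s₁, s₂, s₃, s₄⟩ := surv e₂
        set σ₃ := (σ₂.setReg (Rg.one.code b) 1).setReg ((Rg.idx x).code b) (j + 1) with hσ₃
        have e₃ : (Prog.const (Rg.one.code b) 1 ;;
            Prog.add ((Rg.idx x).code b) ((Rg.idx x).code b) (Rg.one.code b)).Exec σ₂
            (none :: ([none] ++ [none])) σ₃ := by
          have := (Prog.Exec.const (Rg.one.code b) 1 σ₂).seq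
            (Prog.Exec.add ((Rg.idx x).code b) ((Rg.idx x).code b) (Rg.one.code b) _)
          simpa [hσ₃, s₃, hσ₁, hi] using this
        obtain ⟨t', σ', e₄, ht', hch, -⟩ := ihd (j + 1) σ₃ (by omega)
          (by rw [hσ₃]; simp [s₁, hσ₁, hσ])
          (fun y hy => by
            have hyx : y ≠ x := fun h => hUp.1 (h ▸ hy)
            rw [hσ₃, Mem.env_setReg _ _ _ _ (by simp), Mem.env_setReg _ _ _ _ (by simp), s₂ y hy,
              hσ₁, Mem.env_setReg_var, Function.update_of_ne hyx, hσν y hy])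
          (by simp [hσ₃]) (by simp [hσ₃, s₄, hσ₁, hn])
        refine ⟨_, _, Prog.Exec.whl_pos (by omega) (e₁.seq (e₂.seq e₃)) e₄, ?_, ?_, ?_⟩
        · simp only [List.range'_succ, List.flatMap_cons, ← ht, ← ht']
          simp
        · have hg : GoodTrace (p.delay c + 8) ([none, none, none, none] ++ (t ++ [none, none, none])) :=
            hgood.wrap (d := 7) (by simp) (by omega)
          have := hg.chain hch
          simpa using this
        · obtain ⟨e, he, h0⟩ := hgood.1
          exact fun _ => ⟨e, by simp [he], h0⟩
    have hkey : key.map (σ.env b) = key.map ν := map_congr_of_agree fun y hy => hσν y (hU hy)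
    have hN0 : N ≠ 0 := (hset.cnt_ne_zero_iff).2 hν
    set σ₁ := (σ.setReg ((Rg.bnd x).code b) N).setReg ((Rg.idx x).code b) 0 with hσ₁
    obtain ⟨t, σ', e, ht, hch, hne⟩ := loop N 0 σ₁ (by omega) (by simp [hσ₁, hσ])
      (fun y hy => by
        rw [hσ₁, Mem.env_setReg _ _ _ _ (by simp), Mem.env_setReg _ _ _ _ (by simp), hσν y hy])
      (by simp [hσ₁]) (by simp [hσ₁])
    have e₁ : (Prog.load ((Rg.bnd x).code b) ((Ar.cnt x).code b) (vregs b key)).Exec σ [none]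
        (σ.setReg ((Rg.bnd x).code b) N) := by
      have := Prog.Exec.load ((Rg.bnd x).code b) ((Ar.cnt x).code b) (vregs b key) σ
      simpa [hσ, hkey, ← hN] using this
    refine ⟨_, σ', e₁.seq ((Prog.Exec.const _ 0 _).seq e), ?_, ?_⟩
    · rw [sols, List.flatMap_assoc, ← hN, List.range_eq_range', ← ht]
      simp
    · have hg : GoodTrace (2 * (p.delay c + 8)) t := ⟨hne hN0, hch.1⟩
      have := hg.wrap (s := [none, none, none, none]) (u := []) (d := 4) (by simp) le_rfl
      simpa [delay] using this

end Plan

/-! ### Matching tuples against atoms -/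

/-- The memories have the same arrays and differ at most in the registers in `R`. -/
def Mem.Near (b : ℕ) (R : Set Rg) (σ σ' : Mem) : Prop :=
  σ'.arr = σ.arr ∧ ∀ y, (∀ r ∈ R, y ≠ r.code b) → σ'.reg y = σ.reg y

/-- The temporary registers, and the registers of the variables in `X`. -/
def matchRegs (X : Set ℕ) : Set Rg :=
  {r | r = .tmp₁ ∨ r = .tmp₂ ∨ r = .tmp₃ ∨ ∃ x ∈ X, r = .var x}

/-- The registers in `matchRegs X`, and the loop registers of atoms. -/
def loopRegs (X : Set ℕ) : Set Rg :=
  {r | r ∈ matchRegs X ∨ ∃ a, r = .aidx a ∨ r = .abnd a}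

namespace Mem

variable {b : ℕ} {R R' : Set Rg} {σ σ₁ σ₂ σ₃ : Mem}

theorem Near.refl (σ : Mem) : σ.Near b R σ :=
  ⟨rfl, fun _ _ => rfl⟩

theorem Near.trans (h : σ₁.Near b R σ₂) (h' : σ₂.Near b R σ₃) : σ₁.Near b R σ₃ :=
  ⟨h'.1.trans h.1, fun y hy => (h'.2 y hy).trans (h.2 y hy)⟩

theorem Near.mono (h : σ₁.Near b R σ₂) (hR : R ⊆ R') : σ₁.Near b R' σ₂ :=
  ⟨h.1, fun y hy => h.2 y fun r hr => hy r (hR hr)⟩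

theorem Near.reg (h : σ₁.Near b R σ₂) {r : Rg} (hr : r ∉ R) :
    σ₂.reg (r.code b) = σ₁.reg (r.code b) :=
  h.2 _ fun r' hr' he => hr (by rw [Rg.code_inj] at he; exact he ▸ hr')

theorem Near.reg_lt (h : σ₁.Near b R σ₂) {y : ℕ} (hy : y < b) : σ₂.reg y = σ₁.reg y :=
  h.2 y fun r _ => by have := r.le_code b; omega

theorem near_setReg {r : Rg} {v : ℕ} (hr : r ∈ R) : σ.Near b R (σ.setReg (r.code b) v) :=
  ⟨rfl, fun y hy => by simp [hy r hr]⟩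

end Mem

section matchCode

variable {b : ℕ} {ι : Type*} (f : ι → Prog) (x : ι → ℕ)

/-- Assign to every variable a component of a tuple. The program `f i` loads the component `i` into
register `tmp₁`, and `x i` is the variable at this position. -/
def assignCode (b : ℕ) (f : ι → Prog) (x : ι → ℕ) : List ι → Prog
  | [] => skipCode b
  | i :: l => f i ;; .const (Rg.tmp₂.code b) 0 ;;
      .add ((Rg.var (x i)).code b) (Rg.tmp₁.code b) (Rg.tmp₂.code b) ;; assignCode b f x l

/-- Run `body` if the values of the variables are the components of the tuple. -/
def checkCode (b : ℕ) (f : ι → Prog) (x : ι → ℕ) (body : Prog) : List ι → Prog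
  | [] => body
  | i :: l => f i ;; .ite (Rg.tmp₁.code b) ((Rg.var (x i)).code b) (skipCode b)
      (.ite ((Rg.var (x i)).code b) (Rg.tmp₁.code b) (skipCode b) (checkCode b f x body l))

/-- Run `body` with the valuation that maps the variables to the components, if there is one. -/
def matchCode (b : ℕ) (f : ι → Prog) (x : ι → ℕ) (l : List ι) (body : Prog) : Prog :=
  assignCode b f x l ;; checkCode b f x body l

/-- In all memories near `σ₀`, the program `f` loads the number `v` into register `tmp₁`, without
any other effect than possibly the use of `tmp₃`. -/
def IsFetch (b : ℕ) (R : Set Rg) (σ₀ : Mem) (f : Prog) (v : ℕ) : Prop :=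
  ∀ σ, σ₀.Near b R σ → (f.eval σ).reg (Rg.tmp₁.code b) = v ∧ (f.eval σ).arr = σ.arr ∧
    ∀ y, y ≠ Rg.tmp₁.code b → y ≠ Rg.tmp₃.code b → (f.eval σ).reg y = σ.reg y

variable {f x} {X : Set ℕ} {σ₀ : Mem} {v : ι → ℕ} {l : List ι} {body : Prog}

theorem IsFetch.near {f : Prog} {v : ℕ} (h : IsFetch b (matchRegs X) σ₀ f v) {σ : Mem}
    (hσ : σ₀.Near b (matchRegs X) σ) : σ₀.Near b (matchRegs X) (f.eval σ) := by
  obtain ⟨-, h₂, h₃⟩ := h σ hσ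
  exact hσ.trans ⟨h₂, fun y hy => h₃ y (hy .tmp₁ (by simp [matchRegs]))
    (hy .tmp₃ (by simp [matchRegs]))⟩

theorem IsFetch.env {f : Prog} {v : ℕ} (h : IsFetch b (matchRegs X) σ₀ f v) {σ : Mem}
    (hσ : σ₀.Near b (matchRegs X) σ) : (f.eval σ).env b = σ.env b :=
  funext fun _ => (h σ hσ).2.2 _ (by simp) (by simp)

theorem assignCode_eval (hf : ∀ i ∈ l, IsFetch b (matchRegs X) σ₀ (f i) (v i)) (hX : ∀ i ∈ l, x i ∈ X)
    {σ : Mem} (hσ : σ₀.Near b (matchRegs X) σ) : σ₀.Near b (matchRegs X) ((assignCode b f x l).eval σ) ∧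
      ∀ ν : ℕ → ℕ, (∀ i ∈ l, v i = ν (x i)) →
        (∀ i ∈ l, ((assignCode b f x l).eval σ).env b (x i) = ν (x i)) ∧
        ∀ y, σ.env b y = ν y → ((assignCode b f x l).eval σ).env b y = ν y := by
  induction l generalizing σ with
  | nil =>
    refine ⟨hσ.trans (Mem.near_setReg (by simp [matchRegs])), fun ν _ => ⟨by simp, fun y hy => ?_⟩⟩
    simpa [assignCode, skipCode, Prog.eval] using hy
  | cons i l ih =>
    simp only [List.mem_cons, forall_eq_or_imp] at hf hX
    obtain ⟨h₁, h₂, h₃⟩ := hf.1 σ hσ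
    have h₄ := hf.1.env hσ
    set σ₁ := ((f i).eval σ).setReg (Rg.tmp₂.code b) 0 with hσ₁
    set σ₂ := σ₁.setReg ((Rg.var (x i)).code b) (v i) with hσ₂
    have n₂ : σ₀.Near b (matchRegs X) σ₂ :=
      ((hf.1.near hσ).trans (Mem.near_setReg (by simp [matchRegs]))).trans
        (Mem.near_setReg (by simp [matchRegs, hX.1]))
    have e₂ : σ₂.env b = Function.update (σ.env b) (x i) (v i) := by simp [hσ₂, hσ₁, h₄]
    have ev : (assignCode b f x (i :: l)).eval σ = (assignCode b f x l).eval σ₂ := by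
      simp [assignCode, Prog.eval, hσ₂, hσ₁, h₁]
    rw [ev]
    obtain ⟨i₁, i₂⟩ := ih hf.2 hX.2 n₂
    refine ⟨i₁, fun ν hν => ?_⟩
    simp only [List.mem_cons, forall_eq_or_imp] at hν ⊢
    obtain ⟨j₁, j₂⟩ := i₂ ν hν.2
    refine ⟨⟨j₂ _ (by simp [e₂, hν.1]), j₁⟩, fun y hy => j₂ y ?_⟩
    rw [e₂, Function.update_apply]
    split_ifs with hyx
    · rw [hyx, hν.1]
    · exact hy

theorem checkCode_eval (hf : ∀ i ∈ l, IsFetch b (matchRegs X) σ₀ (f i) (v i)) {σ : Mem}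
    (hσ : σ₀.Near b (matchRegs X) σ) :
    (∃ σ₁, σ₀.Near b (matchRegs X) σ₁ ∧ σ₁.env b = σ.env b ∧ (∀ i ∈ l, σ.env b (x i) = v i) ∧
        (checkCode b f x body l).eval σ = body.eval σ₁) ∨
      σ₀.Near b (matchRegs X) ((checkCode b f x body l).eval σ) ∧ ¬ ∀ i ∈ l, σ.env b (x i) = v i := by
  induction l generalizing σ with
  | nil => exact .inl ⟨σ, hσ, rfl, by simp, rfl⟩
  | cons i l ih =>
    simp only [List.mem_cons, forall_eq_or_imp] at hf ⊢
    obtain ⟨h₁, h₂, h₃⟩ := hf.1 σ hσ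
    have h₄ := hf.1.env hσ
    have h₅ := hf.1.near hσ
    have h₆ : ((f i).eval σ).reg ((Rg.var (x i)).code b) = σ.env b (x i) := congrFun h₄ (x i)
    have h₇ : σ₀.Near b (matchRegs X) ((skipCode b).eval ((f i).eval σ)) :=
      h₅.trans (Mem.near_setReg (by simp [matchRegs]))
    simp only [checkCode, Prog.eval, h₁, h₆]
    split_ifs with c₁ c₂
    · exact .inr ⟨h₇, fun h => by omega⟩
    · exact .inr ⟨h₇, fun h => by omega⟩
    · have c₃ : σ.env b (x i) = v i := by omega
      rcases ih hf.2 h₅ with ⟨σ₁, k₁, k₂, k₃, k₄⟩ | ⟨k₁, k₂⟩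
      · rw [h₄] at k₂ k₃
        exact .inl ⟨σ₁, k₁, k₂, ⟨c₃, k₃⟩, k₄⟩
      · rw [h₄] at k₂
        exact .inr ⟨k₁, fun h => k₂ h.2⟩

theorem matchCode_eval (hf : ∀ i ∈ l, IsFetch b (matchRegs X) σ₀ (f i) (v i)) (hX : ∀ i ∈ l, x i ∈ X) :
    (∃ σ₁, σ₀.Near b (matchRegs X) σ₁ ∧ (∀ i ∈ l, σ₁.env b (x i) = v i) ∧
        (matchCode b f x l body).eval σ₀ = body.eval σ₁) ∨
      σ₀.Near b (matchRegs X) ((matchCode b f x l body).eval σ₀) ∧ ¬ ∃ ν : ℕ → ℕ, ∀ i ∈ l, v i = ν (x i) := by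
  obtain ⟨h₁, h₂⟩ := assignCode_eval hf hX (Mem.Near.refl σ₀)
  rcases checkCode_eval (x := x) (body := body) hf h₁ with ⟨σ₁, k₁, k₂, k₃, k₄⟩ | ⟨k₁, k₂⟩
  · exact .inl ⟨σ₁, k₁, fun i hi => by rw [k₂, k₃ i hi], k₄⟩
  · refine .inr ⟨k₁, fun ⟨ν, hν⟩ => k₂ fun i hi => ?_⟩
    rw [(h₂ ν hν).1 i hi, hν i hi]

theorem assignCode_simple (hf : ∀ i, (f i).Simple) : (assignCode b f x l).Simple := by
  induction l with
  | nil => trivial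
  | cons i l ih => exact ⟨hf i, trivial, trivial, ih⟩

theorem matchCode_simple (hf : ∀ i, (f i).Simple) (hb : body.Simple) :
    (matchCode b f x l body).Simple := by
  refine ⟨assignCode_simple hf, ?_⟩
  induction l with
  | nil => exact hb
  | cons i l ih => exact ⟨hf i, trivial, trivial, ih⟩

theorem matchCode_writes (hf : ∀ i y, (f i).Writes y → y = Rg.tmp₁.code b ∨ y = Rg.tmp₃.code b)
    {y : ℕ} (h : (matchCode b f x l body).Writes y) :
    body.Writes y ∨ y = Rg.tmp₁.code b ∨ y = Rg.tmp₂.code b ∨ y = Rg.tmp₃.code b ∨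
      ∃ i ∈ l, y = (Rg.var (x i)).code b := by
  rcases h with h | h
  · right
    induction l with
    | nil => exact .inl h
    | cons i l ih =>
      rcases h with h | h | h | h
      · have := hf i y h; tauto
      · exact .inr (.inl h)
      · exact .inr (.inr (.inr ⟨i, by simp, h⟩))
      · rcases ih h with h | h | h | ⟨j, hj, h⟩
        · tauto
        · tauto
        · tauto
        · exact .inr (.inr (.inr ⟨j, by simp [hj], h⟩))
  · have : body.Writes y ∨ y = Rg.tmp₁.code b ∨ y = Rg.tmp₃.code b := by
      induction l with
      | nil => exact .inl h
      | cons i l ih =>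
        rcases h with h | h | h | h
        · exact .inr (hf i y h)
        · exact .inr (.inl h)
        · exact .inr (.inl h)
        · exact ih h
    tauto

theorem matchCode_stores (hf : ∀ i A, ¬ (f i).Stores A) {A : ℕ}
    (h : (matchCode b f x l body).Stores A) : body.Stores A := by
  rcases h with h | h
  · induction l with
    | nil => exact h.elim
    | cons i l ih =>
      rcases h with h | h | h | h
      · exact (hf i A h).elim
      · exact h.elim
      · exact h.elim
      · exact ih h
  · induction l with
    | nil => exact h
    | cons i l ih =>
      rcases h with h | h | h | h
      · exact (hf i A h).elim
      · exact h.elim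
      · exact h.elim
      · exact ih h

end matchCode

/-! ### Enumerating the matches of a list of atoms in the input -/

section matchAll

variable {S : Schema} {b : ℕ} {aid : Atom S → ℕ}

/-- Load component `j` of the current tuple of the atom. -/
def fetchCode (b : ℕ) (aid : Atom S → ℕ) (c : Σ a : Atom S, Fin (S.arity a.rel)) : Prog :=
  .const (Rg.tmp₃.code b) c.2 ;;
  .load (Rg.tmp₁.code b) c.1.rel [(Rg.aidx (aid c.1)).code b, Rg.tmp₃.code b]

/-- The positions of the arguments of a list of atoms. -/
def cells (G : List (Atom S)) : List (Σ a : Atom S, Fin (S.arity a.rel)) :=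
  G.flatMap fun a => (List.finRange (S.arity a.rel)).map fun j => ⟨a, j⟩

/-- Nested loops over the tuples of the relations of the atoms. -/
def nest (b : ℕ) (aid : Atom S → ℕ) (inner : Prog) : List (Atom S) → Prog
  | [] => inner
  | a :: G => .forLoop (Rg.one.code b) ((Rg.aidx (aid a)).code b) ((Rg.abnd (aid a)).code b)
      (nest b aid inner G)

/-- Load the sizes of the relations of the atoms. -/
def countCode (b : ℕ) (aid : Atom S → ℕ) : List (Atom S) → Prog
  | [] => skipCode b
  | a :: G => .load ((Rg.abnd (aid a)).code b) a.rel [] ;; countCode b aid G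

/-- Run `body` for all valuations that satisfy the atoms in the listed database. -/
def matchAll (b : ℕ) (aid : Atom S → ℕ) (G : List (Atom S)) (body : Prog) : Prog :=
  countCode b aid G ;;
  nest b aid (matchCode b (fetchCode b aid) (fun c => c.1.args c.2) (cells G) body) G

/-- A bound for the running time of `n` nested loops with at most `B` rounds each. -/
def nestCost (B T : ℕ) : ℕ → ℕ
  | 0 => T
  | n + 1 => B * (nestCost B T n + 3) + 3

theorem mem_cells {G : List (Atom S)} {c : Σ a : Atom S, Fin (S.arity a.rel)} :
    c ∈ cells G ↔ c.1 ∈ G := by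
  simp only [cells, List.mem_flatMap, List.mem_map, List.mem_finRange, true_and]
  constructor
  · rintro ⟨a, ha, j, rfl⟩
    exact ha
  · exact fun h => ⟨c.1, h, c.2, rfl⟩

theorem fetchCode_simple (c : Σ a : Atom S, Fin (S.arity a.rel)) : (fetchCode b aid c).Simple :=
  ⟨trivial, trivial⟩

theorem fetchCode_writes (c : Σ a : Atom S, Fin (S.arity a.rel)) (y : ℕ)
    (h : (fetchCode b aid c).Writes y) : y = Rg.tmp₁.code b ∨ y = Rg.tmp₃.code b := by
  rcases h with h | h
  exacts [.inr h, .inl h]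

theorem fetchCode_stores (c : Σ a : Atom S, Fin (S.arity a.rel)) (A : ℕ) :
    ¬ (fetchCode b aid c).Stores A := by
  simp [fetchCode, Prog.Stores]

theorem nest_writes {inner : Prog} {G : List (Atom S)} {y : ℕ}
    (h : (nest b aid inner G).Writes y) :
    inner.Writes y ∨ ∃ a ∈ G, y = (Rg.aidx (aid a)).code b := by
  induction G with
  | nil => exact .inl h
  | cons a G ih =>
    rcases h with h | h | h
    · exact .inr ⟨a, by simp, h⟩
    · exact (ih h).imp_right fun ⟨a, ha, h⟩ => ⟨a, by simp [ha], h⟩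
    · exact .inr ⟨a, by simp, h⟩

theorem countCode_simple (G : List (Atom S)) : (countCode b aid G).Simple := by
  induction G with
  | nil => trivial
  | cons a G ih => exact ⟨trivial, ih⟩

theorem Listing.initMem_nil (L : Listing S) (r : Fin S.numRel) :
    L.initMem.arr r [] = (L.list r).length := by
  simp [Listing.initMem]

theorem Listing.initMem_cell (L : Listing S) (r : Fin S.numRel) (i : ℕ) (j : Fin (S.arity r))
    {t : S.Tuple r} (ht : (L.list r)[i]? = some t) : L.initMem.arr r [i, j] = t j := by
  obtain ⟨hi, ht⟩ := List.getElem?_eq_some_iff.1 ht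
  simp [Listing.initMem, hi, ht]

theorem countCode_eval (L : Listing S) {G : List (Atom S)} (hG : G.Nodup)
    (hid : ∀ a ∈ G, ∀ a' ∈ G, aid a = aid a' → a = a') {X : Set ℕ} {σ : Mem}
    (hin : ∀ r < S.numRel, σ.arr r = L.initMem.arr r) :
    σ.Near b (loopRegs X) ((countCode b aid G).eval σ) ∧ ∀ a ∈ G,
      ((countCode b aid G).eval σ).reg ((Rg.abnd (aid a)).code b) = (L.list a.rel).length := by
  have keep : ∀ (G : List (Atom S)) (σ : Mem) (y : ℕ),
      (∀ a ∈ G, y ≠ aid a) → ((countCode b aid G).eval σ).reg ((Rg.abnd y).code b) =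
        σ.reg ((Rg.abnd y).code b) := by
    intro G
    induction G with
    | nil => intro σ y _; simp [countCode, skipCode, Prog.eval]
    | cons a G ih =>
      intro σ y hy
      simp only [List.mem_cons, forall_eq_or_imp] at hy
      rw [countCode, Prog.eval, ih _ _ hy.2]
      simp [Prog.eval, hy.1]
  induction G generalizing σ with
  | nil => exact ⟨Mem.near_setReg (by simp [loopRegs, matchRegs]), by simp⟩
  | cons a G ih =>
    rw [List.nodup_cons] at hG
    simp only [List.mem_cons, forall_eq_or_imp] at hid ⊢
    obtain ⟨h₁, h₂⟩ := ih hG.2 (fun a ha a' ha' => (hid.2 a ha).2 a' ha')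
      (σ := σ.setReg ((Rg.abnd (aid a)).code b) (σ.arr a.rel [])) hin
    refine ⟨(Mem.near_setReg (by simp [loopRegs, matchRegs])).trans h₁, ?_, h₂⟩
    rw [countCode, Prog.eval, keep]
    · simp [Prog.eval, hin a.rel a.rel.isLt, L.initMem_nil]
    · intro a' ha' h
      exact hG.1 ((hid.1.2 a' ha' h) ▸ ha')

/-- Loop rule for `matchAll`: `I s σ` states that the matches with keys in `s` have been processed.
After the loop, all matches have been processed. -/
theorem matchAll_exec (L : Listing S) {G : List (Atom S)} (hG : G.Nodup)
    (hid : ∀ a ∈ G, ∀ a' ∈ G, aid a = aid a' → a = a') {body : Prog} (hbs : body.Simple)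
    (hbw : ∀ r : Rg, body.Writes (r.code b) → r ≠ .one ∧ ∀ a, r ≠ .aidx a ∧ r ≠ .abnd a)
    {B : ℕ} (hB : ∀ a ∈ G, (L.list a.rel).length ≤ B)
    {α : Type*} {key : (ℕ → ℕ) → α} (I : Set α → Mem → Prop) {X : Set ℕ}
    (hX : ∀ a ∈ G, ∀ j, a.args j ∈ X)
    (hkey : ∀ ν ν' : ℕ → ℕ, (∀ a ∈ G, ∀ j, ν (a.args j) = ν' (a.args j)) → key ν = key ν')
    (hI : ∀ s σ σ', I s σ → σ.Near b (loopRegs X) σ' → I s σ')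
    (hone : ∀ s σ, I s σ → σ.reg (Rg.one.code b) = 1)
    (hin : ∀ s σ, I s σ → ∀ r < S.numRel, σ.arr r = L.initMem.arr r)
    (hbody : ∀ s σ ν, I s σ → (∀ a ∈ G, (fun j => ν (a.args j)) ∈ L.db a.rel) →
      (∀ a ∈ G, ∀ j, σ.env b (a.args j) = ν (a.args j)) → I (insert (key ν) s) (body.eval σ))
    {s : Set α} {σ : Mem} (hs : I s σ) :
    ∃ tr σ', (matchAll b aid G body).Exec σ tr σ' ∧
      tr.length ≤ nestCost B (matchAll b aid G body).size G.length + (matchAll b aid G body).size ∧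
      I (s ∪ key '' {ν | ∀ a ∈ G, (fun j => ν (a.args j)) ∈ L.db a.rel}) σ' := by
  set inner := matchCode b (fetchCode b aid) (fun c => c.1.args c.2) (cells G) body with hinner
  have inner_simple : inner.Simple := matchCode_simple fetchCode_simple hbs
  set T := (matchAll b aid G body).size with hT
  -- one run of the innermost program, with the positions `τ` of the tuples
  have hin_step : ∀ (τ : Atom S → ℕ) s σ, I s σ →
      (∀ a ∈ G, σ.reg ((Rg.aidx (aid a)).code b) = τ a ∧ τ a < (L.list a.rel).length) →
      I (s ∪ key '' {ν | ∀ a ∈ G, (L.list a.rel)[τ a]? = some fun j => ν (a.args j)})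
        (inner.eval σ) := by
    intro τ s σ hs hτ
    have htup : ∀ a : Atom S, ∃ t : S.Tuple a.rel, a ∈ G → (L.list a.rel)[τ a]? = some t := by
      intro a
      by_cases ha : a ∈ G
      · exact ⟨_, fun _ => List.getElem?_eq_getElem (hτ a ha).2⟩
      · exact ⟨fun _ => 0, fun h => (ha h).elim⟩
    choose t ht using htup
    have hfetch : ∀ c ∈ cells G, IsFetch b (matchRegs X) σ (fetchCode b aid c) (t c.1 c.2) := by
      intro c hc σ' hσ'
      rw [mem_cells] at hc
      have harr : σ'.arr c.1.rel = L.initMem.arr c.1.rel := by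
        rw [hσ'.1, hin s σ hs _ c.1.rel.isLt]
      have hcell := L.initMem_cell c.1.rel (τ c.1) c.2 (ht c.1 hc)
      have hidx : σ'.reg ((Rg.aidx (aid c.1)).code b) = τ c.1 := by
        rw [hσ'.reg (by simp [matchRegs]), (hτ c.1 hc).1]
      refine ⟨?_, rfl, ?_⟩
      · simp [fetchCode, Prog.eval, harr, hidx, hcell]
      · intro y h₁ h₂
        simp [fetchCode, Prog.eval, h₁, h₂]
    have sub : matchRegs X ⊆ loopRegs X := fun r hr => .inl hr
    rcases matchCode_eval (body := body) (x := fun c => c.1.args c.2) hfetch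
      (fun c hc => hX c.1 (mem_cells.1 hc) c.2) with ⟨σ₁, n₁, h₁, h₂⟩ | ⟨n₁, h₁⟩
    · have hν : ∀ a ∈ G, ∀ j, σ₁.env b (a.args j) = t a j := fun a ha j =>
        h₁ ⟨a, j⟩ (mem_cells.2 ha)
      have hset : key '' {ν | ∀ a ∈ G, (L.list a.rel)[τ a]? = some fun j => ν (a.args j)} =
          {key (σ₁.env b)} := by
        ext k
        simp only [Set.mem_image, Set.mem_ofPred_eq, Set.mem_singleton_iff]
        constructor
        · rintro ⟨ν, h, rfl⟩
          refine hkey _ _ fun a ha j => ?_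
          have := h a ha
          rw [ht a ha, Option.some.injEq] at this
          rw [hν a ha, this]
        · rintro rfl
          refine ⟨_, fun a ha => ?_, rfl⟩
          rw [ht a ha]
          exact congrArg some (funext fun j => (hν a ha j).symm)
      rw [hset, Set.union_singleton, hinner, h₂]
      refine hbody s σ₁ _ (hI _ _ _ hs (n₁.mono sub)) (fun a ha => ?_) fun _ _ _ => rfl
      have : (fun j => σ₁.env b (a.args j)) = t a := funext (hν a ha)
      rw [this]
      exact List.mem_toFinset.2 (List.mem_of_getElem? (ht a ha))
    · have hset : key '' {ν | ∀ a ∈ G, (L.list a.rel)[τ a]? = some fun j => ν (a.args j)} = ∅ := by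
        rw [Set.image_eq_empty, Set.eq_empty_iff_forall_notMem]
        intro ν hν
        refine h₁ ⟨ν, fun c hc => ?_⟩
        have := hν c.1 (mem_cells.1 hc)
        rw [ht _ (mem_cells.1 hc), Option.some.injEq] at this
        rw [this]
      rw [hset, Set.union_empty, hinner]
      exact hI _ _ _ hs (n₁.mono sub)
  have inner_writes : ∀ r : Rg, inner.Writes (r.code b) →
      r ≠ .one ∧ ∀ a, r ≠ .aidx a ∧ r ≠ .abnd a := by
    intro r hr
    rcases matchCode_writes fetchCode_writes hr with h | h | h | h | ⟨i, _, h⟩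
    · exact hbw r h
    all_goals
      rw [Rg.code_inj] at h
      subst h
      simp
  -- the loops over the tuples of the atoms in `G'`, for fixed positions of the other tuples
  have hnest : ∀ (G' : List (Atom S)), G' <:+ G → ∀ (τ : Atom S → ℕ) s σ, I s σ →
      (∀ a ∈ G, a ∉ G' → σ.reg ((Rg.aidx (aid a)).code b) = τ a ∧ τ a < (L.list a.rel).length) →
      (∀ a ∈ G', σ.reg ((Rg.abnd (aid a)).code b) = (L.list a.rel).length) →
      ∃ tr σ', (nest b aid inner G').Exec σ tr σ' ∧ tr.length ≤ nestCost B T G'.length ∧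
        I (s ∪ key '' {ν | (∀ a ∈ G, (fun j => ν (a.args j)) ∈ L.db a.rel) ∧
          ∀ a ∈ G, a ∉ G' → (L.list a.rel)[τ a]? = some fun j => ν (a.args j)}) σ' := by
    intro G'
    induction G' with
    | nil =>
      intro _ τ s σ hs hτ _
      obtain ⟨n, hn, he⟩ := inner_simple.exec σ
      have hnT : n ≤ T := by
        refine hn.trans ?_
        have : ∀ G : List (Atom S), inner.size ≤ (nest b aid inner G).size := by
          intro G
          induction G with
          | nil => exact le_rfl
          | cons a G ih => simp only [nest, Prog.forLoop, Prog.size]; omega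
        have := this G
        simp only [hT, matchAll, Prog.size, ← hinner]
        omega
      refine ⟨_, _, he, by simpa [nestCost] using hnT, ?_⟩
      have := hin_step τ s σ hs (fun a ha => hτ a ha (by simp))
      convert this using 3
      ext ν
      simp only [Set.mem_ofPred_eq, List.not_mem_nil, not_false_eq_true, forall_const, and_iff_right_iff_imp]
      exact fun h a ha => List.mem_toFinset.2 (List.mem_of_getElem? (h a ha))
    | cons a G' ih =>
      intro hsuf τ s σ hs hτ hbnd
      have hsuf' : G' <:+ G := (List.suffix_cons a G').trans hsuf
      have haG : a ∈ G := hsuf.subset (by simp)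
      have hnd : a ∉ G' := (List.nodup_cons.1 (hsuf.sublist.nodup hG)).1
      have hw : ∀ r : Rg, (nest b aid inner G').Writes (r.code b) →
          r ≠ .one ∧ r ≠ .aidx (aid a) ∧ (∀ a, r ≠ .abnd a) ∧
            ∀ a' ∈ G, a' ∉ G' → r ≠ .aidx (aid a') := by
        intro r hr
        rcases nest_writes hr with h | ⟨a', ha', h⟩
        · have := inner_writes r h
          exact ⟨this.1, (this.2 _).1, fun a => (this.2 a).2, fun a' _ _ => (this.2 _).1⟩
        · rw [Rg.code_inj] at h
          subst h
          refine ⟨by simp, fun h => ?_, by simp, fun a'' h₁ h₂ h => ?_⟩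
          · simp only [Rg.aidx.injEq] at h
            exact hnd (hid a' (hsuf'.subset ha') a haG h ▸ ha')
          · simp only [Rg.aidx.injEq] at h
            exact h₂ (hid a' (hsuf'.subset ha') a'' h₁ h ▸ ha')
      set C : ℕ → Set (ℕ → ℕ) := fun i => {ν | (∀ a ∈ G, (fun j => ν (a.args j)) ∈ L.db a.rel) ∧
          (∀ a' ∈ G, a' ∉ a :: G' → (L.list a'.rel)[τ a']? = some fun j => ν (a'.args j)) ∧
          ∃ k < i, (L.list a.rel)[k]? = some fun j => ν (a.args j)} with hC
      obtain ⟨tr, σ', he, hlen, hI', -⟩ := Prog.exec_forLoop (o := Rg.one.code b)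
        (i := (Rg.aidx (aid a)).code b) (n := (Rg.abnd (aid a)).code b)
        (body := nest b aid inner G') (N := (L.list a.rel).length) (T := nestCost B T G'.length)
        (fun i σ => I (s ∪ key '' C i) σ ∧
          (∀ a' ∈ G, a' ∉ a :: G' →
            σ.reg ((Rg.aidx (aid a')).code b) = τ a' ∧ τ a' < (L.list a'.rel).length) ∧
          ∀ a' ∈ G', σ.reg ((Rg.abnd (aid a')).code b) = (L.list a'.rel).length)
        (by simp) (by simp) (fun h => (hw _ h).2.1 rfl) (fun h => (hw _ h).2.2.1 _ rfl)
        (fun h => (hw _ h).1 rfl)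
        (by
          rintro i σ v ⟨h₁, h₂, h₃⟩
          refine ⟨hI _ _ _ h₁ (Mem.near_setReg (by simp [loopRegs])), fun a' ha' hn => ?_,
            fun a' ha' => by simpa using h₃ a' ha'⟩
          have hne : aid a' ≠ aid a := fun h => hn (by simp [hid a' ha' a haG h])
          simpa [hne] using h₂ a' ha' hn)
        (by
          rintro i hi σ ⟨h₁, h₂, h₃⟩ hidx -
          classical
          obtain ⟨tr, σ', he, hlen, hI'⟩ := ih hsuf' (Function.update τ a i) _ σ h₁
            (fun a' ha' hn => by
              by_cases haa : a' = a
              · subst haa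
                simp [hidx, hi]
              · simpa [haa] using h₂ a' ha' (by simp [haa, hn])) h₃
          refine ⟨tr, σ', he, hlen, ?_, fun a' ha' hn => ?_, fun a' ha' => ?_⟩
          · rw [Set.union_assoc, ← Set.image_union] at hI'
            convert hI' using 3
            ext ν
            simp only [hC, Set.mem_ofPred_eq, Set.mem_union]
            constructor
            · rintro ⟨k₁, k₂, k, hk, k₃⟩
              rcases Nat.lt_succ_iff_lt_or_eq.1 hk with hk | rfl
              · exact .inl ⟨k₁, k₂, k, hk, k₃⟩
              · refine .inr ⟨k₁, fun a' ha' hn => ?_⟩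
                by_cases haa : a' = a
                · subst haa
                  simpa using k₃
                · simpa [haa] using k₂ a' ha' (by simp [haa, hn])
            · rintro (⟨k₁, k₂, k, hk, k₃⟩ | ⟨k₁, k₂⟩)
              · exact ⟨k₁, k₂, k, by omega, k₃⟩
              · refine ⟨k₁, fun a' ha' hn => ?_, i, by omega, by simpa using k₂ a haG hnd⟩
                simp only [List.mem_cons, not_or] at hn
                simpa [hn.1] using k₂ a' ha' hn.2
          · rw [he.reg_eq fun h => (hw _ h).2.2.2 a' ha' (fun h => hn (by simp [h])) rfl]
            exact h₂ a' ha' hn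
          · rw [he.reg_eq fun h => (hw _ h).2.2.1 _ rfl]
            exact h₃ a' ha')
        σ
        ⟨by
          have : C 0 = ∅ := by
            rw [Set.eq_empty_iff_forall_notMem]
            rintro ν ⟨-, -, k, hk, -⟩
            omega
          rw [this, Set.image_empty, Set.union_empty]
          exact hs, hτ, fun a' ha' => hbnd a' (by simp [ha'])⟩
        (hbnd a (by simp)) (hone s σ hs)
      refine ⟨tr, σ', he, ?_, ?_⟩
      · refine hlen.trans ?_
        simp only [nestCost, List.length_cons]
        have := Nat.mul_le_mul_right (nestCost B T G'.length + 3) (hB a haG)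
        omega
      · convert hI' using 3
        ext ν
        simp only [hC, Set.mem_ofPred_eq, and_congr_right_iff, iff_self_and]
        intro h₁ _
        obtain ⟨k, hk, h⟩ := List.getElem_of_mem (List.mem_toFinset.1 (h₁ a haG))
        exact ⟨k, hk, by rw [List.getElem?_eq_getElem hk, h]⟩
  obtain ⟨hn₁, hn₂⟩ := countCode_eval (X := X) L hG hid (hin s σ hs)
  obtain ⟨n, hn, he⟩ := (countCode_simple (b := b) (aid := aid) G).exec σ
  obtain ⟨tr, σ', he', hlen, hI'⟩ := hnest G List.suffix_rfl (fun _ => 0) s _ (hI _ _ _ hs hn₁)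
    (fun a h h' => (h' h).elim) hn₂
  refine ⟨_, σ', he.seq he', ?_, ?_⟩
  · have : n + 1 ≤ T := by
      simp only [hT, matchAll, Prog.size]
      omega
    simp only [List.length_cons, List.length_append, List.length_replicate]
    omega
  · convert hI' using 3
    ext ν
    simp only [Set.mem_ofPred_eq, iff_self_and]
    exact fun _ a h h' => (h' h).elim

end matchAll

namespace Plan

variable {b : ℕ} {m : ℕ → List ℕ → ℕ}

/-! ### Updating a leaf and answering a query -/

/-- Set the entry of leaf `a` at the current values of its arguments to the content of register
`val`, and restore the invariant. -/
def updateLeaf (b a : ℕ) (args : List ℕ) (val : Rg) (p : Plan) : Prog :=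
  .store ((Ar.bit a).code b) (vregs b args) (val.code b) ;; p.refresh b a

theorem updateLeaf_simple (b a : ℕ) (args : List ℕ) (val : Rg) (p : Plan) :
    (p.updateLeaf b a args val).Simple := ⟨trivial, refresh_simple b a p⟩

theorem updateLeaf_writes {a : ℕ} {args : List ℕ} {val : Rg} {p : Plan} {y : ℕ}
    (h : (p.updateLeaf b a args val).Writes y) :
    y = Rg.tmp₁.code b ∨ y = Rg.tmp₂.code b ∨ y = Rg.tmp₃.code b ∨ y = Rg.ans.code b := by
  rcases h with h | h
  · exact h.elim
  · exact refresh_writes h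

theorem updateLeaf_stores {a : ℕ} {args : List ℕ} {val : Rg} {p : Plan} {A : ℕ}
    (h : (p.updateLeaf b a args val).Stores A) : A = (Ar.bit a).code b ∨
    ∃ x ∈ p.bvars, A = (Ar.pos x).code b ∨ A = (Ar.cnt x).code b ∨ A = (Ar.list x).code b := by
  rcases h with h | h
  · exact .inl h
  · exact .inr (refresh_stores h)

theorem updateLeaf_inv {p : Plan} {a : ℕ} {args : List ℕ} {val : Rg} {σ : Mem} (hw : p.WF)
    (hpath : p.Path a args) (ha : a ∈ p.leaves) (h1 : σ.reg (Rg.one.code b) = 1)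
    (hm : p.Inv b σ.arr) : p.Inv b ((p.updateLeaf b a args val).eval σ).arr := by
  refine refresh_inv (m := σ.arr) (args := args) hw hpath ha (by simpa [Prog.eval] using h1) hm
    ?_ ?_
  · intro a' l hl
    have : ¬ (a' = a ∧ l = args.map (σ.env b)) := fun h => hl h.1 h.2
    simp [Prog.eval, this]
  · intro x _
    refine ⟨?_, ?_, ?_⟩ <;> funext l <;> simp [Prog.eval]

theorem updateLeaf_bit {p : Plan} {a a' : ℕ} {args l : List ℕ} {val : Rg} {σ : Mem} :
    ((p.updateLeaf b a args val).eval σ).arr ((Ar.bit a').code b) l =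
      if a' = a ∧ l = args.map (σ.env b) then σ.reg (val.code b)
      else σ.arr ((Ar.bit a').code b) l := by
  rw [updateLeaf, Prog.eval, refresh_arr a p _ (by simp)]
  simp [Prog.eval]

theorem updateLeaf_reg {a : ℕ} {args : List ℕ} {val : Rg} {p : Plan} {σ : Mem} {r : Rg}
    (hr : r ≠ .tmp₁ ∧ r ≠ .tmp₂ ∧ r ≠ .tmp₃ ∧ r ≠ .ans) :
    ((p.updateLeaf b a args val).eval σ).reg (r.code b) = σ.reg (r.code b) :=
  (updateLeaf_simple b a args val p).eval_reg σ fun h => by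
    have := updateLeaf_writes h
    simp only [Rg.code_inj] at this
    tauto

theorem updateLeaf_arr_lt {a : ℕ} {args : List ℕ} {val : Rg} {p : Plan} {σ : Mem} {A : ℕ}
    (hA : A < b) : ((p.updateLeaf b a args val).eval σ).arr A = σ.arr A :=
  (updateLeaf_simple b a args val p).eval_arr σ fun h => by
    rcases updateLeaf_stores h with h | ⟨x, -, h | h | h⟩ <;>
      simp only [h, Ar.code] at hA <;> omega

/-- Output the head for every solution of the plan. -/
def answerCode (b : ℕ) (p : Plan) (head : List ℕ) : Prog :=
  .const (Rg.one.code b) 1 ;; p.status b ;;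
  .ite (Rg.ans.code b) (Rg.one.code b) (skipCode b) (p.enum b (.emit (vregs b head)))

theorem answerCode_stores (p : Plan) (head : List ℕ) (A : ℕ) :
    ¬ (p.answerCode b head).Stores A := by
  simp only [answerCode, Prog.Stores, skipCode, false_or, not_or]
  exact ⟨status_stores, enum_stores (by simp [Prog.Stores])⟩

/-- The plan is evaluated with constant delay. -/
theorem answerCode_exec {p : Plan} (hw : p.WF) {head : List ℕ} (hhead : ∀ x, x ∈ head ↔ x ∈ p.outs)
    (σ : Mem) (hm : p.Inv b σ.arr) :
    ∃ tr σ', (p.answerCode b head).Exec σ tr σ' ∧ (tr.filterMap id).Nodup ∧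
      (∀ t, t ∈ tr.filterMap id ↔ ∃ μ : ℕ → ℕ, (∀ y ∈ p.fv, μ y = σ.env b y) ∧
        p.Sat b σ.arr μ ∧ t = head.map μ) ∧
      GapLE (p.delay 1 + (p.status b).size + 5) tr := by
  have hout : p.fv.Disjoint p.outs := fun y hy hy' => hw.fv_disjoint hy (outs_subset_bvars p hy')
  set σ₁ := σ.setReg (Rg.one.code b) 1 with hσ₁
  obtain ⟨n, hn, he⟩ := (status_simple b p).exec σ₁
  set σ₂ := (p.status b).eval σ₁ with hσ₂
  have a₂ : σ₂.arr = σ.arr := status_arr p σ₁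
  have e₂ : σ₂.env b = σ.env b := by rw [hσ₂, status_env, hσ₁, Mem.env_setReg _ _ _ _ (by simp)]
  have o₂ : σ₂.reg (Rg.one.code b) = 1 := by
    rw [hσ₂, status_reg p σ₁ (by simp) (by simp)]; simp [hσ₁]
  have st := status_ans (b := b) (p := p) (σ := σ₁) (by simp [hσ₁]) hm
  rw [← hσ₂] at st
  have e₁ : σ₁.env b = σ.env b := Mem.env_setReg _ _ _ _ (by simp)
  rw [e₁] at st
  have silent : ∀ t : List Event,
      (none :: ([none] ++ none :: (List.replicate n none ++ none :: t))).filterMap id =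
        t.filterMap id := by
    intro t
    simp [List.filterMap_append]
  by_cases hh : p.Holds b σ.arr (σ.env b)
  · have hlt : ¬ σ₂.reg (Rg.ans.code b) < σ₂.reg (Rg.one.code b) := by
      have := st.2 hh
      omega
    obtain ⟨tr, σ', he', htr, hg⟩ := enum_exec hw (m := σ.arr) hm (body := .emit (vregs b head))
      (U := p.fv) (V := []) (c := 1) (out := fun ν => [head.map ν]) (by intro y hy; exact hy.elim)
      (by simp [Prog.Stores]) (List.Subset.refl _) hw.fv_disjoint (by simp) (by simp) hh
      (by
        intro ν' _ σ _ hσν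
        refine ⟨_, σ, Prog.Exec.emit _ σ, ?_, ⟨_, List.mem_singleton.2 rfl, by simp⟩,
          .of_length (by simp)⟩
        have : head.map (σ.env b) = head.map ν' := map_congr_of_agree fun x hx =>
          hσν x (List.mem_append_right _ ((hhead x).1 hx))
        simp [this])
      σ₂ a₂ (fun x _ => by rw [e₂])
    refine ⟨_, σ', (Prog.Exec.const _ _ _).seq (he.seq (.ite_neg hlt he')), ?_, ?_, ?_⟩
    · rw [silent, htr, ← List.map_eq_flatMap]
      refine (sols_nodup hw hm _).map_on fun μ₁ h₁ μ₂ h₂ h => funext fun y => ?_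
      by_cases hy : y ∈ p.outs
      · exact List.map_inj_left.1 h y ((hhead y).2 hy)
      · rw [sols_agree h₁ hy, sols_agree h₂ hy]
    · intro t
      simp only [silent, htr, List.mem_flatMap, List.mem_singleton, mem_sols hw hm hh]
      constructor
      · rintro ⟨μ, ⟨h₁, h₂⟩, rfl⟩
        exact ⟨μ, fun y hy => h₁ y (hout hy), h₂, rfl⟩
      · rintro ⟨μ, h₁, h₂, rfl⟩
        classical
        refine ⟨fun y => if y ∈ p.outs then μ y else σ.env b y, ⟨fun y hy => by simp [hy], ?_⟩, ?_⟩
        · refine (sat_congr hw fun y hy => ?_).2 h₂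
          split_ifs with hyo
          · rfl
          · exact (h₁ y (hy.resolve_right hyo)).symm
        · exact map_congr_of_agree fun y hy => by simp [(hhead y).1 hy]
    · have := hg.wrap (s := none :: none :: none :: (List.replicate n none ++ [none])) (u := [])
        (d := (p.status b).size + 5) (k := p.delay 1 + (p.status b).size + 5)
        (by simp; omega) (by omega)
      simpa using this.2
  · have hlt : σ₂.reg (Rg.ans.code b) < σ₂.reg (Rg.one.code b) := by
      have := st.not.2 hh
      omega
    refine ⟨_, _, (Prog.Exec.const _ _ _).seq (he.seq (.ite_pos hlt (Prog.Exec.const _ _ _))),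
      ?_, ?_, .of_length ?_⟩
    · simp
    · intro t
      rw [silent]
      simp only [List.filterMap_cons_none, id_eq, List.filterMap_nil, List.not_mem_nil, false_iff]
      rintro ⟨μ, h₁, h₂, -⟩
      exact hh ((holds_congr_env hw h₁).1 h₂.holds)
    · simp
      omega

/-! ### Tries of static tuples -/

/-- The plan that enumerates the variables `os` one after the other, for given values of the
variables `ks`; the tuples are stored at leaf `a`. -/
def trie (a : ℕ) : List ℕ → List ℕ → Plan
  | ks, [] => leaf a ks
  | ks, o :: os => bind true o ks (trie a (ks ++ [o]) os)

theorem trie_fv (a : ℕ) (ks os : List ℕ) : (trie a ks os).fv = ks := by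
  cases os <;> rfl

theorem trie_bvars (a : ℕ) (ks os : List ℕ) : (trie a ks os).bvars = os := by
  induction os generalizing ks with
  | nil => rfl
  | cons o os ih => simp [trie, bvars, ih]

theorem trie_outs (a : ℕ) (ks os : List ℕ) : (trie a ks os).outs = os := by
  induction os generalizing ks with
  | nil => rfl
  | cons o os ih => simp [trie, outs, ih]

theorem trie_leaves (a : ℕ) (ks os : List ℕ) : (trie a ks os).leaves = [a] := by
  induction os generalizing ks with
  | nil => rfl
  | cons o os ih => simp [trie, leaves, ih]

theorem trie_WF {a : ℕ} {ks os : List ℕ} (h : (ks ++ os).Nodup) : (trie a ks os).WF := by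
  induction os generalizing ks with
  | nil => trivial
  | cons o os ih =>
    have h' : ((ks ++ [o]) ++ os).Nodup := by simpa using h
    refine ⟨ih h', ?_, ?_, ?_, ?_⟩
    · rw [trie_fv]
      intro x hx
      simp only [List.mem_append, List.mem_singleton] at hx
      simp only [List.mem_cons]
      tauto
    all_goals
      rw [List.nodup_append'] at h
      obtain ⟨h₁, h₂, h₃⟩ := h
    · exact fun hx => h₃ hx (by simp)
    · rw [trie_bvars]
      exact (List.nodup_cons.1 h₂).1
    · rw [trie_bvars]
      exact fun x hx hx' => h₃ hx (by simp [hx'])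

theorem trie_path (a : ℕ) (ks os : List ℕ) : (trie a ks os).Path a (ks ++ os) := by
  induction os generalizing ks with
  | nil => simp [trie, Path]
  | cons o os ih =>
    refine ⟨by simpa using ih (ks ++ [o]), fun _ => ⟨by simp, List.subset_append_left _ _⟩⟩

theorem trie_sat {a : ℕ} {ks os : List ℕ} {μ : ℕ → ℕ} :
    (trie a ks os).Sat b m μ ↔ m ((Ar.bit a).code b) ((ks ++ os).map μ) ≠ 0 := by
  induction os generalizing ks with
  | nil => simp [trie, Sat]
  | cons o os ih =>
    have := ih (ks := ks ++ [o])
    rw [List.append_assoc] at this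
    exact this

theorem trie_not_holds {a : ℕ} {ks os : List ℕ} {μ : ℕ → ℕ}
    (h : ∀ l, m ((Ar.bit a).code b) l = 0) : ¬ (trie a ks os).Holds b m μ := by
  induction os generalizing ks μ with
  | nil => simp [trie, Holds, h]
  | cons o os ih => rintro ⟨v, hv⟩; exact ih hv

theorem trie_inv_of_zero {a : ℕ} {ks os : List ℕ} (h : ∀ l, m ((Ar.bit a).code b) l = 0)
    (h' : ∀ x ∈ os, ∀ l, m ((Ar.pos x).code b) l = 0 ∧ m ((Ar.cnt x).code b) l = 0) :
    (trie a ks os).Inv b m := by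
  induction os generalizing ks with
  | nil => trivial
  | cons o os ih =>
    simp only [List.mem_cons, forall_eq_or_imp] at h'
    refine ⟨ih h'.2, fun ν => ?_⟩
    simp only [trie_not_holds h]
    exact SetRep.empty (fun l => (h'.1 l).1) (fun l => (h'.1 l).2)

end Plan

section fill

variable {S : Schema} {b : ℕ} {aid : Atom S → ℕ}

theorem matchAll_writes {G : List (Atom S)} {body : Prog} {r : Rg}
    (h : (matchAll b aid G body).Writes (r.code b)) : body.Writes (r.code b) ∨
      r ∈ loopRegs {x | ∃ a ∈ G, ∃ j, a.args j = x} := by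
  rcases h with h | h
  · right
    induction G with
    | nil =>
      have : r = .tmp₁ := by simpa [countCode, skipCode, Prog.Writes] using h
      simp [loopRegs, matchRegs, this]
    | cons a G ih =>
      rcases h with h | h
      · rw [Prog.Writes, Rg.code_inj] at h
        simp [loopRegs, h]
      · rcases ih h with h | h
        · left
          rcases h with h | h | h | ⟨x, ⟨a', ha', hx⟩, h⟩
          · exact .inl h
          · exact .inr (.inl h)
          · exact .inr (.inr (.inl h))
          · exact .inr (.inr (.inr ⟨x, ⟨a', by simp [ha'], hx⟩, h⟩))
        · exact .inr h
  · rcases nest_writes h with h | ⟨a, -, h⟩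
    · rcases matchCode_writes fetchCode_writes h with h | h | h | h | ⟨c, hc, h⟩
      · exact .inl h
      all_goals
        rw [Rg.code_inj] at h
        subst h
        right
      · simp [loopRegs, matchRegs]
      · simp [loopRegs, matchRegs]
      · simp [loopRegs, matchRegs]
      · exact .inl (.inr (.inr (.inr ⟨_, ⟨c.1, mem_cells.1 hc, c.2, rfl⟩, rfl⟩)))
    · rw [Rg.code_inj] at h
      simp [loopRegs, h]

theorem matchAll_stores {G : List (Atom S)} {body : Prog} {A : ℕ}
    (h : (matchAll b aid G body).Stores A) : body.Stores A := by
  rcases h with h | h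
  · induction G with
    | nil => exact h.elim
    | cons a G ih =>
      rcases h with h | h
      · exact h.elim
      · exact ih h
  · have : ∀ (inner : Prog) (G : List (Atom S)), (nest b aid inner G).Stores A →
        inner.Stores A := by
      intro inner G
      induction G with
      | nil => exact id
      | cons a G ih =>
        rintro (h | h | h)
        · exact h.elim
        · exact ih h
        · exact h.elim
    exact matchCode_stores fetchCode_stores (this _ _ h)

/-- Store the projections of all matches of the atoms `G` to the variables `ks ++ os` in a trie. -/
def fillCode (b : ℕ) (aid : Atom S → ℕ) (G : List (Atom S)) (a : ℕ) (ks os : List ℕ) : Prog :=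
  matchAll b aid G ((Plan.trie a ks os).updateLeaf b a (ks ++ os) .one)

theorem fillCode_stores {G : List (Atom S)} {a : ℕ} {ks os : List ℕ} {A : ℕ}
    (h : (fillCode b aid G a ks os).Stores A) : A = (Ar.bit a).code b ∨
    ∃ x ∈ os, A = (Ar.pos x).code b ∨ A = (Ar.cnt x).code b ∨ A = (Ar.list x).code b := by
  have := Plan.updateLeaf_stores (matchAll_stores h)
  rwa [Plan.trie_bvars] at this

theorem fillCode_exec (L : Listing S) (hb : S.numRel ≤ b) {G : List (Atom S)} (hG : G.Nodup)
    (hid : ∀ a ∈ G, ∀ a' ∈ G, aid a = aid a' → a = a')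
    {B : ℕ} (hB : ∀ a ∈ G, (L.list a.rel).length ≤ B) {a : ℕ} {ks os : List ℕ}
    (hnd : (ks ++ os).Nodup) (hvars : ∀ x ∈ ks ++ os, ∃ a ∈ G, ∃ j, a.args j = x) {σ : Mem}
    (h1 : σ.reg (Rg.one.code b) = 1) (hin : ∀ r < S.numRel, σ.arr r = L.initMem.arr r)
    (h0 : ∀ l, σ.arr ((Ar.bit a).code b) l = 0)
    (h0' : ∀ x ∈ os, ∀ l, σ.arr ((Ar.pos x).code b) l = 0 ∧ σ.arr ((Ar.cnt x).code b) l = 0) :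
    ∃ tr σ', (fillCode b aid G a ks os).Exec σ tr σ' ∧
      tr.length ≤ nestCost B (fillCode b aid G a ks os).size G.length +
        (fillCode b aid G a ks os).size ∧
      σ'.reg (Rg.one.code b) = 1 ∧ (∀ r < S.numRel, σ'.arr r = L.initMem.arr r) ∧
      (Plan.trie a ks os).Inv b σ'.arr ∧
      ∀ l, σ'.arr ((Ar.bit a).code b) l ≠ 0 ↔
        ∃ ν : ℕ → ℕ, (∀ a ∈ G, (fun j => ν (a.args j)) ∈ L.db a.rel) ∧ (ks ++ os).map ν = l := by
  have hmap : ∀ ν ν' : ℕ → ℕ, (∀ a ∈ G, ∀ j, ν (a.args j) = ν' (a.args j)) →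
      (ks ++ os).map ν = (ks ++ os).map ν' := fun ν ν' h =>
    Plan.map_congr_of_agree fun x hx => by
      obtain ⟨a, ha, j, rfl⟩ := hvars x hx
      exact h a ha j
  obtain ⟨tr, σ', he, hlen, hI⟩ := matchAll_exec (b := b) (aid := aid) L hG hid
    (body := (Plan.trie a ks os).updateLeaf b a (ks ++ os) .one)
    (Plan.updateLeaf_simple _ _ _ _ _)
    (fun r hr => by
      have := Plan.updateLeaf_writes hr
      simp only [Rg.code_inj] at this
      rcases this with rfl | rfl | rfl | rfl <;> simp)
    hB (key := fun ν => (ks ++ os).map ν)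
    (fun s σ => σ.reg (Rg.one.code b) = 1 ∧ (∀ r < S.numRel, σ.arr r = L.initMem.arr r) ∧
      (Plan.trie a ks os).Inv b σ.arr ∧ ∀ l, σ.arr ((Ar.bit a).code b) l ≠ 0 ↔ l ∈ s)
    (X := {x | ∃ a ∈ G, ∃ j, a.args j = x}) (fun a ha j => ⟨a, ha, j, rfl⟩) hmap
    (by
      rintro s σ σ' ⟨i₁, i₂, i₃, i₄⟩ hσ
      rw [hσ.1]
      exact ⟨by rw [hσ.reg (by simp [loopRegs, matchRegs]), i₁], i₂, i₃, i₄⟩)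
    (fun s σ h => h.1) (fun s σ h => h.2.1)
    (by
      rintro s σ ν ⟨i₁, i₂, i₃, i₄⟩ - hν
      refine ⟨?_, fun r hr => ?_, ?_, fun l => ?_⟩
      · rw [Plan.updateLeaf_reg (by simp), i₁]
      · rw [Plan.updateLeaf_arr_lt (hr.trans_le hb), i₂ r hr]
      · exact Plan.updateLeaf_inv (Plan.trie_WF hnd) (Plan.trie_path _ _ _)
          (by simp [Plan.trie_leaves]) i₁ i₃
      · rw [Plan.updateLeaf_bit, hmap _ ν hν, i₁, Set.mem_insert_iff, ← i₄]
        split_ifs with h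
        · exact iff_of_true one_ne_zero (.inl h.2)
        · exact (or_iff_right fun hl => h ⟨rfl, hl⟩).symm)
    (s := ∅) (σ := σ) ⟨h1, hin, Plan.trie_inv_of_zero h0 h0', by simp [h0]⟩
  refine ⟨tr, σ', he, hlen, hI.1, hI.2.1, hI.2.2.1, fun l => ?_⟩
  rw [hI.2.2.2, Set.empty_union]
  rfl

end fill

/-! ### Plans for well-behaved queries -/

/-- A group of static atoms that is evaluated as a whole: the projections of its matches to
`ks ++ os` are kept in a trie, with leaf `id`, that enumerates `os` for given values of `ks`. -/
structure StatGroup (S : Schema) where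
  atoms : List (Atom S)
  id : ℕ
  ks : List ℕ
  os : List ℕ

/-- The trie of a static group. -/
def StatGroup.plan {S : Schema} (g : StatGroup S) : Plan := Plan.trie g.id g.ks g.os

namespace CQ

variable {S : Schema}

/-- The variables of a set of atoms. -/
def varsOf (G : Finset (Atom S)) : Finset ℕ := G.biUnion Atom.vars

theorem mem_varsOf {G : Finset (Atom S)} {x : ℕ} : x ∈ varsOf G ↔ ∃ a ∈ G, x ∈ a.vars := by
  simp [varsOf]

/-- `p` evaluates the atoms `G` of the query, for given values of the variables `key`, with the
help of the static groups `T`. The last fields describe the initialization, for empty dynamic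
relations, and the meaning of the plan. -/
structure PlanFor (Q : CQ S) (b : ℕ) (aid : Atom S → ℕ) (key : List ℕ) (G : Finset (Atom S))
    (p : Plan) (T : List (StatGroup S)) : Prop where
  wf : p.WF
  fv : p.fv ⊆ key
  bvars : ∀ x ∈ p.bvars, x ∈ varsOf G ∧ x ∉ key
  outs : ∀ x, x ∈ p.outs ↔ x ∈ varsOf G ∧ x ∉ key ∧ x ∈ Q.free
  leaves : ∀ l ∈ p.leaves, ∃ a ∈ G, l = aid a
  dyn_mem : ∀ a ∈ G, S.isDyn a.rel = true → aid a ∈ p.leaves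
  dyn_path : ∀ a ∈ G, S.isDyn a.rel = true → p.Path (aid a) (List.ofFn a.args)
  group_atoms : ∀ g ∈ T, g.atoms.Nodup ∧ ∀ a ∈ g.atoms, a ∈ G ∧ S.isDyn a.rel = false
  group_id : ∀ g ∈ T, ∃ a ∈ G, S.isDyn a.rel = false ∧ g.id = aid a
  group_os : ∀ g ∈ T, g.os ⊆ p.bvars
  group_vars : ∀ g ∈ T, (g.ks ++ g.os).Nodup ∧
    ∀ x ∈ g.ks ++ g.os, ∃ a ∈ g.atoms, ∃ j, a.args j = x
  pairwise : T.Pairwise fun g g' => g.id ≠ g'.id ∧ g.os.Disjoint g'.os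
  init : ∀ m : ℕ → List ℕ → ℕ, (∀ g ∈ T, g.plan.Inv b m) →
    (∀ a ∈ G, S.isDyn a.rel = true → ∀ l, m ((Ar.bit (aid a)).code b) l = 0) →
    (∀ x ∈ p.bvars, (∀ g ∈ T, x ∉ g.os) →
      ∀ l, m ((Ar.pos x).code b) l = 0 ∧ m ((Ar.cnt x).code b) l = 0) → p.Inv b m
  dead : ∀ (m : ℕ → List ℕ → ℕ) (μ : ℕ → ℕ), ∀ a ∈ G, S.isDyn a.rel = true →
    (∀ l, m ((Ar.bit (aid a)).code b) l = 0) → ¬ p.Holds b m μ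
  sat : ∀ (m : ℕ → List ℕ → ℕ) (D : Database S),
    (∀ a ∈ G, S.isDyn a.rel = true → ∀ μ : ℕ → ℕ,
      m ((Ar.bit (aid a)).code b) ((List.ofFn a.args).map μ) ≠ 0 ↔
        (fun j => μ (a.args j)) ∈ D a.rel) →
    (∀ g ∈ T, ∀ l, m ((Ar.bit g.id).code b) l ≠ 0 ↔
      ∃ ν : ℕ → ℕ, (∀ a ∈ g.atoms, (fun j => ν (a.args j)) ∈ D a.rel) ∧
        (g.ks ++ g.os).map ν = l) →
    ∀ μ : ℕ → ℕ, p.Sat b m μ ↔ ∃ ν : ℕ → ℕ, (∀ x, x ∈ key ∨ x ∈ Q.free → ν x = μ x) ∧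
      ∀ a ∈ G, (fun j => ν (a.args j)) ∈ D a.rel

theorem _root_.Atom.args_mem_vars (a : Atom S) (j : Fin (S.arity a.rel)) : a.args j ∈ a.vars :=
  Finset.mem_image_of_mem _ (Finset.mem_univ j)

theorem _root_.Atom.mem_vars_iff {a : Atom S} {x : ℕ} : x ∈ a.vars ↔ ∃ j, a.args j = x := by
  simp [Atom.vars]

theorem _root_.Plan.path_of_notMem {p : Plan} {a : ℕ} {args : List ℕ} (h : a ∉ p.leaves) :
    p.Path a args := by
  induction p with
  | leaf a' args' => exact fun h' => (h (by simp [Plan.leaves, h'])).elim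
  | join p q ihp ihq =>
    simp only [Plan.leaves, List.mem_append, not_or] at h
    exact ⟨ihp h.1, ihq h.2⟩
  | bind fr x key p ih => exact ⟨ih h, fun h' => (h h').elim⟩

theorem _root_.Plan.sat_iff_holds {p : Plan} {b : ℕ} {m : ℕ → List ℕ → ℕ} {μ : ℕ → ℕ}
    (h : p.outs = []) : p.Sat b m μ ↔ p.Holds b m μ := by
  induction p with
  | leaf => rfl
  | join p q ihp ihq =>
    simp only [Plan.outs, List.append_eq_nil_iff] at h
    simp only [Plan.Sat, Plan.Holds, ihp h.1, ihq h.2]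
  | bind fr x key p ih =>
    cases fr
    · rfl
    · simp [Plan.outs] at h

theorem sat_congr_vars {D : Database S} {G : Finset (Atom S)} {ν ν' : ℕ → ℕ}
    (h : ∀ x ∈ varsOf G, ν x = ν' x) (hν : ∀ a ∈ G, (fun j => ν (a.args j)) ∈ D a.rel) :
    ∀ a ∈ G, (fun j => ν' (a.args j)) ∈ D a.rel := by
  intro a ha
  have : (fun j => ν' (a.args j)) = fun j => ν (a.args j) := funext fun j =>
    (h _ (mem_varsOf.2 ⟨a, ha, a.args_mem_vars j⟩)).symm
  rw [this]
  exact hν a ha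

variable {Q : CQ S} {b : ℕ} {aid : Atom S → ℕ} {key : List ℕ} {G G₁ G₂ : Finset (Atom S)}
  {p p₁ p₂ : Plan} {T T₁ T₂ : List (StatGroup S)}

/-- Two sets of atoms without common variables outside `key` are evaluated independently. -/
theorem PlanFor.join [DecidableEq (Atom S)] (h₁ : PlanFor Q b aid key G₁ p₁ T₁)
    (h₂ : PlanFor Q b aid key G₂ p₂ T₂)
    (hid : ∀ a ∈ G₁, ∀ a' ∈ G₂, aid a ≠ aid a')
    (hdisj : ∀ x ∈ varsOf G₁, x ∈ varsOf G₂ → x ∈ key) :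
    PlanFor Q b aid key (G₁ ∪ G₂) (p₁.join p₂) (T₁ ++ T₂) := by
  have hbb : p₁.bvars.Disjoint p₂.bvars := fun x hx hx' =>
    (h₁.bvars x hx).2 (hdisj x (h₁.bvars x hx).1 (h₂.bvars x hx').1)
  have hl₁ : ∀ a ∈ G₁, aid a ∉ p₂.leaves := fun a ha h => by
    obtain ⟨a', ha', h⟩ := h₂.leaves _ h
    exact hid a ha a' ha' h
  have hl₂ : ∀ a ∈ G₂, aid a ∉ p₁.leaves := fun a ha h => by
    obtain ⟨a', ha', h⟩ := h₁.leaves _ h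
    exact hid a' ha' a ha h.symm
  have hv : ∀ x, x ∈ varsOf (G₁ ∪ G₂) ↔ x ∈ varsOf G₁ ∨ x ∈ varsOf G₂ := fun x => by
    simp only [mem_varsOf, Finset.mem_union, or_and_right, exists_or]
  have hm : ∀ {P : Atom S → Prop}, (∀ a ∈ G₁ ∪ G₂, P a) → (∀ a ∈ G₁, P a) ∧ ∀ a ∈ G₂, P a :=
    fun h => ⟨fun a ha => h a (Finset.mem_union_left _ ha),
      fun a ha => h a (Finset.mem_union_right _ ha)⟩
  have hT : ∀ {P : StatGroup S → Prop}, (∀ g ∈ T₁ ++ T₂, P g) →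
      (∀ g ∈ T₁, P g) ∧ ∀ g ∈ T₂, P g := fun h =>
    ⟨fun g hg => h g (List.mem_append_left _ hg), fun g hg => h g (List.mem_append_right _ hg)⟩
  constructor
  case wf =>
    refine ⟨h₁.wf, h₂.wf, hbb, fun x hx hx' => (h₁.bvars x hx).2 (h₂.fv hx'),
      fun x hx hx' => (h₂.bvars x hx).2 (h₁.fv hx'), fun l hl hl' => ?_⟩
    obtain ⟨a, ha, rfl⟩ := h₁.leaves l hl
    exact hl₁ a ha hl'
  case fv => exact List.append_subset.2 ⟨h₁.fv, h₂.fv⟩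
  case bvars =>
    intro x hx
    rw [hv]
    rcases List.mem_append.1 hx with hx | hx
    · exact ⟨.inl (h₁.bvars x hx).1, (h₁.bvars x hx).2⟩
    · exact ⟨.inr (h₂.bvars x hx).1, (h₂.bvars x hx).2⟩
  case outs =>
    intro x
    rw [hv, Plan.outs, List.mem_append, h₁.outs, h₂.outs, or_and_right]
  case leaves =>
    intro l hl
    rcases List.mem_append.1 hl with hl | hl
    · obtain ⟨a, ha, h⟩ := h₁.leaves l hl
      exact ⟨a, Finset.mem_union_left _ ha, h⟩
    · obtain ⟨a, ha, h⟩ := h₂.leaves l hl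
      exact ⟨a, Finset.mem_union_right _ ha, h⟩
  case dyn_mem =>
    intro a ha hd
    rcases Finset.mem_union.1 ha with ha | ha
    · exact List.mem_append_left _ (h₁.dyn_mem a ha hd)
    · exact List.mem_append_right _ (h₂.dyn_mem a ha hd)
  case dyn_path =>
    intro a ha hd
    rcases Finset.mem_union.1 ha with ha | ha
    · exact ⟨h₁.dyn_path a ha hd, Plan.path_of_notMem (hl₁ a ha)⟩
    · exact ⟨Plan.path_of_notMem (hl₂ a ha), h₂.dyn_path a ha hd⟩
  case group_atoms =>
    intro g hg
    rcases List.mem_append.1 hg with hg | hg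
    · exact ⟨(h₁.group_atoms g hg).1, fun a ha => ⟨Finset.mem_union_left _
        ((h₁.group_atoms g hg).2 a ha).1, ((h₁.group_atoms g hg).2 a ha).2⟩⟩
    · exact ⟨(h₂.group_atoms g hg).1, fun a ha => ⟨Finset.mem_union_right _
        ((h₂.group_atoms g hg).2 a ha).1, ((h₂.group_atoms g hg).2 a ha).2⟩⟩
  case group_id =>
    intro g hg
    rcases List.mem_append.1 hg with hg | hg
    · obtain ⟨a, ha, h⟩ := h₁.group_id g hg
      exact ⟨a, Finset.mem_union_left _ ha, h⟩
    · obtain ⟨a, ha, h⟩ := h₂.group_id g hg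
      exact ⟨a, Finset.mem_union_right _ ha, h⟩
  case group_os =>
    intro g hg x hx
    rcases List.mem_append.1 hg with hg | hg
    · exact List.mem_append_left _ (h₁.group_os g hg hx)
    · exact List.mem_append_right _ (h₂.group_os g hg hx)
  case group_vars =>
    intro g hg
    rcases List.mem_append.1 hg with hg | hg
    · exact h₁.group_vars g hg
    · exact h₂.group_vars g hg
  case pairwise =>
    refine List.pairwise_append.2 ⟨h₁.pairwise, h₂.pairwise, fun g hg g' hg' => ⟨?_, ?_⟩⟩
    · obtain ⟨a, ha, -, e⟩ := h₁.group_id g hg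
      obtain ⟨a', ha', -, e'⟩ := h₂.group_id g' hg'
      rw [e, e']
      exact hid a ha a' ha'
    · exact fun x hx hx' => hbb (h₁.group_os g hg hx) (h₂.group_os g' hg' hx')
  case init =>
    intro m hg hd hz
    obtain ⟨hg₁, hg₂⟩ := hT hg
    obtain ⟨hd₁, hd₂⟩ := hm hd
    refine ⟨h₁.init m hg₁ hd₁ fun x hx hxg => hz x (List.mem_append_left _ hx) fun g hg => ?_,
      h₂.init m hg₂ hd₂ fun x hx hxg => hz x (List.mem_append_right _ hx) fun g hg => ?_⟩
    · rcases List.mem_append.1 hg with hg | hg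
      · exact hxg g hg
      · exact fun h => hbb hx (h₂.group_os g hg h)
    · rcases List.mem_append.1 hg with hg | hg
      · exact fun h => hbb (h₁.group_os g hg h) hx
      · exact hxg g hg
  case dead =>
    intro m μ a ha hd h0 h
    rcases Finset.mem_union.1 ha with ha | ha
    · exact h₁.dead m μ a ha hd h0 h.1
    · exact h₂.dead m μ a ha hd h0 h.2
  case sat =>
    intro m D hd hg μ
    obtain ⟨hd₁, hd₂⟩ := hm hd
    obtain ⟨hg₁, hg₂⟩ := hT hg
    rw [Plan.Sat, h₁.sat m D hd₁ hg₁, h₂.sat m D hd₂ hg₂]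
    constructor
    · rintro ⟨⟨ν₁, e₁, s₁⟩, ν₂, e₂, s₂⟩
      obtain ⟨ν, hν⟩ : ∃ ν : ℕ → ℕ, ∀ x, ν x = if x ∈ varsOf G₁ then ν₁ x else ν₂ x :=
        ⟨_, fun _ => rfl⟩
      refine ⟨ν, fun x hx => ?_, fun a ha => ?_⟩
      · rw [hν]
        split_ifs
        exacts [e₁ x hx, e₂ x hx]
      rcases Finset.mem_union.1 ha with ha | ha
      · exact sat_congr_vars (fun x hx => by rw [hν, if_pos hx]) s₁ a ha
      · refine sat_congr_vars (fun x hx => ?_) s₂ a ha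
        rw [hν]
        split_ifs with hx'
        · rw [e₁ x (.inl (hdisj x hx' hx)), e₂ x (.inl (hdisj x hx' hx))]
        · rfl
    · rintro ⟨ν, e, s⟩
      exact ⟨⟨ν, e, (hm s).1⟩, ν, e, (hm s).2⟩

/-- A dynamic atom all of whose variables are given is a leaf. -/
theorem PlanFor.leaf {a : Atom S} (hd : S.isDyn a.rel = true) (hv : ∀ x ∈ a.vars, x ∈ key) :
    PlanFor Q b aid key {a} (.leaf (aid a) (List.ofFn a.args)) [] := by
  constructor
  case wf => trivial
  case fv =>
    intro x hx
    obtain ⟨j, rfl⟩ := List.mem_ofFn.1 hx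
    exact hv _ (a.args_mem_vars j)
  case outs =>
    intro x
    simp only [Plan.outs, List.not_mem_nil, mem_varsOf, Finset.mem_singleton, exists_eq_left,
      false_iff, not_and]
    exact fun h h' => (h' (hv x h)).elim
  case dyn_mem => simp [Plan.leaves]
  case dyn_path =>
    intro a' ha' _ _
    rw [Finset.mem_singleton.1 ha']
  case dead =>
    intro m μ a' ha' _ h0 h
    rw [Finset.mem_singleton.1 ha'] at h0
    exact h (h0 _)
  case init => exact fun _ _ _ _ => trivial
  case sat =>
    intro m D hd' _ μ
    rw [Plan.Sat, hd' a (by simp) hd]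
    simp only [Finset.mem_singleton, forall_eq]
    constructor
    · exact fun h => ⟨μ, fun _ _ => rfl, h⟩
    · rintro ⟨ν, e, h⟩
      have : (fun j => μ (a.args j)) = fun j => ν (a.args j) := funext fun j =>
        (e _ (.inl (hv _ (a.args_mem_vars j)))).symm
      rwa [this]
  all_goals simp [Plan.bvars, Plan.leaves]

/-- Static atoms are evaluated by a trie. -/
theorem PlanFor.trie (hG : G.Nonempty) (hs : ∀ a ∈ G, S.isDyn a.rel = false) (hkey : key.Nodup) :
    ∃ p T, PlanFor Q b aid key G p T := by
  obtain ⟨a₀, ha₀⟩ := hG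
  set ks := key.filter (· ∈ varsOf G) with hks
  set os := ((varsOf G).filter fun x => x ∉ key ∧ x ∈ Q.free).toList with hos
  have mem_ks : ∀ x, x ∈ ks ↔ x ∈ key ∧ x ∈ varsOf G := by simp [hks]
  have mem_os : ∀ x, x ∈ os ↔ x ∈ varsOf G ∧ x ∉ key ∧ x ∈ Q.free := by simp [hos]
  have hnd : (ks ++ os).Nodup := by
    refine List.nodup_append'.2 ⟨hkey.filter _, Finset.nodup_toList _, fun x hx hx' => ?_⟩
    exact ((mem_os x).1 hx').2.1 ((mem_ks x).1 hx).1
  have hstat : ∀ a ∈ G, S.isDyn a.rel ≠ true := fun a ha => by simp [hs a ha]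
  refine ⟨Plan.trie (aid a₀) ks os, [⟨G.toList, aid a₀, ks, os⟩], ?_⟩
  constructor
  case wf => exact Plan.trie_WF hnd
  case fv =>
    rw [Plan.trie_fv]
    exact fun x hx => ((mem_ks x).1 hx).1
  case bvars =>
    intro x hx
    rw [Plan.trie_bvars, mem_os] at hx
    exact ⟨hx.1, hx.2.1⟩
  case outs => simpa only [Plan.trie_outs] using mem_os
  case leaves =>
    rw [Plan.trie_leaves]
    intro l hl
    exact ⟨a₀, ha₀, List.mem_singleton.1 hl⟩
  case dyn_mem => exact fun a ha hd => (hstat a ha hd).elim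
  case dyn_path => exact fun a ha hd => (hstat a ha hd).elim
  case dead => exact fun _ _ a ha hd => (hstat a ha hd).elim
  case group_atoms =>
    simp only [List.mem_singleton, forall_eq, Finset.mem_toList]
    exact ⟨Finset.nodup_toList _, fun a ha => ⟨ha, hs a ha⟩⟩
  case group_id =>
    simp only [List.mem_singleton, forall_eq]
    exact ⟨a₀, ha₀, hs a₀ ha₀, rfl⟩
  case group_os =>
    simp only [List.mem_singleton, forall_eq, Plan.trie_bvars]
    exact List.Subset.refl _
  case group_vars =>
    simp only [List.mem_singleton, forall_eq, Finset.mem_toList]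
    refine ⟨hnd, fun x hx => ?_⟩
    have hx' : x ∈ varsOf G := by
      rcases List.mem_append.1 hx with hx | hx
      exacts [((mem_ks x).1 hx).2, ((mem_os x).1 hx).1]
    obtain ⟨a, ha, hx'⟩ := mem_varsOf.1 hx'
    exact ⟨a, ha, Atom.mem_vars_iff.1 hx'⟩
  case pairwise => simp
  case init =>
    intro m hg _ _
    exact hg _ (List.mem_singleton.2 rfl)
  case sat =>
    intro m D _ hg μ
    rw [Plan.trie_sat, hg ⟨G.toList, aid a₀, ks, os⟩ (List.mem_singleton.2 rfl)]
    simp only [Finset.mem_toList]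
    constructor
    · rintro ⟨ν, s, e⟩
      rw [List.map_inj_left] at e
      obtain ⟨ν', hν'⟩ : ∃ ν' : ℕ → ℕ, ∀ x, ν' x = if x ∈ varsOf G then ν x else μ x :=
        ⟨_, fun _ => rfl⟩
      refine ⟨ν', fun x hx => ?_, sat_congr_vars (fun x hx => by rw [hν', if_pos hx]) s⟩
      rw [hν']
      split_ifs with hx'
      · refine e x (List.mem_append.2 ?_)
        rw [mem_ks, mem_os]
        tauto
      · rfl
    · rintro ⟨ν, e, s⟩
      refine ⟨ν, s, List.map_inj_left.2 fun x hx => e x ?_⟩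
      rw [List.mem_append, mem_ks, mem_os] at hx
      tauto

/-- The dynamic atoms have a common variable outside `key`: it is made the next variable of the
plan. -/
theorem PlanFor.bind {x : ℕ} {fr : Bool} (h : PlanFor Q b aid (key ++ [x]) G p T)
    (hx : x ∈ varsOf G) (hxk : x ∉ key) (hdyn : ∃ a ∈ G, S.isDyn a.rel = true)
    (hxa : ∀ a ∈ G, S.isDyn a.rel = true → x ∈ a.vars)
    (hka : ∀ a ∈ G, S.isDyn a.rel = true → ∀ y ∈ key, y ∈ a.vars)
    (hfr : fr = true → x ∈ Q.free)
    (hfr' : fr = false → ∀ y ∈ varsOf G, y ∉ key → y ∉ Q.free) :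
    PlanFor Q b aid key G (.bind fr x key p) T := by
  have hb : ∀ y ∈ p.bvars, y ∈ varsOf G ∧ y ∉ key ∧ y ≠ x := fun y hy => by
    have := h.bvars y hy
    simpa using this
  have hxo : ∀ g ∈ T, x ∉ g.os := fun g hg hx => (hb x (h.group_os g hg hx)).2.2 rfl
  constructor
  case wf =>
    refine ⟨h.wf, fun y hy => ?_, hxk, fun hy => (hb x hy).2.2 rfl,
      fun y hy hy' => (hb y hy').2.1 hy⟩
    have := h.fv hy
    simp only [List.mem_append, List.mem_singleton] at this
    simp only [List.mem_cons]
    tauto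
  case fv => exact List.Subset.refl _
  case bvars =>
    intro y hy
    rcases List.mem_cons.1 hy with rfl | hy
    · exact ⟨hx, hxk⟩
    · exact ⟨(hb y hy).1, (hb y hy).2.1⟩
  case outs =>
    intro y
    cases fr
    · simp only [Plan.outs, List.not_mem_nil, false_iff, not_and]
      exact hfr' rfl y
    · simp only [Plan.outs, List.mem_cons, h.outs, List.mem_append, not_or, List.not_mem_nil,
        or_false]
      by_cases hyx : y = x
      · subst hyx
        simp [hx, hxk, hfr rfl]
      · simp [hyx]
  case leaves => exact h.leaves
  case dyn_mem => exact h.dyn_mem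
  case dyn_path =>
    refine fun a ha hd => ⟨h.dyn_path a ha hd, fun _ => ⟨?_, fun y hy => ?_⟩⟩
    · exact List.mem_ofFn.2 (Atom.mem_vars_iff.1 (hxa a ha hd))
    · exact List.mem_ofFn.2 (Atom.mem_vars_iff.1 (hka a ha hd y hy))
  case group_atoms => exact h.group_atoms
  case group_id => exact h.group_id
  case group_os => exact fun g hg y hy => List.mem_cons_of_mem _ (h.group_os g hg hy)
  case group_vars => exact h.group_vars
  case pairwise => exact h.pairwise
  case init =>
    intro m hg hd hz
    refine ⟨h.init m hg hd fun y hy => hz y (List.mem_cons_of_mem _ hy), fun ν => ?_⟩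
    obtain ⟨a, ha, hda⟩ := hdyn
    have : {v | p.Holds b m (Function.update ν x v)} = ∅ :=
      Set.eq_empty_iff_forall_notMem.2 fun v => h.dead m _ a ha hda (hd a ha hda)
    rw [this]
    have hzx := hz x (List.mem_cons_self ..) hxo
    exact SetRep.empty (fun l => (hzx l).1) fun l => (hzx l).2
  case dead => exact fun m μ a ha hd h0 ⟨v, hv⟩ => h.dead m _ a ha hd h0 hv
  case sat =>
    intro m D hd hg μ
    have key' := h.sat m D hd hg
    cases fr
    · have hout : p.outs = [] := List.eq_nil_iff_forall_not_mem.2 fun y hy => by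
        obtain ⟨h₁, h₂, h₃⟩ := (h.outs y).1 hy
        exact hfr' rfl y h₁ (fun hk => h₂ (by simp [hk])) h₃
      simp only [Plan.Sat, Plan.Holds, ← Plan.sat_iff_holds hout, key']
      constructor
      · rintro ⟨v, ν, e, s⟩
        refine ⟨ν, fun y hy => ?_, s⟩
        have hyx : y ≠ x := by
          rintro rfl
          exact hy.elim hxk (hfr' rfl y hx hxk)
        rw [e y (by simp; tauto), Function.update_of_ne hyx]
      · rintro ⟨ν, e, s⟩
        refine ⟨ν x, ν, fun y hy => ?_, s⟩
        by_cases hyx : y = x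
        · simp [hyx]
        · rw [Function.update_of_ne hyx]
          refine e y ?_
          simpa [hyx] using hy
    · rw [Plan.Sat, key']
      refine exists_congr fun ν => and_congr_left fun _ => forall_congr' fun y => ?_
      have := hfr rfl
      have e : (y ∈ key ++ [x] ∨ y ∈ Q.free) ↔ (y ∈ key ∨ y ∈ Q.free) := by
        simp only [List.mem_append, List.mem_singleton]
        constructor
        · rintro ((h | rfl) | h) <;> tauto
        · tauto
      rw [e]

/-- If the atoms `G` cannot be split into two parts without common variables outside `key`, then any
two variables outside `key` are connected by a path outside `key`. -/
theorem exists_path_of_unsplittable [DecidableEq (Atom S)] {Q : CQ S} {key : List ℕ}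
    {G : Finset (Atom S)} (hGQ : G ⊆ Q.body)
    (hsplit : ∀ G₁ G₂, G = G₁ ∪ G₂ → Disjoint G₁ G₂ → G₁.Nonempty → G₂.Nonempty →
      ∃ x ∈ varsOf G₁, x ∈ varsOf G₂ ∧ x ∉ key)
    {a c : Atom S} (ha : a ∈ G) (hc : c ∈ G) {x y : ℕ} (hxa : x ∈ a.vars) (hxk : x ∉ key)
    (hyc : y ∈ c.vars) (hyk : y ∉ key) {X Y : Finset ℕ} (hxX : x ∈ X) (hyY : y ∈ Y) :
    ∃ P, Q.Connects P X Y ∧ ∀ z ∈ P, z ∉ key := by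
  classical
  let H : SimpleGraph ℕ :=
    { Adj := fun u v => u ≠ v ∧ u ∉ key ∧ v ∉ key ∧ ∃ d ∈ G, u ∈ d.vars ∧ v ∈ d.vars
      symm := ⟨fun u v ⟨h₁, h₂, h₃, d, hd, h₄, h₅⟩ => ⟨h₁.symm, h₃, h₂, d, hd, h₅, h₄⟩⟩
      loopless := ⟨fun u h => h.1 rfl⟩ }
  have hreach : H.Reachable x y := by
    -- the atoms with a variable that is reachable from `x`
    set G₁ := G.filter fun d => ∃ u ∈ d.vars, u ∉ key ∧ H.Reachable x u with hG₁
    have step : ∀ d ∈ G, ∀ u ∈ d.vars, ∀ v ∈ d.vars, u ∉ key → v ∉ key → H.Reachable x u →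
        H.Reachable x v := by
      intro d hd u hu v hv huk hvk h
      by_cases huv : u = v
      · exact huv ▸ h
      · exact h.trans (SimpleGraph.Adj.reachable (G := H) ⟨huv, huk, hvk, d, hd, hu, hv⟩)
    -- otherwise `G₁` and the remaining atoms would be a splitting without common variables outside `key`
    have hcG : c ∈ G₁ := by
      by_contra hcn
      obtain ⟨z, hz₁, hz₂, hzk⟩ := hsplit G₁ (G \ G₁)
        (Finset.union_sdiff_of_subset (Finset.filter_subset _ _)).symm Finset.disjoint_sdiff
        ⟨a, Finset.mem_filter.2 ⟨ha, x, hxa, hxk, .refl x⟩⟩ ⟨c, Finset.mem_sdiff.2 ⟨hc, hcn⟩⟩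
      obtain ⟨d₁, hd₁, hz₁⟩ := mem_varsOf.1 hz₁
      obtain ⟨d₂, hd₂, hz₂⟩ := mem_varsOf.1 hz₂
      obtain ⟨hd₁, u, hu, huk, hr⟩ := Finset.mem_filter.1 hd₁
      obtain ⟨hd₂, hd₂'⟩ := Finset.mem_sdiff.1 hd₂
      exact hd₂' (Finset.mem_filter.2 ⟨hd₂, z, hz₂, hzk, step d₁ hd₁ u hu z hz₁ huk hzk hr⟩)
    obtain ⟨-, u, hu, huk, hr⟩ := Finset.mem_filter.1 hcG
    exact step c hc u hu y hyc huk hyk hr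
  obtain ⟨p, hp⟩ := hreach.exists_isPath
  refine ⟨p.support, ⟨⟨p.support_ne_nil, hp.support_nodup, ?_⟩, ⟨x, ?_, hxX⟩, y, ?_, hyY⟩, ?_⟩
  · refine p.isChain_adj_support.imp fun u v huv => ?_
    obtain ⟨-, -, -, d, hd, h⟩ := huv
    exact ⟨d, hGQ hd, h⟩
  · rw [List.head?_eq_some_head p.support_ne_nil, p.head_support]
    rfl
  · rw [List.getLast?_eq_some_getLast p.support_ne_nil, p.getLast_support]
    rfl
  · have key' : ∀ {u v : ℕ} (p : H.Walk u v), u ∉ key → ∀ z ∈ p.support, z ∉ key := by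
      intro u v p
      induction p with
      | nil => simp
      | cons h p ih =>
        intro huk z hz
        rw [SimpleGraph.Walk.support_cons, List.mem_cons] at hz
        rcases hz with rfl | hz
        · exact huk
        · exact ih h.2.2.1 z hz
    exact key' p hxk

/-- In a well-behaved query, the dynamic atoms of an unsplittable set of atoms have a common variable
outside `key`; it can be chosen free if a free variable is left at all. The variable is one that
occurs in as many dynamic atoms as possible. -/
theorem exists_common_var [DecidableEq (Atom S)] {Q : CQ S} (hQ : Q.WellBehaved) {key : List ℕ}
    {G : Finset (Atom S)} (hGQ : G ⊆ Q.body)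
    (hsplit : ∀ G₁ G₂, G = G₁ ∪ G₂ → Disjoint G₁ G₂ → G₁.Nonempty → G₂.Nonempty →
      ∃ x ∈ varsOf G₁, x ∈ varsOf G₂ ∧ x ∉ key)
    (hdyn : ∃ a ∈ G, S.isDyn a.rel = true)
    (hres : ∀ a ∈ G, S.isDyn a.rel = true → ∃ x ∈ a.vars, x ∉ key) :
    ∃ x fr, x ∈ varsOf G ∧ x ∉ key ∧ (∀ a ∈ G, S.isDyn a.rel = true → x ∈ a.vars) ∧
      (fr = true → x ∈ Q.free) ∧ (fr = false → ∀ y ∈ varsOf G, y ∉ key → y ∉ Q.free) := by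
  have hbody : ∀ a ∈ G, S.isDyn a.rel = true → a ∈ Q.dyn.body := fun a ha hd =>
    Finset.mem_filter.2 ⟨hGQ ha, hd⟩
  -- two dynamic atoms have a common variable outside `key`
  have hcommon : ∀ a ∈ G, ∀ c ∈ G, S.isDyn a.rel = true → S.isDyn c.rel = true →
      ∃ z ∈ a.vars, z ∈ c.vars ∧ z ∉ key := by
    intro a ha c hc hda hdc
    obtain ⟨x, hx, hxk⟩ := hres a ha hda
    obtain ⟨y, hy, hyk⟩ := hres c hc hdc
    obtain ⟨P, hP, hPk⟩ := exists_path_of_unsplittable hGQ hsplit ha hc hx hxk hy hyk hx hy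
    obtain ⟨z, hz, h₁, h₂⟩ := hQ.1 a (hbody a ha hda) c (hbody c hc hdc) P hP
    exact ⟨z, h₁, h₂, hPk z hz⟩
  have hpath : ∀ a ∈ G, ∀ u ∈ a.vars, ∀ v ∈ a.vars, u ≠ v → ∀ X Y : Finset ℕ, u ∈ X → v ∈ Y →
      Q.Connects [u, v] X Y := by
    intro a ha u hu v hv huv X Y huX hvY
    exact ⟨⟨by simp, by simpa using huv, by simpa using ⟨a, hGQ ha, hu, hv⟩⟩,
      ⟨u, by simp, huX⟩, v, by simp, hvY⟩
  -- it suffices to find a set of candidates that is closed in the following sense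
  have hmax : ∀ C : Finset ℕ, C.Nonempty →
      (∀ x ∈ C, x ∉ key ∧ ∃ a ∈ G, S.isDyn a.rel = true ∧ x ∈ a.vars) →
      (∀ x ∈ C, ∀ a ∈ G, ∀ c ∈ G, S.isDyn a.rel = true → S.isDyn c.rel = true → x ∈ a.vars →
        x ∉ c.vars → ∀ z ∈ a.vars, z ∈ c.vars → z ∉ key → z ∈ C) →
      ∃ x ∈ C, ∀ a ∈ G, S.isDyn a.rel = true → x ∈ a.vars := by
    intro C hC hCk hCz
    obtain ⟨x, hx, hm⟩ := C.exists_max_image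
      (fun x : ℕ => (G.filter fun a : Atom S => S.isDyn a.rel = true ∧ x ∈ a.vars).card) hC
    refine ⟨x, hx, fun c hc hdc => ?_⟩
    by_contra hxc
    obtain ⟨hxk, a, ha, hda, hxa⟩ := hCk x hx
    -- if `c` does not contain `x`, then a common variable `z` of `a` and `c` occurs in more dynamic atoms
    -- than `x`: in `c`, and in all atoms `d` that contain `x`, because of the path `x, z` from `d` to `c`
    obtain ⟨z, hza, hzc, hzk⟩ := hcommon a ha c hc hda hdc
    refine (hm z (hCz x hx a ha c hc hda hdc hxa hxc z hza hzc hzk)).not_gt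
      (Finset.card_lt_card (Finset.ssubset_iff_of_subset ?_ |>.2 ⟨c, ?_, ?_⟩))
    · intro d hd
      obtain ⟨hd, hdd, hxd⟩ := Finset.mem_filter.1 hd
      refine Finset.mem_filter.2 ⟨hd, hdd, ?_⟩
      by_contra hzd
      obtain ⟨w, hw, h₁, h₂⟩ := hQ.1 d (hbody d hd hdd) c (hbody c hc hdc) [x, z]
        (hpath a ha x hxa z hza (fun h => hxc (h ▸ hzc)) _ _ hxd hzc)
      rcases List.mem_cons.1 hw with rfl | hw
      · exact hxc h₂
      · rw [List.mem_singleton] at hw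
        exact hzd (hw ▸ h₁)
    · exact Finset.mem_filter.2 ⟨hc, hdc, hzc⟩
    · exact fun h => hxc (Finset.mem_filter.1 h).2.2
  obtain ⟨a₀, ha₀, hd₀⟩ := hdyn
  by_cases hfree : ∃ y ∈ varsOf G, y ∉ key ∧ y ∈ Q.free
  · obtain ⟨y, hy, hyk, hyf⟩ := hfree
    obtain ⟨c, hc, hyc⟩ := mem_varsOf.1 hy
    -- the candidates are the free variables of dynamic atoms; the path condition for free variables
    -- provides one, and shows that they are closed
    set C := (varsOf G).filter fun x =>
      x ∉ key ∧ x ∈ Q.free ∧ ∃ a ∈ G, S.isDyn a.rel = true ∧ x ∈ a.vars with hC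
    obtain ⟨x, hx, h⟩ := hmax C
      (by
        obtain ⟨x, hx, hxk⟩ := hres a₀ ha₀ hd₀
        obtain ⟨P, hP, hPk⟩ := exists_path_of_unsplittable hGQ hsplit ha₀ hc hx hxk hyc hyk hx hyf
        obtain ⟨z, hz, h₁, h₂⟩ := hQ.2 a₀ (hbody a₀ ha₀ hd₀) P hP
        exact ⟨z, Finset.mem_filter.2 ⟨mem_varsOf.2 ⟨a₀, ha₀, h₁⟩, hPk z hz, h₂, a₀, ha₀, hd₀, h₁⟩⟩)
      (fun x hx => ⟨(Finset.mem_filter.1 hx).2.1, (Finset.mem_filter.1 hx).2.2.2⟩)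
      (by
        intro x hx a ha c hc hda hdc hxa hxc z hza hzc hzk
        obtain ⟨-, hxk, hxf, -⟩ := Finset.mem_filter.1 hx
        refine Finset.mem_filter.2 ⟨mem_varsOf.2 ⟨a, ha, hza⟩, hzk, ?_, a, ha, hda, hza⟩
        obtain ⟨w, hw, h₁, h₂⟩ := hQ.2 c (hbody c hc hdc) [z, x]
          (hpath a ha z hza x hxa (fun h => hxc (h ▸ hzc)) _ _ hzc hxf)
        rcases List.mem_cons.1 hw with rfl | hw
        · exact h₂
        · rw [List.mem_singleton] at hw
          exact (hxc (hw ▸ h₁)).elim)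
    obtain ⟨h₁, h₂, h₃, -⟩ := Finset.mem_filter.1 hx
    exact ⟨x, true, h₁, h₂, h, fun _ => h₃, by simp⟩
  · push Not at hfree
    obtain ⟨x, hx, h⟩ := hmax
      ((varsOf G).filter fun x => x ∉ key ∧ ∃ a ∈ G, S.isDyn a.rel = true ∧ x ∈ a.vars)
      (by
        obtain ⟨x, hx, hxk⟩ := hres a₀ ha₀ hd₀
        exact ⟨x, Finset.mem_filter.2 ⟨mem_varsOf.2 ⟨a₀, ha₀, hx⟩, hxk, a₀, ha₀, hd₀, hx⟩⟩)
      (fun x hx => (Finset.mem_filter.1 hx).2)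
      (fun x _ a ha _ _ hda _ _ _ z hza _ hzk =>
        Finset.mem_filter.2 ⟨mem_varsOf.2 ⟨a, ha, hza⟩, hzk, a, ha, hda, hza⟩)
    obtain ⟨h₁, h₂, -⟩ := Finset.mem_filter.1 hx
    exact ⟨x, false, h₁, h₂, h, by simp, fun _ y hy hyk => hfree y hy hyk⟩

/-- Every well-behaved query has a plan, by recursion: independent parts are joined, purely static
parts become tries, and otherwise there is a common variable of the dynamic atoms. -/
theorem exists_plan {Q : CQ S} (hQ : Q.WellBehaved) (b : ℕ) {aid : Atom S → ℕ}
    (hid : Set.InjOn aid Q.body) (n : ℕ) {key : List ℕ} (hkey : key.Nodup) {G : Finset (Atom S)}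
    (hGQ : G ⊆ Q.body) (hG : G.Nonempty)
    (hka : ∀ a ∈ G, S.isDyn a.rel = true → ∀ y ∈ key, y ∈ a.vars)
    (hn : G.card + ((varsOf G).filter (· ∉ key)).card ≤ n) :
    ∃ p T, PlanFor Q b aid key G p T := by
  classical
  induction n generalizing key G with
  | zero =>
    have := hG.card_pos
    omega
  | succ n ih =>
    by_cases hsplit : ∀ G₁ G₂, G = G₁ ∪ G₂ → Disjoint G₁ G₂ → G₁.Nonempty → G₂.Nonempty →
      ∃ x ∈ varsOf G₁, x ∈ varsOf G₂ ∧ x ∉ key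
    · by_cases hdyn : ∃ a ∈ G, S.isDyn a.rel = true
      · by_cases hres : ∀ a ∈ G, S.isDyn a.rel = true → ∃ x ∈ a.vars, x ∉ key
        · obtain ⟨x, fr, hx, hxk, hxa, h₁, h₂⟩ := exists_common_var hQ hGQ hsplit hdyn hres
          obtain ⟨p, T, h⟩ := ih (key := key ++ [x])
            (List.nodup_append'.2 ⟨hkey, List.nodup_singleton x, by simpa using hxk⟩) hGQ hG
            (fun a ha hd y hy => by
              rcases List.mem_append.1 hy with hy | hy
              · exact hka a ha hd y hy
              · rw [List.mem_singleton.1 hy]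
                exact hxa a ha hd)
            (by
              have : ((varsOf G).filter (· ∉ key ++ [x])).card <
                  ((varsOf G).filter (· ∉ key)).card := by
                refine Finset.card_lt_card (Finset.ssubset_iff_of_subset ?_ |>.2 ⟨x, ?_, ?_⟩)
                · intro y hy
                  simp only [Finset.mem_filter, List.mem_append, not_or] at hy ⊢
                  exact ⟨hy.1, hy.2.1⟩
                · exact Finset.mem_filter.2 ⟨hx, hxk⟩
                · simp
              omega)
          exact ⟨_, T, h.bind hx hxk hdyn hxa hka h₁ h₂⟩
        · push Not at hres
          obtain ⟨a, ha, hd, hv⟩ := hres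
          have hGa : G = {a} := by
            by_contra hne
            obtain ⟨x, hx, -, hxk⟩ := hsplit {a} (G \ {a})
              (Finset.union_sdiff_of_subset (by simpa using ha)).symm Finset.disjoint_sdiff
              ⟨a, by simp⟩ (Finset.sdiff_nonempty.2 fun h => hne
                (Finset.Subset.antisymm h (by simpa using ha)))
            obtain ⟨a', ha', hx⟩ := mem_varsOf.1 hx
            rw [Finset.mem_singleton] at ha'
            exact hxk (hv x (ha' ▸ hx))
          subst hGa
          exact ⟨_, _, PlanFor.leaf hd hv⟩
      · push Not at hdyn
        exact PlanFor.trie hG (fun a ha => by simpa using hdyn a ha) hkey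
    · push Not at hsplit
      obtain ⟨G₁, G₂, rfl, hdisj, hG₁, hG₂, hv⟩ := hsplit
      have hc := Finset.card_union_of_disjoint hdisj
      have c₁ := hG₁.card_pos
      have c₂ := hG₂.card_pos
      have sub : ∀ G' ⊆ G₁ ∪ G₂, ((varsOf G').filter (· ∉ key)).card ≤
          ((varsOf (G₁ ∪ G₂)).filter (· ∉ key)).card := fun G' h =>
        Finset.card_le_card (Finset.filter_subset_filter _ (Finset.biUnion_subset_biUnion_of_subset_left _ h))
      have s₁ := sub G₁ Finset.subset_union_left
      have s₂ := sub G₂ Finset.subset_union_right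
      obtain ⟨p₁, T₁, h₁⟩ := ih hkey (Finset.subset_union_left.trans hGQ) hG₁
        (fun a ha => hka a (Finset.mem_union_left _ ha)) (by omega)
      obtain ⟨p₂, T₂, h₂⟩ := ih hkey (Finset.subset_union_right.trans hGQ) hG₂
        (fun a ha => hka a (Finset.mem_union_right _ ha)) (by omega)
      refine ⟨_, _, h₁.join h₂ (fun a ha a' ha' h => ?_) hv⟩
      have := hid (hGQ (Finset.mem_union_left _ ha)) (hGQ (Finset.mem_union_right _ ha')) h
      exact Finset.disjoint_left.1 hdisj ha (this ▸ ha')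

end CQ

/-! ### Loading the dynamic relations -/

section load

variable {S : Schema} {b : ℕ}

/-- Write tuple number `aidx 0` of the listing of the relation `r`, as a request for an insert, into
the first registers. -/
def requestCode (b : ℕ) (r : Fin S.numRel) : List (Fin (S.arity r)) → Prog
  | [] => .const 1 r ;; .const 0 1
  | j :: l => .const (Rg.tmp₃.code b) j ;;
      .load (j + 2) r [(Rg.aidx 0).code b, Rg.tmp₃.code b] ;; requestCode b r l

/-- Insert all listed tuples of the relation `r`. -/
def loadRel (b : ℕ) (upd : Prog) (r : Fin S.numRel) : Prog :=
  .const ((Rg.aidx 1).code b) 1 ;; .load ((Rg.abnd 0).code b) r [] ;;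
  .forLoop ((Rg.aidx 1).code b) ((Rg.aidx 0).code b) ((Rg.abnd 0).code b)
    (requestCode b r (List.finRange _) ;; upd)

/-- Insert all listed tuples of the relations in a list. -/
def loadCode (b : ℕ) (upd : Prog) : List (Fin S.numRel) → Prog
  | [] => skipCode b
  | r :: l => loadRel b upd r ;; loadCode b upd l

theorem requestCode_simple (r : Fin S.numRel) (l : List (Fin (S.arity r))) :
    (requestCode b r l).Simple := by
  induction l with
  | nil => exact ⟨trivial, trivial⟩
  | cons j l ih => exact ⟨trivial, trivial, ih⟩

theorem requestCode_stores (r : Fin S.numRel) (l : List (Fin (S.arity r))) (A : ℕ) :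
    ¬ (requestCode b r l).Stores A := by
  induction l with
  | nil => simp [requestCode, Prog.Stores]
  | cons j l ih => simp [requestCode, Prog.Stores, ih]

theorem requestCode_writes {r : Fin S.numRel} {l : List (Fin (S.arity r))} {y : ℕ}
    (h : (requestCode b r l).Writes y) : y < S.arity r + 2 ∨ y = Rg.tmp₃.code b := by
  induction l with
  | nil => rcases h with h | h <;> simp only [Prog.Writes] at h <;> omega
  | cons j l ih =>
    rcases h with h | h | h
    · exact .inr h
    · simp only [Prog.Writes] at h
      omega
    · exact ih h

theorem requestCode_eval {r : Fin S.numRel} (hb : S.arity r + 2 ≤ b) {σ : Mem}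
    {t : S.Tuple r} (ht : ∀ j : Fin (S.arity r), σ.arr r [σ.reg ((Rg.aidx 0).code b), j] = t j)
    (l : List (Fin (S.arity r))) : ((requestCode b r l).eval σ).reg 0 = 1 ∧
      ((requestCode b r l).eval σ).reg 1 = r ∧
      ∀ j : Fin (S.arity r), j ∈ l ∨ σ.reg (j + 2) = t j →
        ((requestCode b r l).eval σ).reg (j + 2) = t j := by
  induction l generalizing σ with
  | nil => simp [requestCode, Prog.eval]
  | cons i l ih =>
    have h₀ := Rg.le_code b (.aidx 0)
    have h₁ := Rg.le_code b .tmp₃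
    have hi := i.isLt
    have e₁ : (Rg.aidx 0).code b ≠ i + 2 := by omega
    obtain ⟨i₁, i₂, i₃⟩ := ih (σ := (Prog.load (i + 2) r [(Rg.aidx 0).code b, Rg.tmp₃.code b]).eval
      ((Prog.const (Rg.tmp₃.code b) i).eval σ)) (by
        intro j
        simpa [Prog.eval, e₁] using ht j)
    refine ⟨i₁, i₂, fun j hj => i₃ j ?_⟩
    have hj' := j.isLt
    have e₂ : (j : ℕ) + 2 ≠ Rg.tmp₃.code b := by omega
    by_cases hij : j = i
    · subst hij
      right
      simpa [Prog.eval] using ht j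
    · rcases hj with hj | hj
      · exact .inl ((List.mem_cons.1 hj).resolve_left hij)
      · right
        have : (j : ℕ) ≠ i := fun h => hij (Fin.ext h)
        simp [Prog.eval, this, e₂, hj]

/-- The database with the same static relations and with empty dynamic relations. -/
def Database.staticPart (D : Database S) : Database S := fun r => if S.isDyn r then ∅ else D r

theorem request_eq_self {u : Update S} {σ : Mem} (h₀ : σ.reg 0 = if u.insert then 1 else 0)
    (h₁ : σ.reg 1 = u.rel) (h₂ : ∀ j : Fin (S.arity u.rel), σ.reg (j + 2) = u.tuple j) :
    u.request σ = σ := by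
  obtain ⟨reg, arr⟩ := σ
  simp only [Update.request, Mem.mk.injEq, and_true]
  funext x
  match x with
  | 0 => simpa using h₀.symm
  | 1 => simpa using h₁.symm
  | x + 2 =>
    simp only [List.getD_cons_succ]
    by_cases hx : x < S.arity u.rel
    · rw [List.getD_eq_getElem _ _ (by simpa using hx), List.getElem_ofFn]
      exact (h₂ ⟨x, hx⟩).symm
    · exact List.getD_eq_default _ _ (by simpa using hx)

variable {upd : Prog} {Enc : Database S → (ℕ → List ℕ → ℕ) → Prop}

/-- Loading a relation, given that `upd` maintains the property `Enc` of the arrays. -/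
theorem loadRel_exec (L : Listing S) {r : Fin S.numRel} (hr : S.isDyn r = true)
    (hb : S.arity r + 2 ≤ b) (hs : upd.Simple)
    (hw : ∀ a, ¬ upd.Writes ((Rg.aidx a).code b) ∧ ¬ upd.Writes ((Rg.abnd a).code b))
    (hst : ∀ A < S.numRel, ¬ upd.Stores A)
    (hupd : ∀ (D : Database S) (u : Update S) (σ : Mem), Enc D σ.arr →
      Enc (u.apply D) (upd.eval (u.request σ)).arr)
    {D : Database S} {σ : Mem} (hin : ∀ r < S.numRel, σ.arr r = L.initMem.arr r)
    (hD : Enc D σ.arr) : ∃ tr σ', (loadRel b upd r).Exec σ tr σ' ∧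
      tr.length ≤ (L.list r).length * ((requestCode b r (List.finRange _) ;; upd).size + 3) + 7 ∧
      (∀ r < S.numRel, σ'.arr r = L.initMem.arr r) ∧
      Enc (Function.update D r (D r ∪ L.db r)) σ'.arr := by
  have hc := fun i => Rg.le_code b (.aidx i)
  have hc' := fun i => Rg.le_code b (.abnd i)
  have hbs : (requestCode b r (List.finRange _) ;; upd).Simple := ⟨requestCode_simple _ _, hs⟩
  have hbw : ∀ a, ¬ (requestCode b r (List.finRange _) ;; upd).Writes ((Rg.aidx a).code b) ∧
      ¬ (requestCode b r (List.finRange _) ;; upd).Writes ((Rg.abnd a).code b) := by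
    intro a
    have h₁ := hc a
    have h₂ := hc' a
    constructor <;> rintro (h | h)
    · rcases requestCode_writes h with h | h
      · omega
      · simp at h
    · exact (hw a).1 h
    · rcases requestCode_writes h with h | h
      · omega
      · simp at h
    · exact (hw a).2 h
  obtain ⟨tr, σ', he, hlen, h₁, h₂⟩ := Prog.exec_forLoop (o := (Rg.aidx 1).code b)
    (i := (Rg.aidx 0).code b) (n := (Rg.abnd 0).code b)
    (body := requestCode b r (List.finRange _) ;; upd) (N := (L.list r).length)
    (T := (requestCode b r (List.finRange _) ;; upd).size)
    (fun i σ => (∀ r < S.numRel, σ.arr r = L.initMem.arr r) ∧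
      Enc (Function.update D r (D r ∪ ((L.list r).take i).toFinset)) σ.arr)
    (by simp) (by simp) (hbw 0).1 (hbw 0).2 (hbw 1).1 (fun _ _ _ h => h)
    (by
      rintro i hi σ ⟨h₁, h₂⟩ hidx -
      obtain ⟨n, hn, he⟩ := hbs.exec σ
      refine ⟨_, _, he, by simpa using hn, fun r' hr' => ?_, ?_⟩
      · rw [hbs.eval_arr, h₁ r' hr']
        rintro (h | h)
        · exact requestCode_stores _ _ _ h
        · exact hst r' hr' h
      · have ht : ∀ j : Fin (S.arity r), σ.arr r [σ.reg ((Rg.aidx 0).code b), j] =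
            (L.list r)[i] j := fun j => by
          rw [h₁ r r.isLt, hidx, L.initMem_cell r i j (List.getElem?_eq_getElem hi)]
        obtain ⟨e₁, e₂, e₃⟩ := requestCode_eval hb ht (List.finRange _)
        have ha : ((requestCode b r (List.finRange _)).eval σ).arr = σ.arr := funext fun A =>
          (requestCode_simple r _).eval_arr σ (requestCode_stores _ _ A)
        have := hupd _ ⟨r, hr, true, (L.list r)[i]⟩ ((requestCode b r (List.finRange _)).eval σ)
          (ha ▸ h₂)
        rw [request_eq_self e₁ e₂ fun j => e₃ j (.inl (List.mem_finRange j))] at this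
        convert this using 1
        swap
        · rfl
        simp only [Update.apply, Function.update_self, if_true, Function.update_idem]
        rw [List.take_succ_eq_append_getElem hi]
        congr 1
        ext t
        simp only [Finset.mem_union, Finset.mem_insert, List.mem_toFinset, List.mem_append,
          List.mem_singleton]
        tauto)
    ((σ.setReg ((Rg.aidx 1).code b) 1).setReg ((Rg.abnd 0).code b) (σ.arr r []))
    ⟨hin, by simpa using hD⟩ (by simp [hin r r.isLt, L.initMem_nil]) (by simp)
  refine ⟨_, σ', (Prog.Exec.const _ _ _).seq ((Prog.Exec.load _ _ _ _).seq he), ?_, h₁, ?_⟩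
  · simp only [List.length_cons, List.length_append, List.length_nil]
    omega
  · rwa [List.take_length] at h₂

theorem loadCode_exec (L : Listing S) (hb : ∀ r, S.arity r + 2 ≤ b) (hs : upd.Simple)
    (hw : ∀ a, ¬ upd.Writes ((Rg.aidx a).code b) ∧ ¬ upd.Writes ((Rg.abnd a).code b))
    (hst : ∀ A < S.numRel, ¬ upd.Stores A)
    (hupd : ∀ (D : Database S) (u : Update S) (σ : Mem), Enc D σ.arr →
      Enc (u.apply D) (upd.eval (u.request σ)).arr)
    {K : ℕ} (hK : ∀ r : Fin S.numRel, (requestCode b r (List.finRange _) ;; upd).size + 8 ≤ K)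
    {l : List (Fin S.numRel)} (hl : ∀ r ∈ l, S.isDyn r = true)
    {D : Database S} {σ : Mem} (hin : ∀ r < S.numRel, σ.arr r = L.initMem.arr r)
    (hD : Enc D σ.arr) : ∃ tr σ', (loadCode b upd l).Exec σ tr σ' ∧
      tr.length ≤ (l.map fun r => (L.list r).length * K + K).sum + 1 ∧
      Enc (fun r => if r ∈ l then D r ∪ L.db r else D r) σ'.arr := by
  induction l generalizing D σ with
  | nil => exact ⟨_, _, Prog.Exec.const _ _ _, by simp, by simpa using hD⟩
  | cons r l ih =>
    simp only [List.mem_cons, forall_eq_or_imp] at hl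
    obtain ⟨t₁, σ₁, e₁, l₁, i₁, d₁⟩ := loadRel_exec L hl.1 (hb r) hs hw hst hupd hin hD
    obtain ⟨t₂, σ₂, e₂, l₂, d₂⟩ := ih hl.2 i₁ d₁
    refine ⟨_, σ₂, e₁.seq e₂, ?_, ?_⟩
    · have := Nat.mul_le_mul_left (L.list r).length (hK r)
      have := hK r
      simp only [List.length_cons, List.length_append, List.map_cons, List.sum_cons]
      have : (L.list r).length * ((requestCode b r (List.finRange _) ;; upd).size + 3) ≤
        (L.list r).length * K := Nat.mul_le_mul_left _ (by omega)
      omega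
    · convert d₂ using 1
      funext r'
      by_cases h : r' = r
      · subst h
        simp
      · simp [h]

/-- Programs that maintain an encoding `Enc` of the database in the arrays give rise to a maintenance
algorithm: the preprocessing first handles the static relations and then inserts the tuples of the
dynamic relations one by one. The encoding refers to the arrays alone and enumerations do not change
them, so that an enumeration may be abandoned at any time. -/
theorem exists_maintenance {Q : CQ S} (hb : ∀ r, S.arity r + 2 ≤ b) {prep upd enum : Prog}
    {Enc : Listing S → Database S → (ℕ → List ℕ → ℕ) → Prop} {f : ℕ → ℕ} {c : ℕ}
    (hprep : ∀ L : Listing S, ∃ tr σ, prep.Exec L.initMem tr σ ∧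
      tr.length ≤ f L.db.staticSize ∧ (∀ r < S.numRel, σ.arr r = L.initMem.arr r) ∧
      Enc L L.db.staticPart σ.arr)
    (hs : upd.Simple)
    (hw : ∀ a, ¬ upd.Writes ((Rg.aidx a).code b) ∧ ¬ upd.Writes ((Rg.abnd a).code b))
    (hst : ∀ A < S.numRel, ¬ upd.Stores A)
    (hupd : ∀ (L : Listing S) (D : Database S) (u : Update S) (σ : Mem), Enc L D σ.arr →
      Enc L (u.apply D) (upd.eval (u.request σ)).arr)
    (hest : ∀ A, ¬ enum.Stores A)
    (henum : ∀ (L : Listing S) (D : Database S) (σ : Mem), Enc L D σ.arr →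
      ∃ tr σ', enum.Exec σ tr σ' ∧ (tr.filterMap id).Nodup ∧
        {t | t ∈ tr.filterMap id} = Q.result D ∧ GapLE c tr) :
    ∃ (A : Maintenance) (k : ℕ), A.PreprocessingTime S (fun N M => f N + k + k * M) ∧
      A.UpdateTime S k ∧ A.EnumerationDelay Q k := by
  classical
  set dl := (List.finRange S.numRel).filter fun r => S.isDyn r = true with hdl
  set K := ∑ r : Fin S.numRel, ((requestCode b r (List.finRange _) ;; upd).size + 8) with hKdef
  have hK : ∀ r : Fin S.numRel, (requestCode b r (List.finRange _) ;; upd).size + 8 ≤ K := fun r =>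
    Finset.single_le_sum (f := fun r : Fin S.numRel =>
      (requestCode b r (List.finRange _) ;; upd).size + 8) (fun _ _ => Nat.zero_le _)
      (Finset.mem_univ r)
  have hprep' : ∀ L : Listing S, ∃ tr σ, (prep ;; loadCode b upd dl).Exec L.initMem tr σ ∧
      tr.length ≤ f L.db.staticSize + (K * S.numRel + 2) + K * L.db.dynamicSize ∧
      Enc L L.db σ.arr := by
    intro L
    obtain ⟨t₁, σ₁, e₁, l₁, i₁, d₁⟩ := hprep L
    obtain ⟨t₂, σ₂, e₂, l₂, d₂⟩ := loadCode_exec L hb hs hw hst (hupd L) hK (l := dl)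
      (fun r hr => by simpa [hdl] using hr) i₁ d₁
    refine ⟨_, σ₂, e₁.seq e₂, ?_, ?_⟩
    · have h₁ : (dl.map fun r => (L.list r).length * K + K).sum ≤
          K * L.db.dynamicSize + K * S.numRel := by
        have hnd : dl.Nodup := (List.nodup_finRange _).filter _
        rw [← List.sum_toFinset _ hnd, Finset.sum_add_distrib, Finset.sum_const, smul_eq_mul,
          ← Finset.sum_mul, mul_comm _ K, mul_comm _ K]
        refine Nat.add_le_add (Nat.mul_le_mul_left _ ?_) (Nat.mul_le_mul_left _ ?_)
        · rw [Database.dynamicSize]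
          refine (Finset.sum_congr ?_ fun r _ => ?_).le
          · ext r
            simp [hdl]
          · exact (List.toFinset_card_of_nodup (L.nodup r)).symm
        · exact (Finset.card_le_univ _).trans_eq (Fintype.card_fin _)
      simp only [List.length_cons, List.length_append]
      omega
    · convert d₂ using 1
      funext r
      by_cases h : S.isDyn r = true <;> simp [hdl, Database.staticPart, h]
  set A : Maintenance := ⟨prep ;; loadCode b upd dl, upd, enum⟩ with hA
  have hreach : ∀ L D σ, A.Reachable L D σ → Enc L D σ.arr := by
    intro L D σ h
    induction h with
    | prep h =>
      obtain ⟨t, σ', e, -, d⟩ := hprep' L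
      obtain ⟨-, rfl⟩ := Run.unique h e.run
      exact d
    | update u _ h ih =>
      obtain ⟨n, -, e⟩ := hs.exec (u.request _)
      obtain ⟨-, rfl⟩ := Run.unique h e.run
      exact hupd L _ u _ ih
    | enum _ h ih =>
      have := funext fun B => h.arr_eq (A := B) (by simpa [hA] using hest B)
      rwa [this]
  refine ⟨A, K * S.numRel + 2 + K + upd.size + c, fun L => ?_, fun L D σ _ u => ?_,
    fun L D σ h => ?_⟩
  · obtain ⟨t, σ', e, l, -⟩ := hprep' L
    refine ⟨t, σ', e.run, l.trans ?_⟩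
    beta_reduce
    have := Nat.mul_le_mul_right L.db.dynamicSize
      (show K ≤ K * S.numRel + 2 + K + upd.size + c by omega)
    omega
  · obtain ⟨n, hn, e⟩ := hs.exec (u.request σ)
    exact ⟨_, _, e.run, by simp; omega⟩
  · obtain ⟨tr, σ', e, h₁, h₂, h₃⟩ := henum L D σ (hreach L D σ h)
    refine ⟨tr, σ', e.run, h₁, h₂, fun w hw hn => ?_⟩
    have := h₃ w hw hn
    omega

end load

/-! ### Running times that are at most exponential -/

/-- The function is bounded by `2 ^ (C * (n + 1))` for some constant `C`. -/
def ExpBdd (f : ℕ → ℕ) : Prop := ∃ C, ∀ n, f n ≤ 2 ^ (C * (n + 1))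

namespace ExpBdd

variable {f g : ℕ → ℕ}

theorem mono (hg : ExpBdd g) (h : ∀ n, f n ≤ g n) : ExpBdd f :=
  hg.imp fun _ hC n => (h n).trans (hC n)

theorem const (k : ℕ) : ExpBdd fun _ => k :=
  ⟨k, fun n => Nat.lt_two_pow_self.le.trans
    (Nat.pow_le_pow_right two_pos (Nat.le_mul_of_pos_right k n.succ_pos))⟩

theorem id : ExpBdd fun n => n :=
  ⟨1, fun _ => Nat.lt_two_pow_self.le.trans (Nat.pow_le_pow_right two_pos (by dsimp only; omega))⟩

theorem mul (hf : ExpBdd f) (hg : ExpBdd g) : ExpBdd fun n => f n * g n := by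
  obtain ⟨C, hC⟩ := hf
  obtain ⟨C', hC'⟩ := hg
  exact ⟨C + C', fun n => (Nat.mul_le_mul (hC n) (hC' n)).trans_eq (by rw [← pow_add, add_mul])⟩

theorem add (hf : ExpBdd f) (hg : ExpBdd g) : ExpBdd fun n => f n + g n := by
  obtain ⟨C, hC⟩ := hf
  obtain ⟨C', hC'⟩ := hg
  refine ((const 2).mul (g := fun n => 2 ^ ((C + C') * (n + 1))) ⟨_, fun _ => le_rfl⟩).mono
    fun n => ?_
  have h₁ := (hC n).trans (Nat.pow_le_pow_right two_pos
    (Nat.mul_le_mul_right (n + 1) (Nat.le_add_right C C')))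
  have h₂ := (hC' n).trans (Nat.pow_le_pow_right two_pos
    (Nat.mul_le_mul_right (n + 1) (Nat.le_add_left C' C)))
  omega

theorem two_pow (k : ℕ) : ExpBdd fun n => 2 ^ (k * n) :=
  ⟨k, fun n => Nat.pow_le_pow_right two_pos (Nat.mul_le_mul_left k n.le_succ)⟩

theorem nestCost (hf : ExpBdd f) (k : ℕ) : ExpBdd fun n => _root_.nestCost n (f n) k := by
  induction k with
  | zero => exact hf
  | succ k ih => exact (id.mul (ih.add (const 3))).add (const 3)

end ExpBdd

/-! ### Well-behaved queries -/

section wellBehaved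

variable {S : Schema} {b : ℕ} {aid : Atom S → ℕ}

/-- Run `body` if the relation of the requested update is number `r`. -/
def relTest (b r : ℕ) (body : Prog) : Prog :=
  .const (Rg.tmp₁.code b) r ;;
  .ite (Rg.tmp₁.code b) 1 (skipCode b) (.ite 1 (Rg.tmp₁.code b) (skipCode b) body)

/-- Load component `j` of the tuple of the requested update. -/
def argFetch (b : ℕ) {k : ℕ} (j : Fin k) : Prog :=
  .const (Rg.tmp₃.code b) 0 ;; .add (Rg.tmp₁.code b) (j + 2) (Rg.tmp₃.code b)

/-- Apply the requested update to the leaf `i` of the dynamic atom `a`. The register `top` has to hold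
`1` for an insert and `0` for a delete. -/
def atomUpdate (b i : ℕ) (p : Plan) (a : Atom S) : Prog :=
  relTest b a.rel (matchCode b (argFetch b) a.args (List.finRange _)
    (p.updateLeaf b i (List.ofFn a.args) .top))

/-- Apply the requested update to the leaves of a list of dynamic atoms. -/
def atomUpdates (b : ℕ) (aid : Atom S → ℕ) (p : Plan) : List (Atom S) → Prog
  | [] => skipCode b
  | a :: l => atomUpdate b (aid a) p a ;; atomUpdates b aid p l

/-- Apply the requested update to the leaves of all dynamic atoms. -/
def planUpdate (b : ℕ) (aid : Atom S → ℕ) (p : Plan) (l : List (Atom S)) : Prog :=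
  .const (Rg.one.code b) 1 ;; .const (Rg.tmp₁.code b) 0 ;;
  .add (Rg.top.code b) 0 (Rg.tmp₁.code b) ;; atomUpdates b aid p l

/-- The registers that hold the request. -/
structure IsRequest (b : ℕ) (u : Update S) (σ : Mem) : Prop where
  one : σ.reg (Rg.one.code b) = 1
  top : σ.reg (Rg.top.code b) = if u.insert then 1 else 0
  rel : σ.reg 1 = u.rel
  tuple : ∀ j : Fin (S.arity u.rel), σ.reg (j + 2) = u.tuple j

theorem Update.request_reg (u : Update S) (σ : Mem) :
    (u.request σ).reg 0 = (if u.insert then 1 else 0) ∧ (u.request σ).reg 1 = u.rel ∧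
      ∀ j : Fin (S.arity u.rel), (u.request σ).reg (j + 2) = u.tuple j := by
  refine ⟨rfl, rfl, fun j => ?_⟩
  simp only [Update.request, List.getD_cons_succ]
  rw [List.getD_eq_getElem _ _ (by simp), List.getElem_ofFn]

theorem argFetch_isFetch {k : ℕ} {j : Fin k} (hk : k + 2 ≤ b) {X : Set ℕ} {σ : Mem} {v : ℕ}
    (hv : σ.reg (j + 2) = v) : IsFetch b (matchRegs X) σ (argFetch b j) v := by
  have hj := j.isLt
  have h₃ := Rg.le_code b .tmp₃
  intro σ' hσ'
  refine ⟨?_, rfl, fun y h₁ h₂ => ?_⟩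
  · have := hσ'.reg_lt (show (j : ℕ) + 2 < b by omega)
    have hne : (j : ℕ) + 2 ≠ Rg.tmp₃.code b := by omega
    simp [argFetch, Prog.eval, hne, this, hv]
  · simp [argFetch, Prog.eval, h₁, h₂]

theorem argFetch_writes {k : ℕ} (j : Fin k) (y : ℕ) (h : (argFetch b j).Writes y) :
    y = Rg.tmp₁.code b ∨ y = Rg.tmp₃.code b := by
  rcases h with h | h
  exacts [.inr h, .inl h]

theorem relTest_eval {r : ℕ} {body : Prog} {σ : Mem} (hb : 2 ≤ b) :
    (relTest b r body).eval σ = if σ.reg 1 = r then body.eval (σ.setReg (Rg.tmp₁.code b) r)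
      else (σ.setReg (Rg.tmp₁.code b) r).setReg (Rg.tmp₁.code b) 0 := by
  have h := Rg.le_code b .tmp₁
  have hne : 1 ≠ Rg.tmp₁.code b := by omega
  simp only [relTest, Prog.eval, skipCode, Mem.setReg_reg, if_true, if_neg hne]
  split_ifs <;> first | rfl | omega

theorem atomUpdate_simple (i : ℕ) (p : Plan) (a : Atom S) : (atomUpdate b i p a).Simple :=
  ⟨trivial, trivial, trivial, matchCode_simple (fun _ => ⟨trivial, trivial⟩)
    (Plan.updateLeaf_simple _ _ _ _ _)⟩

theorem atomUpdates_simple (p : Plan) (l : List (Atom S)) : (atomUpdates b aid p l).Simple := by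
  induction l with
  | nil => trivial
  | cons a l ih => exact ⟨atomUpdate_simple _ p a, ih⟩

theorem atomUpdate_writes {i : ℕ} {p : Plan} {a : Atom S} {y : ℕ}
    (h : (atomUpdate b i p a).Writes y) : ∃ r : Rg, y = r.code b ∧ r ≠ .one ∧ r ≠ .top ∧
      ∀ a, r ≠ .aidx a ∧ r ≠ .abnd a := by
  rcases h with h | h | h | h
  · exact ⟨_, h, by simp⟩
  · exact ⟨_, h, by simp⟩
  · exact ⟨_, h, by simp⟩
  · rcases matchCode_writes argFetch_writes h with h | h | h | h | ⟨j, -, h⟩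
    · rcases Plan.updateLeaf_writes h with h | h | h | h <;> exact ⟨_, h, by simp⟩
    all_goals exact ⟨_, h, by simp⟩

theorem atomUpdates_writes {p : Plan} {l : List (Atom S)} {y : ℕ}
    (h : (atomUpdates b aid p l).Writes y) : ∃ r : Rg, y = r.code b ∧ r ≠ .one ∧ r ≠ .top ∧
      ∀ a, r ≠ .aidx a ∧ r ≠ .abnd a := by
  induction l with
  | nil => exact ⟨_, h, by simp⟩
  | cons a l ih => exact h.elim atomUpdate_writes ih

theorem atomUpdate_stores {i : ℕ} {p : Plan} {a : Atom S} {A : ℕ}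
    (h : (atomUpdate b i p a).Stores A) : A = (Ar.bit i).code b ∨
    ∃ x ∈ p.bvars, A = (Ar.pos x).code b ∨ A = (Ar.cnt x).code b ∨ A = (Ar.list x).code b := by
  rcases h with h | h | h | h
  · exact h.elim
  · exact h.elim
  · exact h.elim
  · exact Plan.updateLeaf_stores (matchCode_stores (fun _ _ => by simp [argFetch, Prog.Stores]) h)

theorem atomUpdates_stores {p : Plan} {l : List (Atom S)} {A : ℕ}
    (h : (atomUpdates b aid p l).Stores A) : b ≤ A := by
  induction l with
  | nil => exact h.elim
  | cons a l ih =>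
    rcases h with h | h
    · rcases atomUpdate_stores h with h | ⟨x, -, h | h | h⟩ <;> subst h <;> exact Ar.le_code b _
    · exact ih h

theorem atomUpdate_request {i : ℕ} {p : Plan} {a : Atom S} {u : Update S} {σ : Mem}
    (hb : S.arity u.rel + 2 ≤ b) (hu : IsRequest b u σ) :
    IsRequest b u ((atomUpdate b i p a).eval σ) := by
  have hs := atomUpdate_simple (b := b) i p a
  have low : ∀ y < b, ((atomUpdate b i p a).eval σ).reg y = σ.reg y := fun y hy =>
    hs.eval_reg σ fun h => by
      obtain ⟨r, hr, -⟩ := atomUpdate_writes h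
      have := r.le_code b
      omega
  refine ⟨?_, ?_, ?_, fun j => ?_⟩
  · rw [hs.eval_reg σ, hu.one]
    intro h
    obtain ⟨r, hr, h₁, -⟩ := atomUpdate_writes h
    exact h₁ (Rg.code_inj.1 hr).symm
  · rw [hs.eval_reg σ, hu.top]
    intro h
    obtain ⟨r, hr, -, h₁, -⟩ := atomUpdate_writes h
    exact h₁ (Rg.code_inj.1 hr).symm
  · rw [low _ (by omega), hu.rel]
  · rw [low _ (by omega), hu.tuple]

theorem atomUpdate_eval {i : ℕ} {p : Plan} {a : Atom S} {u : Update S} {σ : Mem} {D : Database S}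
    (hb : S.arity u.rel + 2 ≤ b) (hu : IsRequest b u σ) (hw : p.WF)
    (hpath : p.Path i (List.ofFn a.args)) (hi : i ∈ p.leaves) (hinv : p.Inv b σ.arr)
    (hD : ∀ μ : ℕ → ℕ, σ.arr ((Ar.bit i).code b) ((List.ofFn a.args).map μ) ≠ 0 ↔
      (fun j => μ (a.args j)) ∈ D a.rel) :
    p.Inv b ((atomUpdate b i p a).eval σ).arr ∧
      ∀ μ : ℕ → ℕ, ((atomUpdate b i p a).eval σ).arr ((Ar.bit i).code b)
        ((List.ofFn a.args).map μ) ≠ 0 ↔ (fun j => μ (a.args j)) ∈ (u.apply D) a.rel := by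
  obtain ⟨r, hd, ins, t⟩ := u
  obtain ⟨r', args⟩ := a
  obtain ⟨u₁, u₂, u₃, u₄⟩ := hu
  dsimp only at *
  rw [atomUpdate, relTest_eval (by omega), u₃]
  by_cases hr : r = r'
  · subst hr
    rw [if_pos rfl]
    set σ₀ := σ.setReg (Rg.tmp₁.code b) r
    have hlt : ∀ y < b, y ≠ Rg.tmp₁.code b := fun y hy => by
      have := Rg.le_code b .tmp₁
      omega
    have hf : ∀ j ∈ List.finRange (S.arity r),
        IsFetch b (matchRegs Set.univ) σ₀ (argFetch b j) (t j) := fun j _ =>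
      argFetch_isFetch hb (by simp [σ₀, hlt (j + 2) (by omega), u₄])
    rcases matchCode_eval (x := args) (body := p.updateLeaf b i (List.ofFn args) .top) hf
      (fun _ _ => Set.mem_univ _) with ⟨σ₁, n₁, h₁, h₂⟩ | ⟨n₁, h₁⟩
    · have a₁ : σ₁.arr = σ.arr := n₁.1
      have ht : ∀ μ : ℕ → ℕ, (List.ofFn args).map μ = (List.ofFn args).map (σ₁.env b) ↔
          (fun j => μ (args j)) = t := by
        intro μ
        rw [List.map_inj_left, funext_iff]
        simp only [List.mem_ofFn, forall_exists_index, forall_apply_eq_imp_iff]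
        exact forall_congr' fun j => by rw [h₁ j (List.mem_finRange j)]
      rw [h₂]
      refine ⟨Plan.updateLeaf_inv hw hpath hi ?_ (a₁ ▸ hinv), fun μ => ?_⟩
      · rw [n₁.reg (by simp [matchRegs])]
        simpa [σ₀] using u₁
      · rw [Plan.updateLeaf_bit, a₁, n₁.reg (by simp [matchRegs])]
        have htop : σ₀.reg (Rg.top.code b) = if ins then 1 else 0 := by simpa [σ₀] using u₂
        simp only [Update.apply, Function.update_self, ht, true_and, htop]
        by_cases hμ : (fun j => μ (args j)) = t
        · rw [if_pos hμ, hμ]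
          cases ins <;> simp
        · rw [if_neg hμ, hD]
          cases ins <;> simp [hμ]
    · rw [n₁.1]
      refine ⟨hinv, fun μ => ?_⟩
      have hμ : (fun j => μ (args j)) ≠ t := fun h => h₁ ⟨μ, fun j _ => (congrFun h j).symm⟩
      simp only [Update.apply, Function.update_self, σ₀, Mem.setReg_arr]
      rw [hD]
      cases ins <;> simp [hμ]
  · rw [if_neg fun h => hr (Fin.ext h)]
    refine ⟨hinv, fun μ => ?_⟩
    simpa [Update.apply, Function.update_of_ne (Ne.symm hr)] using hD μ

theorem atomUpdates_eval {p : Plan} {u : Update S} {D : Database S}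
    (hb : S.arity u.rel + 2 ≤ b) (hw : p.WF) {l : List (Atom S)} {σ : Mem} (hu : IsRequest b u σ)
    (hid : (l.map aid).Nodup)
    (hpath : ∀ a ∈ l, p.Path (aid a) (List.ofFn a.args) ∧ aid a ∈ p.leaves)
    (hinv : p.Inv b σ.arr)
    (hD : ∀ a ∈ l, ∀ μ : ℕ → ℕ, σ.arr ((Ar.bit (aid a)).code b) ((List.ofFn a.args).map μ) ≠ 0 ↔
      (fun j => μ (a.args j)) ∈ D a.rel) :
    p.Inv b ((atomUpdates b aid p l).eval σ).arr ∧
      (∀ i ∉ l.map aid, ((atomUpdates b aid p l).eval σ).arr ((Ar.bit i).code b) =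
        σ.arr ((Ar.bit i).code b)) ∧
      ∀ a ∈ l, ∀ μ : ℕ → ℕ, ((atomUpdates b aid p l).eval σ).arr ((Ar.bit (aid a)).code b)
        ((List.ofFn a.args).map μ) ≠ 0 ↔ (fun j => μ (a.args j)) ∈ (u.apply D) a.rel := by
  have keep : ∀ (a : Atom S) (i : ℕ) (σ : Mem), i ≠ aid a →
      ((atomUpdate b (aid a) p a).eval σ).arr ((Ar.bit i).code b) =
        σ.arr ((Ar.bit i).code b) := by
    intro a i σ hi
    refine (atomUpdate_simple _ p a).eval_arr σ fun h => ?_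
    rcases atomUpdate_stores h with h | ⟨x, -, h | h | h⟩ <;> simp [hi] at h
  induction l generalizing σ with
  | nil => exact ⟨hinv, by simp [atomUpdates, skipCode, Prog.eval], by simp⟩
  | cons a l ih =>
    simp only [List.mem_cons, forall_eq_or_imp, List.map_cons, List.nodup_cons, not_or] at *
    obtain ⟨i₁, i₂⟩ := atomUpdate_eval hb hu hw hpath.1.1 hpath.1.2 hinv hD.1
    have hne : ∀ a' ∈ l, aid a' ≠ aid a := fun a' ha' h => hid.1 (h ▸ List.mem_map_of_mem ha')
    obtain ⟨j₁, j₂, j₃⟩ := ih (atomUpdate_request hb hu) hid.2 hpath.2 i₁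
      (fun a' ha' μ => by rw [keep a _ σ (hne a' ha')]; exact hD.2 a' ha' μ)
    refine ⟨j₁, fun i hi => ?_, fun μ => ?_, j₃⟩
    · exact (j₂ i hi.2).trans (keep a i σ hi.1)
    · rw [atomUpdates, Prog.eval, j₂ _ hid.1]
      exact i₂ μ

/-- Fill the tries of a list of static groups. -/
def fillAll (b : ℕ) (aid : Atom S → ℕ) : List (StatGroup S) → Prog
  | [] => skipCode b
  | g :: T => fillCode b aid g.atoms g.id g.ks g.os ;; fillAll b aid T

/-- A bound for the running time of `fillAll`, if the relations have at most `B` tuples. -/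
def fillCost (b : ℕ) (aid : Atom S → ℕ) (T : List (StatGroup S)) (B : ℕ) : ℕ :=
  (T.map fun g => nestCost B (fillCode b aid g.atoms g.id g.ks g.os).size g.atoms.length +
    (fillCode b aid g.atoms g.id g.ks g.os).size + 1).sum + 1

theorem fillCost_expBdd (T : List (StatGroup S)) : ExpBdd (fillCost b aid T) := by
  refine .add ?_ (.const 1)
  induction T with
  | nil => exact .const 0
  | cons g T ih =>
    exact ((((ExpBdd.const _).nestCost _).add (.const _)).add (.const 1)).add ih

theorem fillAll_exec (L : Listing S) (hb : S.numRel ≤ b) {B : ℕ} {T : List (StatGroup S)}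
    (hT : T.Pairwise fun g g' => g.id ≠ g'.id ∧ g.os.Disjoint g'.os)
    (hatoms : ∀ g ∈ T, g.atoms.Nodup ∧ (∀ a ∈ g.atoms, ∀ a' ∈ g.atoms, aid a = aid a' → a = a') ∧
      ∀ a ∈ g.atoms, (L.list a.rel).length ≤ B)
    (hvars : ∀ g ∈ T, (g.ks ++ g.os).Nodup ∧ ∀ x ∈ g.ks ++ g.os, ∃ a ∈ g.atoms, ∃ j, a.args j = x)
    {σ : Mem} (h1 : σ.reg (Rg.one.code b) = 1) (hin : ∀ r < S.numRel, σ.arr r = L.initMem.arr r)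
    (h0 : ∀ g ∈ T, (∀ l, σ.arr ((Ar.bit g.id).code b) l = 0) ∧
      ∀ x ∈ g.os, ∀ l, σ.arr ((Ar.pos x).code b) l = 0 ∧ σ.arr ((Ar.cnt x).code b) l = 0) :
    ∃ tr σ', (fillAll b aid T).Exec σ tr σ' ∧ tr.length ≤ fillCost b aid T B ∧
      (∀ r < S.numRel, σ'.arr r = L.initMem.arr r) ∧
      (∀ A : Ar, (∀ g ∈ T, A ≠ .bit g.id ∧ ∀ x ∈ g.os, A ≠ .pos x ∧ A ≠ .cnt x ∧ A ≠ .list x) →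
        σ'.arr (A.code b) = σ.arr (A.code b)) ∧
      ∀ g ∈ T, g.plan.Inv b σ'.arr ∧ ∀ l, σ'.arr ((Ar.bit g.id).code b) l ≠ 0 ↔
        ∃ ν : ℕ → ℕ, (∀ a ∈ g.atoms, (fun j => ν (a.args j)) ∈ L.db a.rel) ∧
          (g.ks ++ g.os).map ν = l := by
  induction T generalizing σ with
  | nil => exact ⟨_, _, .const _ _ _, by simp [fillCost], hin, by simp, by simp⟩
  | cons g T ih =>
    simp only [List.mem_cons, forall_eq_or_imp, List.pairwise_cons] at *
    obtain ⟨t₁, σ₁, e₁, l₁, o₁, n₁, i₁, b₁⟩ := fillCode_exec L hb hatoms.1.1 hatoms.1.2.1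
      hatoms.1.2.2 hvars.1.1 hvars.1.2 h1 hin h0.1.1 h0.1.2
    have k₁ : ∀ A : Ar, (A ≠ .bit g.id ∧ ∀ x ∈ g.os, A ≠ .pos x ∧ A ≠ .cnt x ∧ A ≠ .list x) →
        σ₁.arr (A.code b) = σ.arr (A.code b) := fun A hA => e₁.arr_eq fun h => by
      rcases fillCode_stores h with h | ⟨x, hx, h | h | h⟩ <;> rw [Ar.code_inj] at h
      · exact hA.1 h
      · exact (hA.2 x hx).1 h
      · exact (hA.2 x hx).2.1 h
      · exact (hA.2 x hx).2.2 h
    obtain ⟨t₂, σ₂, e₂, l₂, n₂, k₂, d₂⟩ := ih hT.2 hatoms.2 hvars.2 o₁ n₁ (by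
      intro g' hg'
      obtain ⟨h, h'⟩ := hT.1 g' hg'
      refine ⟨fun l => ?_, fun x hx l => ?_⟩
      · rw [k₁ _ ⟨by simpa using h.symm, by simp⟩, (h0.2 g' hg').1]
      · have hne : ∀ y ∈ g.os, x ≠ y := fun y hy hxy => h' hy (hxy ▸ hx)
        rw [k₁ _ ⟨by simp, fun y hy => by simp [hne y hy]⟩,
          k₁ _ ⟨by simp, fun y hy => by simp [hne y hy]⟩]
        exact (h0.2 g' hg').2 x hx l)
    refine ⟨_, σ₂, e₁.seq e₂, ?_, n₂, fun A hA => ?_, ⟨?_, fun l => ?_⟩, d₂⟩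
    · simp only [fillCost, List.map_cons, List.sum_cons, List.length_cons,
        List.length_append] at l₂ ⊢
      omega
    · rw [k₂ A hA.2, k₁ A hA.1]
    · refine Plan.inv_congr_arr (p := Plan.trie g.id g.ks g.os) ?_ ?_ i₁
      · intro a ha
        rw [Plan.trie_leaves, List.mem_singleton] at ha
        subst ha
        exact k₂ _ fun g' hg' => ⟨by simpa using (hT.1 g' hg').1, by simp⟩
      · intro x hx
        rw [Plan.trie_bvars] at hx
        have hne : ∀ g' ∈ T, ∀ y ∈ g'.os, x ≠ y := fun g' hg' y hy hxy =>
          (hT.1 g' hg').2 hx (hxy ▸ hy)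
        refine ⟨?_, ?_, ?_⟩ <;>
          exact k₂ _ fun g' hg' => ⟨by simp, fun y hy => by simp [hne g' hg' y hy]⟩
    · rw [k₂ _ fun g' hg' => ⟨by simpa using (hT.1 g' hg').1, by simp⟩]
      exact b₁ l

end wellBehaved

section wellBehaved

variable {S : Schema}

theorem exists_base (S : Schema) : ∃ b, S.numRel ≤ b ∧ ∀ r, S.arity r + 2 ≤ b := by
  refine ⟨S.numRel + ∑ r, S.arity r + 2, by omega, fun r => ?_⟩
  have := Finset.single_le_sum (f := S.arity) (fun _ _ => Nat.zero_le _) (Finset.mem_univ r)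
  omega

theorem Listing.initMem_arr_ge (L : Listing S) {A : ℕ} (hA : S.numRel ≤ A) (l : List ℕ) :
    L.initMem.arr A l = 0 := by
  simp [Listing.initMem, Nat.not_lt.2 hA]

/-- A well-behaved query is maintained with the help of its plan. -/
theorem exists_maintenance_of_wellBehaved {Q : CQ S} (hQ : Q.WellBehaved) (hne : Q.body.Nonempty)
    (B : ℕ → ℕ) (hB : ∀ L : Listing S, ∀ a ∈ Q.body, S.isDyn a.rel = false →
      (L.list a.rel).length ≤ B L.db.staticSize) :
    ∃ (A : Maintenance) (f : ℕ → ℕ) (k : ℕ), ExpBdd f ∧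
      A.PreprocessingTime S (fun N M => f (B N) + k + k * M) ∧ A.UpdateTime S k ∧
      A.EnumerationDelay Q k := by
  classical
  obtain ⟨b, hb, hba⟩ := exists_base S
  obtain ⟨aid, hid⟩ := Set.countable_iff_exists_injOn.1 Q.body.countable_toSet
  obtain ⟨p, T, hp⟩ := CQ.exists_plan hQ b hid _ List.nodup_nil subset_rfl hne (by simp) le_rfl
  set dl := (Q.body.filter fun a => S.isDyn a.rel = true).toList with hdl
  have mem_dl : ∀ {a}, a ∈ dl ↔ a ∈ Q.body ∧ S.isDyn a.rel = true := by simp [hdl]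
  have hidl : (dl.map aid).Nodup := (Finset.nodup_toList _).map_on fun a ha a' ha' h =>
    hid (mem_dl.1 ha).1 (mem_dl.1 ha').1 h
  have hup : ∀ {y}, (planUpdate b aid p dl).Writes y → ∃ r : Rg, y = r.code b ∧
      ∀ a, r ≠ .aidx a ∧ r ≠ .abnd a := by
    rintro y (h | h | h | h)
    · exact ⟨_, h, by simp⟩
    · exact ⟨_, h, by simp⟩
    · exact ⟨_, h, by simp⟩
    · obtain ⟨r, h₁, -, -, h₂⟩ := atomUpdates_writes h
      exact ⟨r, h₁, h₂⟩
  suffices H : ∃ (A : Maintenance) (k : ℕ),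
      A.PreprocessingTime S (fun N M => fillCost b aid T (B N) + 2 + k + k * M) ∧
      A.UpdateTime S k ∧ A.EnumerationDelay Q k by
    obtain ⟨A, k, h⟩ := H
    exact ⟨A, _, k, (fillCost_expBdd T).add (.const 2), h⟩
  refine exists_maintenance (Q := Q) (b := b)
    (prep := .const (Rg.one.code b) 1 ;; fillAll b aid T) (upd := planUpdate b aid p dl)
    (enum := p.answerCode b Q.head) (f := fun N => fillCost b aid T (B N) + 2)
    (c := p.delay 1 + (p.status b).size + 5)
    (Enc := fun L D m => p.Inv b m ∧
      (∀ a ∈ dl, ∀ μ : ℕ → ℕ, m ((Ar.bit (aid a)).code b) ((List.ofFn a.args).map μ) ≠ 0 ↔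
        (fun j => μ (a.args j)) ∈ D a.rel) ∧
      (∀ g ∈ T, ∀ l, m ((Ar.bit g.id).code b) l ≠ 0 ↔
        ∃ ν : ℕ → ℕ, (∀ a ∈ g.atoms, (fun j => ν (a.args j)) ∈ L.db a.rel) ∧
          (g.ks ++ g.os).map ν = l) ∧
      ∀ r, S.isDyn r = false → D r = L.db r)
    hba ?prep ⟨trivial, trivial, trivial, atomUpdates_simple p dl⟩ ?_ ?_ ?upd
    (Plan.answerCode_stores _ _) ?enum
  case prep =>
    intro L
    have z : ∀ (A : Ar) (l : List ℕ), (L.initMem.setReg (Rg.one.code b) 1).arr (A.code b) l = 0 :=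
      fun A l => L.initMem_arr_ge (hb.trans (Ar.le_code b A)) l
    obtain ⟨tr, σ, he, hl, h₁, h₂, h₃⟩ := fillAll_exec (b := b) (aid := aid) L hb
      (B := B L.db.staticSize) hp.pairwise
      (fun g hg => ⟨(hp.group_atoms g hg).1, fun a ha a' ha' h =>
        hid ((hp.group_atoms g hg).2 a ha).1 ((hp.group_atoms g hg).2 a' ha').1 h,
        fun a ha => hB L a ((hp.group_atoms g hg).2 a ha).1 ((hp.group_atoms g hg).2 a ha).2⟩)
      hp.group_vars (σ := L.initMem.setReg (Rg.one.code b) 1) (by simp) (fun _ _ => rfl)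
      (fun g _ => ⟨z _, fun x _ l => ⟨z _ l, z _ l⟩⟩)
    have hbit : ∀ a ∈ Q.body, S.isDyn a.rel = true → ∀ l,
        σ.arr ((Ar.bit (aid a)).code b) l = 0 := by
      intro a ha hd l
      rw [h₂ _ fun g hg => ⟨fun h => ?_, by simp⟩, z]
      obtain ⟨a', ha', hd', h'⟩ := hp.group_id g hg
      rw [Ar.bit.injEq, h'] at h
      have := hid ha ha' h
      subst this
      simp [hd] at hd'
    refine ⟨_, σ, (Prog.Exec.const _ _ _).seq he, ?_, h₁, ?_, ?_, fun g hg => (h₃ g hg).2, ?_⟩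
    · simp only [List.length_cons, List.length_append, List.length_nil]
      omega
    · refine hp.init _ (fun g hg => (h₃ g hg).1) hbit fun x _ hx l => ?_
      have hne : ∀ g ∈ T, ∀ y ∈ g.os, x ≠ y := fun g hg y hy h => hx g hg (h ▸ hy)
      constructor <;>
        rw [h₂ _ fun g hg => ⟨by simp, fun y hy => by simp [hne g hg y hy]⟩, z]
    · intro a ha μ
      simp [hbit a (mem_dl.1 ha).1 (mem_dl.1 ha).2, Database.staticPart, (mem_dl.1 ha).2]
    · intro r hr
      simp [Database.staticPart, hr]
  · intro a
    constructor <;> intro h <;> obtain ⟨r, h₁, h₂⟩ := hup h <;> rw [Rg.code_inj] at h₁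
    exacts [(h₂ a).1 h₁.symm, (h₂ a).2 h₁.symm]
  · rintro A hA (h | h | h | h)
    · exact h
    · exact h
    · exact h
    · have := atomUpdates_stores h
      omega
  case upd =>
    rintro L D u σ ⟨i₁, i₂, i₃, i₄⟩
    obtain ⟨q₁, q₂, q₃⟩ := u.request_reg σ
    set σ₁ := (((u.request σ).setReg (Rg.one.code b) 1).setReg (Rg.tmp₁.code b) 0).setReg
      (Rg.top.code b) (if u.insert then 1 else 0) with hσ₁
    have hc := fun r => Rg.le_code b r
    have hbu := hba u.rel
    have low : ∀ y < b, σ₁.reg y = (u.request σ).reg y := by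
      intro y hy
      have h₁ := hc .one
      have h₂ := hc .tmp₁
      have h₃ := hc .top
      simp only [hσ₁, Mem.setReg_reg]
      rw [if_neg (by omega), if_neg (by omega), if_neg (by omega)]
    have hreq : IsRequest b u σ₁ := by
      refine ⟨by simp [hσ₁], by simp [hσ₁], ?_, fun j => ?_⟩
      · rw [low _ (by omega), q₂]
      · rw [low _ (by omega), q₃]
    have ev : (planUpdate b aid p dl).eval (u.request σ) = (atomUpdates b aid p dl).eval σ₁ := by
      have h0 : ∀ r : Rg, 0 ≠ r.code b := fun r => by
        have := hc r
        omega
      simp [planUpdate, Prog.eval, hσ₁, h0, q₁]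
    obtain ⟨j₁, j₂, j₃⟩ := atomUpdates_eval (D := D) hbu hp.wf hreq hidl
      (fun a ha => ⟨hp.dyn_path a (mem_dl.1 ha).1 (mem_dl.1 ha).2,
        hp.dyn_mem a (mem_dl.1 ha).1 (mem_dl.1 ha).2⟩) (show p.Inv b σ₁.arr from i₁) i₂
    rw [ev]
    refine ⟨j₁, j₃, fun g hg l => ?_, fun r hr => ?_⟩
    · rw [j₂]
      · exact i₃ g hg l
      · intro h
        obtain ⟨a, ha, h⟩ := List.mem_map.1 h
        obtain ⟨a', ha', hd', h'⟩ := hp.group_id g hg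
        have := hid (mem_dl.1 ha).1 ha' (h.trans h')
        subst this
        simp [(mem_dl.1 ha).2] at hd'
    · rw [← i₄ r hr, Update.apply, Function.update_of_ne]
      rintro rfl
      simp [u.dyn] at hr
  case enum =>
    rintro L D σ ⟨i₁, i₂, i₃, i₄⟩
    obtain ⟨tr, σ', he, hnd, hmem, hgap⟩ := Plan.answerCode_exec hp.wf (head := Q.head) (by
      intro x
      rw [hp.outs, CQ.free, List.mem_toFinset, CQ.mem_varsOf]
      exact ⟨fun h => ⟨Q.head_subset x h, by simp, h⟩, fun h => h.2.2⟩) σ i₁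
    refine ⟨tr, σ', he, hnd, ?_, hgap⟩
    ext t
    rw [Set.mem_ofPred_eq, hmem]
    have hs := hp.sat σ.arr D (fun a ha hd => i₂ a (mem_dl.2 ⟨ha, hd⟩)) (fun g hg l => by
      rw [i₃ g hg]
      refine exists_congr fun ν => and_congr_left fun _ => forall₂_congr fun a ha => ?_
      rw [i₄ _ ((hp.group_atoms g hg).2 a ha).2])
    constructor
    · rintro ⟨μ, -, h, rfl⟩
      obtain ⟨ν, h₁, h₂⟩ := (hs μ).1 h
      exact ⟨ν, h₂, Plan.map_congr_of_agree fun x hx =>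
        (h₁ x (.inr (List.mem_toFinset.2 hx))).symm⟩
    · rintro ⟨ν, h, rfl⟩
      exact ⟨ν, fun y hy => (List.not_mem_nil (hp.fv hy)).elim,
        (hs ν).2 ⟨ν, fun _ _ => rfl, h⟩, rfl⟩

end wellBehaved

/-! ### The size bound for query results -/

section sizeBound

/-- A form of Hölder's inequality with weights of sum at least `1`, by the inequality of weighted
arithmetic and geometric means. -/
theorem sum_prod_rpow_le {ι κ : Type*} {E E' : Finset ι} {s : Finset κ} (hE : E' ⊆ E)
    {w C : ι → ℝ} {c : ι → κ → ℝ} (hw : ∀ a ∈ E, 0 ≤ w a) (hw1 : 1 ≤ ∑ a ∈ E', w a)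
    (hc : ∀ a ∈ E, ∀ v ∈ s, 0 ≤ c a v) (hcC : ∀ a ∈ E, ∀ v ∈ s, c a v ≤ C a)
    (hC : ∀ a ∈ E, 0 ≤ C a) (hsum : ∀ a ∈ E', ∑ v ∈ s, c a v ≤ C a) :
    ∑ v ∈ s, ∏ a ∈ E, c a v ^ w a ≤ ∏ a ∈ E, C a ^ w a := by
  set W := ∑ a ∈ E', w a with hW
  have hWpos : 0 < W := by linarith
  have q0 : ∀ a ∈ E, ∀ v ∈ s, 0 ≤ c a v / C a := fun a ha v hv =>
    div_nonneg (hc a ha v hv) (hC a ha)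
  have q1 : ∀ a ∈ E, ∀ v ∈ s, c a v / C a ≤ 1 := fun a ha v hv =>
    div_le_one_of_le₀ (hcC a ha v hv) (hC a ha)
  have hpos : 0 ≤ ∏ a ∈ E, C a ^ w a :=
    Finset.prod_nonneg fun a ha => Real.rpow_nonneg (hC a ha) _
  -- The quotients `c a v / C a` are at most `1`. Hence factors outside `E'` may be dropped and the weights
  -- in `E'` may be lowered to have sum `1`.
  have term : ∀ v ∈ s, ∏ a ∈ E, c a v ^ w a ≤
      (∏ a ∈ E, C a ^ w a) * ∑ a ∈ E', w a / W * (c a v / C a) := by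
    intro v hv
    calc ∏ a ∈ E, c a v ^ w a ≤ ∏ a ∈ E, C a ^ w a * (c a v / C a) ^ w a := by
          refine Finset.prod_le_prod (fun a ha => Real.rpow_nonneg (hc a ha v hv) _)
            fun a ha => ?_
          -- the quotient is a junk value for `C a = 0`, but then `c a v = 0` as well
          by_cases h0 : C a = 0
          · have hc0 : c a v = 0 := le_antisymm (h0 ▸ hcC a ha v hv) (hc a ha v hv)
            by_cases hw0 : w a = 0
            · simp [hw0]
            · simp [hc0, h0, Real.zero_rpow hw0]
          · rw [← Real.mul_rpow (hC a ha) (q0 a ha v hv), mul_div_cancel₀ _ h0]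
      _ = (∏ a ∈ E, C a ^ w a) * ∏ a ∈ E, (c a v / C a) ^ w a := Finset.prod_mul_distrib
      _ ≤ (∏ a ∈ E, C a ^ w a) * ∏ a ∈ E', (c a v / C a) ^ w a := by
          refine mul_le_mul_of_nonneg_left ?_ hpos
          refine Finset.prod_le_prod_of_subset_of_le_one hE
            (fun a ha => Real.rpow_nonneg (q0 a ha v hv) _)
            fun a ha _ => Real.rpow_le_one (q0 a ha v hv) (q1 a ha v hv) (hw a ha)
      _ ≤ (∏ a ∈ E, C a ^ w a) * ∏ a ∈ E', (c a v / C a) ^ (w a / W) := by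
          refine mul_le_mul_of_nonneg_left (Finset.prod_le_prod
            (fun a ha => Real.rpow_nonneg (q0 a (hE ha) v hv) _) fun a ha => ?_) hpos
          exact Real.rpow_le_rpow_of_exponent_ge' (q0 a (hE ha) v hv) (q1 a (hE ha) v hv)
            (div_nonneg (hw a (hE ha)) hWpos.le) (div_le_self (hw a (hE ha)) hw1)
      _ ≤ _ := by
          refine mul_le_mul_of_nonneg_left (Real.geom_mean_le_arith_mean_weighted _ _ _
            (fun a ha => div_nonneg (hw a (hE ha)) hWpos.le) ?_
            fun a ha => q0 a (hE ha) v hv) hpos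
          rw [← Finset.sum_div, div_self hWpos.ne']
  refine (Finset.sum_le_sum term).trans ?_
  rw [← Finset.mul_sum]
  refine mul_le_of_le_one_right hpos ?_
  rw [Finset.sum_comm]
  calc ∑ a ∈ E', ∑ v ∈ s, w a / W * (c a v / C a) ≤ ∑ a ∈ E', w a / W := by
        refine Finset.sum_le_sum fun a ha => ?_
        rw [← Finset.mul_sum, ← Finset.sum_div]
        exact mul_le_of_le_one_right (div_nonneg (hw a (hE ha)) hWpos.le)
          (div_le_one_of_le₀ (hsum a ha) (hC a (hE ha)))
    _ = 1 := by rw [← Finset.sum_div, div_self hWpos.ne']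

variable {S : Schema}

/-- The bound of Atserias, Grohe and Marx for the number of valuations that satisfy a set of atoms, by
induction on the number of variables: one fixes the value of a variable and sums up over all its
values with Hölder's inequality. -/
theorem card_le_prod_rpow {E : Finset (Atom S)} {w : Atom S → ℝ} (hw : ∀ a ∈ E, 0 ≤ w a)
    (X : Finset ℕ) (hX : ∀ x ∈ X, 1 ≤ ∑ a ∈ E.filter (fun a => x ∈ a.vars), w a)
    (J : Finset (ℕ → ℕ)) (R : (a : Atom S) → Finset (S.Tuple a.rel))
    (hJ : ∀ ν ∈ J, ∀ ν' ∈ J, (∀ x ∈ X, ν x = ν' x) → ν = ν')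
    (hR : ∀ ν ∈ J, ∀ a ∈ E, (fun j => ν (a.args j)) ∈ R a) :
    (J.card : ℝ) ≤ ∏ a ∈ E, ((R a).card : ℝ) ^ w a := by
  classical
  induction X using Finset.induction_on generalizing J R with
  | empty =>
    have h1 : J.card ≤ 1 := Finset.card_le_one.2 fun ν hν ν' hν' => hJ ν hν ν' hν' (by simp)
    rcases J.eq_empty_or_nonempty with rfl | ⟨ν, hν⟩
    · simpa using Finset.prod_nonneg fun a _ => Real.rpow_nonneg (Nat.cast_nonneg _) _
    · refine (Nat.cast_le_one.2 h1).trans ?_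
      rw [← Finset.prod_const_one (s := E)]
      refine Finset.prod_le_prod (fun _ _ => zero_le_one) fun a ha => ?_
      exact Real.one_le_rpow (Nat.one_le_cast.2 (Finset.card_pos.2 ⟨_, hR ν hν a ha⟩)) (hw a ha)
  | insert x X hx ih =>
    simp only [Finset.mem_insert, forall_eq_or_imp] at hX hJ
    -- the tuples that assign `v` to `x`; for an atom that does not contain `x`, these are all tuples
    set R' : ℕ → (a : Atom S) → Finset (S.Tuple a.rel) := fun v a =>
      (R a).filter fun t => ∀ j, a.args j = x → t j = v with hR'
    have hsplit : J.card = ∑ v ∈ J.image (· x), (J.filter fun ν => ν x = v).card :=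
      Finset.card_eq_sum_card_image _ _
    rw [hsplit, Nat.cast_sum]
    refine (Finset.sum_le_sum fun v _ => ih hX.2 (J.filter fun ν => ν x = v) (R' v) ?_ ?_).trans
      (sum_prod_rpow_le (E' := E.filter fun a => x ∈ a.vars) (Finset.filter_subset _ _) hw hX.1
        (fun _ _ _ _ => Nat.cast_nonneg _)
        (fun a _ v _ => Nat.cast_le.2 (Finset.card_le_card (Finset.filter_subset _ _)))
        (fun _ _ => Nat.cast_nonneg _) fun a ha => ?_)
    · intro ν hν ν' hν' h
      rw [Finset.mem_filter] at hν hν'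
      exact hJ ν hν.1 ν' hν'.1 ⟨hν.2.trans hν'.2.symm, h⟩
    · intro ν hν a ha
      rw [Finset.mem_filter] at hν
      refine Finset.mem_filter.2 ⟨hR ν hν.1 a ha, fun j hj => ?_⟩
      dsimp only
      rw [hj, hν.2]
    · obtain ⟨j, hj⟩ := Atom.mem_vars_iff.1 (Finset.mem_filter.1 ha).2
      rw [← Nat.cast_sum, Nat.cast_le, ← Finset.card_biUnion]
      · exact Finset.card_le_card (Finset.biUnion_subset.2 fun v _ => Finset.filter_subset _ _)
      · intro v _ v' _ hv
        refine Finset.disjoint_left.2 fun t ht ht' => hv ?_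
        rw [← (Finset.mem_filter.1 ht).2 j hj, (Finset.mem_filter.1 ht').2 j hj]

namespace CQ

theorem mem_vars {Q : CQ S} {x : ℕ} : x ∈ Q.vars ↔ ∃ a ∈ Q.body, x ∈ a.vars := by
  simp [vars]

/-- The values of the linear program of fractional edge covers. -/
def coverValues (Q : CQ S) : Set ℝ :=
  {s | ∃ w, Q.IsFractionalEdgeCover Q.vars w ∧ s = ∑ a ∈ Q.body, w a}

theorem coverValues_nonempty (Q : CQ S) : Q.coverValues.Nonempty := by
  refine ⟨_, fun _ => 1, ⟨fun _ _ => ⟨zero_le_one, le_rfl⟩, fun x hx => ?_⟩, rfl⟩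
  obtain ⟨a, ha, hxa⟩ := mem_vars.1 hx
  rw [Finset.sum_const, nsmul_eq_mul, mul_one, Nat.one_le_cast]
  exact Finset.card_pos.2 ⟨a, Finset.mem_filter.2 ⟨ha, hxa⟩⟩

theorem coverValues_nonneg (Q : CQ S) : ∀ s ∈ Q.coverValues, 0 ≤ s := by
  rintro _ ⟨w, hw, rfl⟩
  exact Finset.sum_nonneg fun a ha => (hw.1 a ha).1

theorem rhoStar_nonneg (Q : CQ S) : 0 ≤ Q.rhoStar :=
  le_csInf Q.coverValues_nonempty Q.coverValues_nonneg

theorem one_le_rhoStar {Q : CQ S} {x : ℕ} (hx : x ∈ Q.vars) : 1 ≤ Q.rhoStar := by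
  refine le_csInf Q.coverValues_nonempty ?_
  rintro _ ⟨w, hw, rfl⟩
  exact (hw.2 x hx).trans (Finset.sum_le_sum_of_subset_of_nonneg (Finset.filter_subset _ _)
    fun a ha _ => (hw.1 a ha).1)

/-- The integral size bound for the results of the static sub-query. -/
noncomputable def sizeBound (Q : CQ S) (N : ℕ) : ℕ := ⌈(N : ℝ) ^ Q.stat.rhoStar⌉₊

theorem mem_stat_body {Q : CQ S} {a : Atom S} :
    a ∈ Q.stat.body ↔ a ∈ Q.body ∧ S.isDyn a.rel = false := by
  simp [stat, sub]

theorem mem_dyn_body {Q : CQ S} {a : Atom S} :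
    a ∈ Q.dyn.body ↔ a ∈ Q.body ∧ S.isDyn a.rel = true := by
  simp [dyn, sub]

theorem _root_.Database.card_le_staticSize (D : Database S) {r : Fin S.numRel}
    (hr : S.isDyn r = false) : (D r).card ≤ D.staticSize :=
  Finset.single_le_sum (f := fun r => (D r).card) (fun _ _ => Nat.zero_le _)
    (Finset.mem_filter.2 ⟨Finset.mem_univ r, hr⟩)

/-- The relations of the static atoms do not exceed the size bound. -/
theorem card_le_sizeBound {Q : CQ S} (D : Database S) {a : Atom S} (ha : a ∈ Q.body)
    (hd : S.isDyn a.rel = false) : (D a.rel).card ≤ Q.sizeBound D.staticSize := by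
  have hN := D.card_le_staticSize hd
  by_cases h0 : (D a.rel).card = 0
  · simp [h0]
  have hN1 : (1 : ℝ) ≤ D.staticSize := by
    rw [Nat.one_le_cast]
    omega
  refine Nat.cast_le.1 (le_trans ?_ (Nat.le_ceil _) : ((D a.rel).card : ℝ) ≤ _)
  by_cases hv : ∃ x, x ∈ a.vars
  · obtain ⟨x, hx⟩ := hv
    have := one_le_rhoStar (mem_vars.2 ⟨a, mem_stat_body.2 ⟨ha, hd⟩, hx⟩)
    calc ((D a.rel).card : ℝ) ≤ (D.staticSize : ℝ) ^ (1 : ℝ) := by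
          rw [Real.rpow_one]
          exact Nat.cast_le.2 hN
      _ ≤ _ := Real.rpow_le_rpow_of_exponent_le hN1 this
  · have : (D a.rel).card ≤ 1 := Finset.card_le_one.2 fun t _ t' _ => funext fun j =>
      (hv ⟨_, a.args_mem_vars j⟩).elim
    exact (Nat.cast_le_one.2 this).trans (Real.one_le_rpow hN1 Q.stat.rhoStar_nonneg)

/-- The number of different values `key ν`, where `ν` ranges over the matches of the static sub-query,
does not exceed the size bound. -/
theorem card_image_le_sizeBound {Q : CQ S} (D : Database S) {α : Type*} {key : (ℕ → ℕ) → α}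
    (hkey : ∀ ν ν' : ℕ → ℕ, (∀ x ∈ Q.stat.vars, ν x = ν' x) → key ν = key ν') {s : Finset α}
    (hs : ∀ k ∈ s, ∃ ν : ℕ → ℕ, (∀ a ∈ Q.stat.body, (fun j => ν (a.args j)) ∈ D a.rel) ∧
      key ν = k) : s.card ≤ Q.sizeBound D.staticSize := by
  classical
  choose! f hf hfk using hs
  have hinj : Set.InjOn f s := fun k hk k' hk' h => by rw [← hfk k hk, h, hfk k' hk']
  rw [← Finset.card_image_of_injOn hinj]
  -- the bound for every fractional edge cover
  have main : ∀ t ∈ Q.stat.coverValues, ((s.image f).card : ℝ) ≤ (D.staticSize : ℝ) ^ t := by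
    rintro _ ⟨w, hw, rfl⟩
    by_cases h0 : D.staticSize = 0
    · rcases Q.stat.body.eq_empty_or_nonempty with he | ⟨a, ha⟩
      · have : s.card ≤ 1 := Finset.card_le_one.2 fun k hk k' hk' => by
          rw [← hfk k hk, ← hfk k' hk']
          exact hkey _ _ fun x hx => by
            obtain ⟨a, ha, -⟩ := mem_vars.1 hx
            simp [he] at ha
        rw [he, Finset.sum_empty, Real.rpow_zero]
        exact Nat.cast_le_one.2 (Finset.card_image_le.trans this)
      · have he : s = ∅ := by
          refine Finset.eq_empty_of_forall_notMem fun k hk => ?_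
          have h₁ := Finset.card_pos.2 ⟨_, hf k hk a ha⟩
          have h₂ := D.card_le_staticSize (mem_stat_body.1 ha).2
          omega
        simp only [he, Finset.image_empty, Finset.card_empty, Nat.cast_zero]
        exact Real.rpow_nonneg (Nat.cast_nonneg _) _
    · have hpos : (0 : ℝ) < D.staticSize := Nat.cast_pos.2 (Nat.pos_of_ne_zero h0)
      refine (card_le_prod_rpow (E := Q.stat.body) (fun a ha => (hw.1 a ha).1) Q.stat.vars hw.2
        (s.image f) (fun a => D a.rel) ?_ ?_).trans ?_
      · intro ν hν ν' hν' h
        obtain ⟨k, hk, rfl⟩ := Finset.mem_image.1 hν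
        obtain ⟨k', hk', rfl⟩ := Finset.mem_image.1 hν'
        rw [← hfk k hk, hkey _ _ h, hfk k' hk']
      · intro ν hν a ha
        obtain ⟨k, hk, rfl⟩ := Finset.mem_image.1 hν
        exact hf k hk a ha
      · rw [Real.rpow_sum_of_pos hpos]
        exact Finset.prod_le_prod (fun a _ => Real.rpow_nonneg (Nat.cast_nonneg _) _) fun a ha =>
          Real.rpow_le_rpow (Nat.cast_nonneg _)
            (Nat.cast_le.2 (D.card_le_staticSize (mem_stat_body.1 ha).2)) (hw.1 a ha).1
  refine Nat.cast_le.1 (le_trans ?_ (Nat.le_ceil _) : ((s.image f).card : ℝ) ≤ _)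
  by_cases h0 : D.staticSize = 0
  · by_cases hρ : Q.stat.rhoStar = 0
    · obtain ⟨t, ht⟩ := Q.stat.coverValues_nonempty
      rw [hρ, Real.rpow_zero]
      refine (main t ht).trans ?_
      rw [h0, Nat.cast_zero]
      exact Real.zero_rpow_le_one t
    · have hpos := lt_of_le_of_ne Q.stat.rhoStar_nonneg (Ne.symm hρ)
      obtain ⟨t, ht⟩ := Q.stat.coverValues_nonempty
      have : Q.stat.rhoStar ≤ t := csInf_le ⟨0, Q.stat.coverValues_nonneg⟩ ht
      have h := main t ht
      rw [h0, Nat.cast_zero, Real.zero_rpow (by linarith)] at h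
      rwa [h0, Nat.cast_zero, Real.zero_rpow hρ]
  · have hpos : (0 : ℝ) < D.staticSize := Nat.cast_pos.2 (Nat.pos_of_ne_zero h0)
    -- the fractional edge cover number is an infimum, and the bound is preserved in the limit
    have hcl : IsClosed {t : ℝ | ((s.image f).card : ℝ) ≤ (D.staticSize : ℝ) ^ t} :=
      isClosed_le continuous_const (Real.continuous_const_rpow hpos.ne')
    exact closure_minimal main hcl
      (csInf_mem_closure Q.stat.coverValues_nonempty ⟨0, Q.stat.coverValues_nonneg⟩)

/-- A running time that is at most exponential in the size bound has the form required. -/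
theorem exists_time_bound (Q : CQ S) {f : ℕ → ℕ} (hf : ExpBdd f) :
    ∃ p : ℕ → ℕ, (fun N => (p N : ℝ)) =O[atTop] (fun N : ℕ => (N : ℝ) ^ Q.stat.rhoStar) ∧
      ∀ N, f (Q.sizeBound N) ≤ 2 ^ p N * p N ^ 2 := by
  obtain ⟨C, hC⟩ := hf
  refine ⟨fun N => (C + 1) * (Q.sizeBound N + 1), ?_, fun N => ?_⟩
  · refine .of_bound ((C + 1) * 3) (eventually_atTop.2 ⟨1, fun N hN => ?_⟩)
    have hN1 : (1 : ℝ) ≤ N := Nat.one_le_cast.2 hN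
    have h1 := Real.one_le_rpow hN1 Q.stat.rhoStar_nonneg
    have h2 : (Q.sizeBound N : ℝ) ≤ (N : ℝ) ^ Q.stat.rhoStar + 1 :=
      (Nat.ceil_lt_add_one (by linarith)).le
    rw [Real.norm_of_nonneg (Nat.cast_nonneg _), Real.norm_of_nonneg (by linarith)]
    push_cast
    rw [mul_assoc]
    exact mul_le_mul_of_nonneg_left (by linarith) (by positivity)
  · refine (hC _).trans ?_
    refine (Nat.pow_le_pow_right two_pos
      (Nat.mul_le_mul_right (Q.sizeBound N + 1) C.le_succ)).trans (Nat.le_mul_of_pos_right _ ?_)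
    positivity

end CQ

end sizeBound

/-! ### Weights of the relevant dynamic tuples -/

section states

variable {S : Schema} {b : ℕ}

theorem testBit_sum_two_pow (F : Finset ℕ) (j : ℕ) :
    (∑ i ∈ F, 2 ^ i).testBit j = true ↔ j ∈ F := by
  induction F using Finset.induction_on_max with
  | empty => simp
  | insert a s hs ih =>
    have ha : a ∉ s := fun h => (hs a h).false
    have hlt : ∑ i ∈ s, 2 ^ i < 2 ^ a := Nat.geomSum_lt le_rfl hs
    rw [Finset.sum_insert ha, ← Nat.mul_one (2 ^ a), Nat.testBit_two_pow_mul_add _ hlt,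
      Finset.mem_insert]
    split_ifs with hj
    · rw [ih]
      exact ⟨.inr, fun h => h.resolve_left hj.ne⟩
    · rw [Nat.testBit_one_eq_true_iff_self_eq_zero]
      constructor
      · intro h
        left
        omega
      · rintro (h | h)
        · omega
        · exact (hj (hs j h)).elim

/-- The name of the relation and the tuple that a valuation assigns to an atom. -/
def Atom.entry (a : Atom S) (ν : ℕ → ℕ) : ℕ × List ℕ := (a.rel, (List.ofFn a.args).map ν)

theorem Atom.entry_congr {a : Atom S} {ν ν' : ℕ → ℕ} (h : ∀ j, ν (a.args j) = ν' (a.args j)) :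
    a.entry ν = a.entry ν' := by
  simp only [entry, List.map_ofFn, Prod.mk.injEq, true_and]
  exact congrArg List.ofFn (funext h)

/-- The entries `W` are numbered by `idx`; the array `weight` holds the corresponding powers of two, and
`0` for all other entries. -/
structure IsNumbering (b : ℕ) (W : Finset (ℕ × List ℕ)) (idx : ℕ × List ℕ → ℕ)
    (m : ℕ → List ℕ → ℕ) : Prop where
  inj : Set.InjOn idx W
  lt : ∀ e ∈ W, idx e < W.card
  weight : ∀ r l, (r, l) ∈ W → m ((Ar.weight r).code b) l = 2 ^ idx (r, l)
  weight_zero : ∀ r l, (r, l) ∉ W → m ((Ar.weight r).code b) l = 0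
  half : ∀ i < W.card, m (Ar.half.code b) [2 ^ (i + 1)] = 2 ^ i

theorem IsNumbering.congr {W : Finset (ℕ × List ℕ)} {idx : ℕ × List ℕ → ℕ}
    {m m' : ℕ → List ℕ → ℕ} (h : IsNumbering b W idx m)
    (hw : ∀ r, m' ((Ar.weight r).code b) = m ((Ar.weight r).code b))
    (hh : m' (Ar.half.code b) = m (Ar.half.code b)) : IsNumbering b W idx m' :=
  ⟨h.inj, h.lt, fun r l => hw r ▸ h.weight r l, fun r l => hw r ▸ h.weight_zero r l,
    fun i hi => hh ▸ h.half i hi⟩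

/-- Assign the next power of two, which is in register `top`, to the entry of the atom, unless it has
a weight. -/
def weightCode (b : ℕ) (a : Atom S) : Prog :=
  .load (Rg.tmp₁.code b) ((Ar.weight a.rel).code b) (vregs b (List.ofFn a.args)) ;;
  .ite (Rg.tmp₁.code b) (Rg.one.code b)
    (.store ((Ar.weight a.rel).code b) (vregs b (List.ofFn a.args)) (Rg.top.code b) ;;
      .add (Rg.tmp₂.code b) (Rg.top.code b) (Rg.top.code b) ;;
      .store (Ar.half.code b) [Rg.tmp₂.code b] (Rg.top.code b) ;;
      .const (Rg.tmp₁.code b) 0 ;;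
      .add (Rg.top.code b) (Rg.tmp₂.code b) (Rg.tmp₁.code b))
    (skipCode b)

/-- Assign weights to the entries of a list of atoms. -/
def weightCodes (b : ℕ) : List (Atom S) → Prog
  | [] => skipCode b
  | a :: l => weightCode b a ;; weightCodes b l

theorem weightCodes_simple (l : List (Atom S)) : (weightCodes b l).Simple := by
  induction l with
  | nil => trivial
  | cons a l ih => exact ⟨⟨trivial, ⟨trivial, trivial, trivial, trivial, trivial⟩, trivial⟩, ih⟩

theorem weightCodes_writes {l : List (Atom S)} {y : ℕ} (h : (weightCodes b l).Writes y) :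
    y = Rg.tmp₁.code b ∨ y = Rg.tmp₂.code b ∨ y = Rg.top.code b := by
  induction l with
  | nil => exact .inl h
  | cons a l ih =>
    simp only [weightCodes, weightCode, Prog.Writes, skipCode] at h
    tauto

theorem weightCodes_stores {l : List (Atom S)} {A : ℕ} (h : (weightCodes b l).Stores A) :
    (∃ r, A = (Ar.weight r).code b) ∨ A = Ar.half.code b := by
  induction l with
  | nil => exact h.elim
  | cons a l ih =>
    simp only [weightCodes, weightCode, Prog.Stores, skipCode, false_or, or_false] at h
    rcases h with (h | h) | h
    · exact .inl ⟨_, h⟩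
    · exact .inr h
    · exact ih h

theorem weightCode_eval {a : Atom S} {σ : Mem} {W : Finset (ℕ × List ℕ)} {idx : ℕ × List ℕ → ℕ}
    (h1 : σ.reg (Rg.one.code b) = 1) (hW : IsNumbering b W idx σ.arr)
    (htop : σ.reg (Rg.top.code b) = 2 ^ W.card) :
    ∃ idx', IsNumbering b (insert (a.entry (σ.env b)) W) idx' ((weightCode b a).eval σ).arr ∧
      ((weightCode b a).eval σ).reg (Rg.top.code b) = 2 ^ (insert (a.entry (σ.env b)) W).card := by
  set e := a.entry (σ.env b) with he
  by_cases hmem : e ∈ W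
  · have hw : ¬ σ.arr ((Ar.weight a.rel).code b) ((List.ofFn a.args).map (σ.env b)) < 1 := by
      rw [hW.weight _ _ hmem]
      exact Nat.not_lt.2 Nat.one_le_two_pow
    have ev : (weightCode b a).eval σ = (skipCode b).eval (σ.setReg (Rg.tmp₁.code b)
        (σ.arr ((Ar.weight a.rel).code b) ((List.ofFn a.args).map (σ.env b)))) := by
      simp only [weightCode, Prog.eval, map_vregs, Mem.setReg_reg, if_true, Rg.code_inj,
        reduceCtorEq, if_false, h1, hw]
    rw [Finset.insert_eq_of_mem hmem, ev]
    exact ⟨idx, hW, by simpa [skipCode, Prog.eval] using htop⟩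
  · have hw : σ.arr ((Ar.weight a.rel).code b) ((List.ofFn a.args).map (σ.env b)) = 0 :=
      hW.weight_zero _ _ hmem
    have hcard : (insert e W).card = W.card + 1 := Finset.card_insert_of_notMem hmem
    have ev : ((weightCode b a).eval σ).reg (Rg.top.code b) = 2 ^ (W.card + 1) ∧
        (∀ r l, ((weightCode b a).eval σ).arr ((Ar.weight r).code b) l =
          if (r, l) = e then 2 ^ W.card else σ.arr ((Ar.weight r).code b) l) ∧
        ∀ l, ((weightCode b a).eval σ).arr (Ar.half.code b) l =
          if l = [2 ^ (W.card + 1)] then 2 ^ W.card else σ.arr (Ar.half.code b) l := by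
      have hp : 2 ^ W.card + 2 ^ W.card = 2 ^ (W.card + 1) := by ring
      simp [weightCode, Prog.eval, h1, hw, htop, hp, he, Atom.entry, -List.map_ofFn]
    obtain ⟨ev₁, ev₂, ev₃⟩ := ev
    refine ⟨Function.update idx e W.card, ⟨?_, ?_, ?_, ?_, ?_⟩, by rw [ev₁, hcard]⟩
    · have hne : ∀ e' ∈ W, e' ≠ e := fun e' h h' => hmem (h' ▸ h)
      intro e₁ h₁ e₂ h₂ h
      rcases Finset.mem_insert.1 h₁ with rfl | h₁ <;> rcases Finset.mem_insert.1 h₂ with rfl | h₂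
      · rfl
      · rw [Function.update_self, Function.update_of_ne (hne _ h₂)] at h
        have := hW.lt _ h₂
        omega
      · rw [Function.update_self, Function.update_of_ne (hne _ h₁)] at h
        have := hW.lt _ h₁
        omega
      · rw [Function.update_of_ne (hne _ h₁), Function.update_of_ne (hne _ h₂)] at h
        exact hW.inj h₁ h₂ h
    · intro e' h
      rw [hcard, Function.update_apply]
      split_ifs with hee
      · omega
      · have := hW.lt _ ((Finset.mem_insert.1 h).resolve_left hee)
        omega
    · intro r l h
      rw [ev₂, Function.update_apply]
      split_ifs with hee
      · rfl
      · exact hW.weight _ _ ((Finset.mem_insert.1 h).resolve_left hee)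
    · intro r l h
      rw [Finset.mem_insert, not_or] at h
      rw [ev₂, if_neg h.1]
      exact hW.weight_zero _ _ h.2
    · intro i hi
      rw [hcard] at hi
      rw [ev₃]
      rcases Nat.lt_succ_iff_lt_or_eq.1 hi with hi | rfl
      · rw [if_neg, hW.half i hi]
        simp only [List.cons.injEq, and_true]
        intro h
        have := Nat.pow_right_injective le_rfl h
        omega
      · rw [if_pos rfl]

theorem weightCodes_eval {l : List (Atom S)} {σ : Mem} {W : Finset (ℕ × List ℕ)}
    {idx : ℕ × List ℕ → ℕ} (h1 : σ.reg (Rg.one.code b) = 1) (hW : IsNumbering b W idx σ.arr)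
    (htop : σ.reg (Rg.top.code b) = 2 ^ W.card) :
    ∃ idx', IsNumbering b (W ∪ (l.map fun a => a.entry (σ.env b)).toFinset) idx'
        ((weightCodes b l).eval σ).arr ∧
      ((weightCodes b l).eval σ).reg (Rg.top.code b) =
        2 ^ (W ∪ (l.map fun a => a.entry (σ.env b)).toFinset).card := by
  induction l generalizing σ W idx with
  | nil => exact ⟨idx, by simpa [weightCodes, skipCode, Prog.eval] using hW,
      by simpa [weightCodes, skipCode, Prog.eval] using htop⟩
  | cons a l ih =>
    have hs := (weightCodes_simple (b := b) [a]).1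
    obtain ⟨idx₁, hW₁, ht₁⟩ := weightCode_eval (a := a) h1 hW htop
    have keep : ∀ r : Rg, r ≠ .tmp₁ → r ≠ .tmp₂ → r ≠ .top →
        ((weightCode b a).eval σ).reg (r.code b) = σ.reg (r.code b) := fun r h₁ h₂ h₃ =>
      hs.eval_reg σ fun h => by
        have := weightCodes_writes (l := [a]) (b := b) (.inl h)
        simp only [Rg.code_inj] at this
        tauto
    have he : ((weightCode b a).eval σ).env b = σ.env b :=
      funext fun x => keep _ (by simp) (by simp) (by simp)
    obtain ⟨idx₂, h₂⟩ := ih (σ := (weightCode b a).eval σ)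
      ((keep .one (by simp) (by simp) (by simp)).trans h1) hW₁ ht₁
    refine ⟨idx₂, ?_⟩
    rw [he] at h₂
    have : W ∪ ((a :: l).map fun a => a.entry (σ.env b)).toFinset =
        insert (a.entry (σ.env b)) W ∪ (l.map fun a => a.entry (σ.env b)).toFinset := by
      rw [List.map_cons, List.toFinset_cons, Finset.union_insert, Finset.insert_union]
    rw [this]
    exact h₂

/-- Write the binary digits of the number in the register of the variable `x` into the array `digit`,
which is indexed by powers of two. -/
def decodeCode (b x : ℕ) : Prog :=
  .const (Rg.tmp₂.code b) 0 ;;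
  .add ((Rg.idx 0).code b) ((Rg.var x).code b) (Rg.tmp₂.code b) ;;
  .add ((Rg.bnd 0).code b) (Rg.top.code b) (Rg.tmp₂.code b) ;;
  .whl (Rg.one.code b) ((Rg.bnd 0).code b)
    (.load ((Rg.bnd 0).code b) (Ar.half.code b) [(Rg.bnd 0).code b] ;;
      .ite ((Rg.idx 0).code b) ((Rg.bnd 0).code b)
        (.store (Ar.digit.code b) [(Rg.bnd 0).code b] (Rg.tmp₂.code b))
        (.sub ((Rg.idx 0).code b) ((Rg.idx 0).code b) ((Rg.bnd 0).code b) ;;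
          .store (Ar.digit.code b) [(Rg.bnd 0).code b] (Rg.one.code b)))

theorem decodeCode_writes {x y : ℕ} (h : (decodeCode b x).Writes y) :
    y = Rg.tmp₂.code b ∨ y = (Rg.idx 0).code b ∨ y = (Rg.bnd 0).code b := by
  simp only [decodeCode, Prog.Writes] at h
  tauto

theorem decodeCode_stores {x A : ℕ} (h : (decodeCode b x).Stores A) : A = Ar.digit.code b := by
  simp only [decodeCode, Prog.Stores] at h
  tauto

theorem decodeCode_exec {x n s : ℕ} {σ : Mem} (h1 : σ.reg (Rg.one.code b) = 1)
    (hs : σ.env b x = s) (hsn : s < 2 ^ n) (htop : σ.reg (Rg.top.code b) = 2 ^ n)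
    (hhalf : ∀ i < n, σ.arr (Ar.half.code b) [2 ^ (i + 1)] = 2 ^ i) :
    ∃ tr σ', (decodeCode b x).Exec σ tr σ' ∧ tr.length ≤ 9 * n + 8 ∧
      ∀ i < n, σ'.arr (Ar.digit.code b) [2 ^ i] = if s.testBit i then 1 else 0 := by
  -- the loop, when the digits from number `k` on have been written and the others remain
  have key : ∀ (k : ℕ) (σ : Mem), k ≤ n → σ.reg (Rg.one.code b) = 1 →
      σ.reg (Rg.tmp₂.code b) = 0 → σ.reg ((Rg.idx 0).code b) = s % 2 ^ k →
      σ.reg ((Rg.bnd 0).code b) = 2 ^ k →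
      (∀ i < n, σ.arr (Ar.half.code b) [2 ^ (i + 1)] = 2 ^ i) →
      (∀ i < n, k ≤ i → σ.arr (Ar.digit.code b) [2 ^ i] = if s.testBit i then 1 else 0) →
      ∃ tr σ', (Prog.whl (Rg.one.code b) ((Rg.bnd 0).code b)
        (.load ((Rg.bnd 0).code b) (Ar.half.code b) [(Rg.bnd 0).code b] ;;
        .ite ((Rg.idx 0).code b) ((Rg.bnd 0).code b)
          (.store (Ar.digit.code b) [(Rg.bnd 0).code b] (Rg.tmp₂.code b))
          (.sub ((Rg.idx 0).code b) ((Rg.idx 0).code b) ((Rg.bnd 0).code b) ;;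
            .store (Ar.digit.code b) [(Rg.bnd 0).code b] (Rg.one.code b)))).Exec σ tr σ' ∧
        tr.length ≤ 9 * k + 1 ∧
        ∀ i < n, σ'.arr (Ar.digit.code b) [2 ^ i] = if s.testBit i then 1 else 0 := by
    intro k
    induction k with
    | zero =>
      intro σ _ h1 _ _ hb _ hd
      exact ⟨_, _, .whl_neg (by rw [h1, hb]; simp), by simp, fun i hi => hd i hi (Nat.zero_le i)⟩
    | succ k ih =>
      intro σ hk h1 h2 hi hb hh hd
      set body : Prog := .load ((Rg.bnd 0).code b) (Ar.half.code b) [(Rg.bnd 0).code b] ;;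
        .ite ((Rg.idx 0).code b) ((Rg.bnd 0).code b)
          (.store (Ar.digit.code b) [(Rg.bnd 0).code b] (Rg.tmp₂.code b))
          (.sub ((Rg.idx 0).code b) ((Rg.idx 0).code b) ((Rg.bnd 0).code b) ;;
            .store (Ar.digit.code b) [(Rg.bnd 0).code b] (Rg.one.code b)) with hbody
      have hbs : body.Simple := ⟨trivial, trivial, trivial, trivial⟩
      obtain ⟨m, hm, he⟩ := hbs.exec σ
      have hm7 : m ≤ 7 := hm.trans (by simp [hbody, Prog.size])
      have hbit : s.testBit k = true ↔ s / 2 ^ k % 2 = 1 := by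
        rw [Nat.testBit_eq_decide_div_mod_eq, decide_eq_true_iff]
      have hmod : s % 2 ^ (k + 1) = s % 2 ^ k + 2 ^ k * (s / 2 ^ k % 2) := Nat.mod_pow_succ
      have hlt : s % 2 ^ k < 2 ^ k := Nat.mod_lt _ (by positivity)
      have hdig : s / 2 ^ k % 2 = 0 ∨ s / 2 ^ k % 2 = 1 := by omega
      have ev : (body.eval σ).reg ((Rg.idx 0).code b) = s % 2 ^ k ∧
          (body.eval σ).reg ((Rg.bnd 0).code b) = 2 ^ k ∧
          ∀ l, (body.eval σ).arr (Ar.digit.code b) l =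
            if l = [2 ^ k] then (if s.testBit k then 1 else 0)
            else σ.arr (Ar.digit.code b) l := by
        rcases hdig with h0 | h0
        · have hb0 : s.testBit k = false := by
            rw [← Bool.not_eq_true, hbit]
            omega
          rw [h0, Nat.mul_zero, Nat.add_zero] at hmod
          simp [hbody, Prog.eval, hb, hi, hh k (by omega), h2, hmod, hlt, hb0]
        · rw [h0, Nat.mul_one] at hmod
          simp [hbody, Prog.eval, hb, hi, hh k (by omega), h1, hmod, hbit.2 h0]
      obtain ⟨ev₁, ev₂, ev₃⟩ := ev
      have hr : ∀ r : Rg, r ≠ .idx 0 → r ≠ .bnd 0 →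
          (body.eval σ).reg (r.code b) = σ.reg (r.code b) := fun r h₁ h₂ =>
        hbs.eval_reg σ (by simp [hbody, Prog.Writes, h₁, h₂])
      have ha : (body.eval σ).arr (Ar.half.code b) = σ.arr (Ar.half.code b) :=
        hbs.eval_arr σ (by simp [hbody, Prog.Stores])
      obtain ⟨tr, σ', e', hl, hd'⟩ := ih (body.eval σ) (by omega)
        ((hr .one (by simp) (by simp)).trans h1) ((hr .tmp₂ (by simp) (by simp)).trans h2)
        ev₁ ev₂ (fun i hi => by rw [ha, hh i hi]) (fun i hi hki => by
          rw [ev₃]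
          rcases hki.lt_or_eq with hki | rfl
          · rw [if_neg, hd i hi hki]
            simp only [List.cons.injEq, and_true]
            intro h
            have := Nat.pow_right_injective le_rfl h
            omega
          · rw [if_pos rfl])
      refine ⟨_, σ', .whl_pos ?_ he e', ?_, hd'⟩
      · rw [h1, hb]
        exact Nat.one_lt_two_pow (by omega)
      · simp only [List.length_cons, List.length_append, List.length_replicate]
        omega
  obtain ⟨tr, σ', e, hl, hd⟩ := key n
    (((σ.setReg (Rg.tmp₂.code b) 0).setReg ((Rg.idx 0).code b) s).setReg
      ((Rg.bnd 0).code b) (2 ^ n)) le_rfl (by simp [h1]) (by simp)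
    (by simp [Nat.mod_eq_of_lt hsn]) (by simp) hhalf (fun i hi hni => by omega)
  have e₀ := (Prog.Exec.const (Rg.tmp₂.code b) 0 σ)
  have e₁ := Prog.Exec.add ((Rg.idx 0).code b) ((Rg.var x).code b) (Rg.tmp₂.code b)
    (σ.setReg (Rg.tmp₂.code b) 0)
  have hs' : σ.reg ((Rg.var x).code b) = s := hs
  simp only [Mem.setReg_reg, Rg.code_inj, reduceCtorEq, if_false, if_true, hs', add_zero] at e₁
  have e₂ := Prog.Exec.add ((Rg.bnd 0).code b) (Rg.top.code b) (Rg.tmp₂.code b)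
    ((σ.setReg (Rg.tmp₂.code b) 0).setReg ((Rg.idx 0).code b) s)
  simp only [Mem.setReg_reg, Rg.code_inj, reduceCtorEq, if_false, if_true, htop, add_zero] at e₂
  refine ⟨_, σ', e₀.seq (e₁.seq (e₂.seq e)), ?_, hd⟩
  simp only [List.length_cons, List.length_append, List.length_nil]
  omega

/-- Run `body` if the digits of the weights of the entries of all atoms in the list are nonzero. -/
def digitCheck (b : ℕ) (body : Prog) : List (Atom S) → Prog
  | [] => body
  | a :: l => .load (Rg.tmp₁.code b) ((Ar.weight a.rel).code b) (vregs b (List.ofFn a.args)) ;;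
      .load (Rg.tmp₁.code b) (Ar.digit.code b) [Rg.tmp₁.code b] ;;
      .ite (Rg.tmp₁.code b) (Rg.one.code b) (skipCode b) (digitCheck b body l)

theorem digitCheck_simple {body : Prog} (hb : body.Simple) (l : List (Atom S)) :
    (digitCheck b body l).Simple := by
  induction l with
  | nil => exact hb
  | cons a l ih => exact ⟨trivial, trivial, trivial, ih⟩

theorem digitCheck_writes {body : Prog} {l : List (Atom S)} {y : ℕ}
    (h : (digitCheck b body l).Writes y) : body.Writes y ∨ y = Rg.tmp₁.code b := by
  induction l with
  | nil => exact .inl h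
  | cons a l ih =>
    simp only [digitCheck, Prog.Writes, skipCode] at h
    tauto

theorem digitCheck_stores {body : Prog} {l : List (Atom S)} {A : ℕ}
    (h : (digitCheck b body l).Stores A) : body.Stores A := by
  induction l with
  | nil => exact h
  | cons a l ih =>
    simp only [digitCheck, Prog.Stores, skipCode] at h
    tauto

theorem digitCheck_eval {body : Prog} {l : List (Atom S)} {σ : Mem}
    (h1 : σ.reg (Rg.one.code b) = 1) {P : ℕ × List ℕ → Prop}
    (hP : ∀ a ∈ l, σ.arr (Ar.digit.code b)
      [σ.arr ((Ar.weight a.rel).code b) ((List.ofFn a.args).map (σ.env b))] ≠ 0 ↔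
        P (a.entry (σ.env b))) :
    (∃ σ₁, σ.Near b (matchRegs ∅) σ₁ ∧ (digitCheck b body l).eval σ = body.eval σ₁ ∧
      ∀ a ∈ l, P (a.entry (σ.env b))) ∨
    σ.Near b (matchRegs ∅) ((digitCheck b body l).eval σ) ∧
      ¬ ∀ a ∈ l, P (a.entry (σ.env b)) := by
  induction l generalizing σ with
  | nil => exact .inl ⟨σ, .refl σ, rfl, by simp⟩
  | cons a l ih =>
    simp only [List.mem_cons, forall_eq_or_imp] at hP ⊢
    set v := σ.arr (Ar.digit.code b)
      [σ.arr ((Ar.weight a.rel).code b) ((List.ofFn a.args).map (σ.env b))] with hv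
    set σ₁ := (σ.setReg (Rg.tmp₁.code b)
      (σ.arr ((Ar.weight a.rel).code b) ((List.ofFn a.args).map (σ.env b)))).setReg
      (Rg.tmp₁.code b) v with hσ₁
    have n₁ : σ.Near b (matchRegs ∅) σ₁ := (Mem.near_setReg (by simp [matchRegs])).trans
      (Mem.near_setReg (by simp [matchRegs]))
    have env₁ : σ₁.env b = σ.env b := by simp [hσ₁]
    have ev : (digitCheck b body (a :: l)).eval σ =
        if v < 1 then (skipCode b).eval σ₁ else (digitCheck b body l).eval σ₁ := by
      simp [digitCheck, Prog.eval, h1, hv, hσ₁]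
    rw [ev]
    split_ifs with h
    · refine .inr ⟨n₁.trans (Mem.near_setReg (by simp [matchRegs])), fun h' => ?_⟩
      have := hP.1.2 h'.1
      omega
    · have hPa := hP.1.1 (by omega)
      rcases ih (σ := σ₁) (by simp [hσ₁, h1]) (by rw [env₁]; exact hP.2) with
        ⟨σ₂, i₁, i₂, i₃⟩ | ⟨i₁, i₂⟩ <;> rw [env₁] at *
      · exact .inl ⟨σ₂, n₁.trans i₁, i₂, hPa, i₃⟩
      · exact .inr ⟨n₁.trans i₁, fun h' => i₂ h'.2⟩

end states

/-! ### Tries of answers for all states -/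

section states

variable {S : Schema} {b : ℕ} {aid : Atom S → ℕ}

/-- Assign weights to all entries of the atoms `dl` in matches of the atoms `G`. -/
theorem weigh_exec (L : Listing S) (hb : S.numRel ≤ b) {G dl : List (Atom S)} (hG : G.Nodup)
    (hid : ∀ a ∈ G, ∀ a' ∈ G, aid a = aid a' → a = a')
    {B : ℕ} (hB : ∀ a ∈ G, (L.list a.rel).length ≤ B)
    (hdl : ∀ a ∈ dl, ∀ j, ∃ a' ∈ G, ∃ j', a'.args j' = a.args j) {σ : Mem}
    (h1 : σ.reg (Rg.one.code b) = 1) (htop : σ.reg (Rg.top.code b) = 1)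
    (hin : ∀ r < S.numRel, σ.arr r = L.initMem.arr r)
    (h0 : ∀ r l, σ.arr ((Ar.weight r).code b) l = 0) :
    ∃ tr σ', (matchAll b aid G (weightCodes b dl)).Exec σ tr σ' ∧
      tr.length ≤ nestCost B (matchAll b aid G (weightCodes b dl)).size G.length +
        (matchAll b aid G (weightCodes b dl)).size ∧
      σ'.reg (Rg.one.code b) = 1 ∧ (∀ r < S.numRel, σ'.arr r = L.initMem.arr r) ∧
      ∃ W idx, IsNumbering b W idx σ'.arr ∧ σ'.reg (Rg.top.code b) = 2 ^ W.card ∧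
        ∀ e, e ∈ W ↔ ∃ ν : ℕ → ℕ, (∀ a ∈ G, (fun j => ν (a.args j)) ∈ L.db a.rel) ∧
          ∃ a ∈ dl, e = a.entry ν := by
  have hkey : ∀ ν ν' : ℕ → ℕ, (∀ a ∈ G, ∀ j, ν (a.args j) = ν' (a.args j)) →
      (dl.map fun a => a.entry ν) = dl.map fun a => a.entry ν' := fun ν ν' h =>
    List.map_congr_left fun a ha => Atom.entry_congr fun j => by
      obtain ⟨a', ha', j', hj⟩ := hdl a ha j
      rw [← hj]
      exact h a' ha' j'
  obtain ⟨tr, σ', he, hl, i₁, i₂, W, idx, i₃, i₄, i₅⟩ := matchAll_exec (b := b) (aid := aid) L hG hid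
    (weightCodes_simple dl)
    (fun r hr => by
      have := weightCodes_writes hr
      rw [Rg.code_inj, Rg.code_inj, Rg.code_inj] at this
      rcases this with rfl | rfl | rfl <;> simp)
    hB (key := fun ν => dl.map fun a => a.entry ν)
    (fun s σ => σ.reg (Rg.one.code b) = 1 ∧ (∀ r < S.numRel, σ.arr r = L.initMem.arr r) ∧
      ∃ W idx, IsNumbering b W idx σ.arr ∧ σ.reg (Rg.top.code b) = 2 ^ W.card ∧
        ∀ e, e ∈ W ↔ ∃ k ∈ s, e ∈ k)
    (X := Set.univ) (fun _ _ _ => Set.mem_univ _) hkey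
    (by
      rintro s σ σ' ⟨i₁, i₂, i₃⟩ hσ
      rw [hσ.1, hσ.reg (r := .one) (by simp [loopRegs, matchRegs]),
        hσ.reg (r := .top) (by simp [loopRegs, matchRegs])]
      exact ⟨i₁, i₂, i₃⟩)
    (fun s σ h => h.1) (fun s σ h => h.2.1)
    (by
      rintro s σ ν ⟨i₁, i₂, W, idx, i₃, i₄, i₅⟩ - hν
      have hs := weightCodes_simple (b := b) dl
      obtain ⟨idx', j₁, j₂⟩ := weightCodes_eval (l := dl) i₁ i₃ i₄
      refine ⟨?_, fun r hr => ?_, _, idx', j₁, j₂, fun e => ?_⟩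
      · rw [hs.eval_reg σ, i₁]
        intro h
        simpa using weightCodes_writes h
      · rw [hs.eval_arr σ, i₂ r hr]
        intro h
        have := fun A => Ar.le_code b A
        rcases weightCodes_stores h with ⟨r', h⟩ | h
        · have := this (.weight r')
          omega
        · have := this .half
          omega
      · rw [Finset.mem_union, i₅, List.mem_toFinset, hkey _ ν hν]
        simp only [Set.mem_insert_iff, exists_eq_or_imp]
        rw [or_comm])
    (s := ∅) (σ := σ) ⟨h1, hin, ∅, fun _ => 0, ⟨by simp, by simp, by simp, fun r l _ => h0 r l,
      by simp⟩, by simpa using htop, by simp⟩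
  refine ⟨tr, σ', he, hl, i₁, i₂, W, idx, i₃, i₄, fun e => ?_⟩
  rw [i₅, Set.empty_union]
  simp only [Set.exists_mem_image, Set.mem_ofPred_eq, List.mem_map]
  refine exists_congr fun ν => and_congr_right fun _ => exists_congr fun a => and_congr_right fun _ =>
    eq_comm

/-- Insert the answers for the state in the register of the variable `x` into the trie. -/
def stateFill (b : ℕ) (aid : Atom S → ℕ) (G dl : List (Atom S)) (x : ℕ) (os : List ℕ) : Prog :=
  decodeCode b x ;;
  matchAll b aid G (digitCheck b ((Plan.trie 0 [x] os).updateLeaf b 0 ([x] ++ os) .one) dl)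

theorem stateFill_writes {G dl : List (Atom S)} {x : ℕ} {os : List ℕ} {r : Rg}
    (hx : ∀ a ∈ G, ∀ j, a.args j ≠ x) (h : (stateFill b aid G dl x os).Writes (r.code b)) :
    r ≠ .one ∧ r ≠ .top ∧ r ≠ .var x := by
  rcases h with h | h
  · have := decodeCode_writes h
    simp only [Rg.code_inj] at this
    rcases this with rfl | rfl | rfl <;> simp
  · rcases matchAll_writes h with h | h
    · rcases digitCheck_writes h with h | h
      · have := Plan.updateLeaf_writes h
        simp only [Rg.code_inj] at this
        rcases this with rfl | rfl | rfl | rfl <;> simp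
      · rw [Rg.code_inj] at h
        simp [h]
    · rcases h with (h | h | h | ⟨y, ⟨a, ha, j, hj⟩, h⟩) | ⟨a, h | h⟩
      all_goals simp [h]
      rintro rfl
      exact hx a ha j hj

theorem stateFill_stores {G dl : List (Atom S)} {x : ℕ} {os : List ℕ} {A : ℕ}
    (h : (stateFill b aid G dl x os).Stores A) : A = Ar.digit.code b ∨ A = (Ar.bit 0).code b ∨
    ∃ y ∈ os, A = (Ar.pos y).code b ∨ A = (Ar.cnt y).code b ∨ A = (Ar.list y).code b := by
  rcases h with h | h
  · exact .inl (decodeCode_stores h)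
  · have := Plan.updateLeaf_stores (digitCheck_stores (matchAll_stores h))
    rw [Plan.trie_bvars] at this
    exact .inr this

theorem stateFill_exec (L : Listing S) (hb : S.numRel ≤ b) {G dl : List (Atom S)} (hG : G.Nodup)
    (hid : ∀ a ∈ G, ∀ a' ∈ G, aid a = aid a' → a = a')
    {B : ℕ} (hB : ∀ a ∈ G, (L.list a.rel).length ≤ B)
    (hdl : ∀ a ∈ dl, ∀ j, ∃ a' ∈ G, ∃ j', a'.args j' = a.args j) {x : ℕ}
    (hx : ∀ a ∈ G, ∀ j, a.args j ≠ x) {os : List ℕ} (hos : os.Nodup)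
    (hov : ∀ y ∈ os, ∃ a ∈ G, ∃ j, a.args j = y) {W : Finset (ℕ × List ℕ)}
    {idx : ℕ × List ℕ → ℕ} (hW : ∀ ν : ℕ → ℕ, (∀ a ∈ G, (fun j => ν (a.args j)) ∈ L.db a.rel) →
      ∀ a ∈ dl, a.entry ν ∈ W) {σ : Mem} {s : ℕ} (hs : s < 2 ^ W.card) (hsσ : σ.env b x = s)
    (h1 : σ.reg (Rg.one.code b) = 1) (htop : σ.reg (Rg.top.code b) = 2 ^ W.card)
    (hin : ∀ r < S.numRel, σ.arr r = L.initMem.arr r) (hidx : IsNumbering b W idx σ.arr)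
    (hinv : (Plan.trie 0 [x] os).Inv b σ.arr) :
    ∃ tr σ', (stateFill b aid G dl x os).Exec σ tr σ' ∧
      tr.length ≤ 9 * W.card + 9 + (nestCost B (stateFill b aid G dl x os).size G.length +
        (stateFill b aid G dl x os).size) ∧
      (Plan.trie 0 [x] os).Inv b σ'.arr ∧
      ∀ l, σ'.arr ((Ar.bit 0).code b) l ≠ 0 ↔ σ.arr ((Ar.bit 0).code b) l ≠ 0 ∨
        ∃ ν : ℕ → ℕ, (∀ a ∈ G, (fun j => ν (a.args j)) ∈ L.db a.rel) ∧
          (∀ a ∈ dl, s.testBit (idx (a.entry ν)) = true) ∧ s :: os.map ν = l := by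
  set body := digitCheck b ((Plan.trie 0 [x] os).updateLeaf b 0 ([x] ++ os) .one) dl with hbody
  have hxos : x ∉ os := fun h => by
    obtain ⟨a, ha, j, hj⟩ := hov x h
    exact hx a ha j hj
  have hwf : (Plan.trie 0 [x] os).WF := Plan.trie_WF (by simpa using ⟨hxos, hos⟩)
  obtain ⟨t₂, σ₂, e₂, l₂, d₂⟩ := decodeCode_exec (x := x) h1 hsσ hs htop hidx.half
  have r₂ : ∀ r : Rg, r ≠ .tmp₂ → r ≠ .idx 0 → r ≠ .bnd 0 →
      σ₂.reg (r.code b) = σ.reg (r.code b) := fun r h₁ h₂ h₃ => e₂.reg_eq fun h => by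
    have := decodeCode_writes h
    simp only [Rg.code_inj] at this
    tauto
  have a₂ : ∀ A, A ≠ Ar.digit.code b → σ₂.arr A = σ.arr A := fun A hA =>
    e₂.arr_eq fun h => hA (decodeCode_stores h)
  -- a match is processed according to its output values and its entries for the dynamic atoms
  have hkey : ∀ ν ν' : ℕ → ℕ, (∀ a ∈ G, ∀ j, ν (a.args j) = ν' (a.args j)) →
      (os.map ν, dl.map fun a => a.entry ν) = (os.map ν', dl.map fun a => a.entry ν') := by
    intro ν ν' h
    refine Prod.ext (Plan.map_congr_of_agree fun y hy => ?_)
      (List.map_congr_left fun a ha => Atom.entry_congr fun j => ?_)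
    · obtain ⟨a, ha, j, rfl⟩ := hov y hy
      exact h a ha j
    · obtain ⟨a', ha', j', hj⟩ := hdl a ha j
      rw [← hj]
      exact h a' ha' j'
  have leaf_arr : ∀ (σ : Mem) (A : Ar), (A = .digit ∨ ∃ r, A = .weight r) →
      (((Plan.trie 0 [x] os).updateLeaf b 0 ([x] ++ os) .one).eval σ).arr (A.code b) =
        σ.arr (A.code b) := fun σ A hA =>
    (Plan.updateLeaf_simple _ _ _ _ _).eval_arr σ fun h => by
      rcases hA with rfl | ⟨r, rfl⟩ <;>
        rcases Plan.updateLeaf_stores h with h | ⟨y, -, h | h | h⟩ <;> simp at h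
  obtain ⟨tr, σ', he, hl, -, -, -, -, -, i₁, i₂⟩ := matchAll_exec (b := b) (aid := aid) L hG hid
    (body := body) (digitCheck_simple (Plan.updateLeaf_simple _ _ _ _ _) dl)
    (fun r hr => by
      rcases digitCheck_writes hr with h | h
      · have := Plan.updateLeaf_writes h
        simp only [Rg.code_inj] at this
        rcases this with rfl | rfl | rfl | rfl <;> simp
      · rw [Rg.code_inj] at h
        simp [h])
    hB (key := fun ν => (os.map ν, dl.map fun a => a.entry ν))
    (fun K σ => σ.reg (Rg.one.code b) = 1 ∧ (∀ r < S.numRel, σ.arr r = L.initMem.arr r) ∧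
      σ.env b x = s ∧ σ.arr (Ar.digit.code b) = σ₂.arr (Ar.digit.code b) ∧
      (∀ r, σ.arr ((Ar.weight r).code b) = σ₂.arr ((Ar.weight r).code b)) ∧
      (Plan.trie 0 [x] os).Inv b σ.arr ∧ ∀ l, σ.arr ((Ar.bit 0).code b) l ≠ 0 ↔
        σ₂.arr ((Ar.bit 0).code b) l ≠ 0 ∨
          ∃ k ∈ K, (∀ e ∈ k.2, s.testBit (idx e) = true) ∧ s :: k.1 = l)
    (X := {y | y ≠ x}) hx hkey
    (by
      rintro K σ σ' ⟨i₁, i₂, i₃, i₄⟩ hσ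
      rw [hσ.1]
      refine ⟨by rw [hσ.reg (by simp [loopRegs, matchRegs]), i₁], i₂, ?_, i₄⟩
      rw [← i₃]
      exact hσ.reg (by simp [loopRegs, matchRegs]))
    (fun K σ h => h.1) (fun K σ h => h.2.1)
    (by
      rintro K σ ν ⟨i₁, i₂, i₃, i₄, i₅, i₆, i₇⟩ hmatch hν
      have hent : ∀ a ∈ dl, a.entry (σ.env b) = a.entry ν := fun a ha =>
        Atom.entry_congr fun j => by
          obtain ⟨a', ha', j', hj⟩ := hdl a ha j
          rw [← hj]
          exact hν a' ha' j'
      have hP : ∀ a ∈ dl, σ.arr (Ar.digit.code b)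
          [σ.arr ((Ar.weight a.rel).code b) ((List.ofFn a.args).map (σ.env b))] ≠ 0 ↔
            s.testBit (idx (a.entry (σ.env b))) = true := by
        intro a ha
        have hmem : a.entry (σ.env b) ∈ W := hent a ha ▸ hW ν hmatch a ha
        have hw : σ.arr ((Ar.weight a.rel).code b) ((List.ofFn a.args).map (σ.env b)) =
            2 ^ idx (a.entry (σ.env b)) := by
          rw [i₅, a₂ _ (by simp)]
          exact hidx.weight _ _ hmem
        rw [hw, i₄, d₂ _ (hidx.lt _ hmem)]
        simp
      rcases digitCheck_eval (body := (Plan.trie 0 [x] os).updateLeaf b 0 ([x] ++ os) .one)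
        (P := fun e => s.testBit (idx e) = true) i₁ hP with ⟨σ₁, n₁, ev, hall⟩ | ⟨n₁, hall⟩
      · have env₁ : σ₁.env b = σ.env b := funext fun y => n₁.reg (by simp [matchRegs])
        have one₁ : σ₁.reg (Rg.one.code b) = 1 := (n₁.reg (by simp [matchRegs])).trans i₁
        rw [hbody, ev]
        refine ⟨?_, fun r hr => ?_, ?_, ?_, fun r => ?_, ?_, fun l => ?_⟩
        · rw [Plan.updateLeaf_reg (by simp), one₁]
        · rw [Plan.updateLeaf_arr_lt (hr.trans_le hb), n₁.1, i₂ r hr]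
        · refine (Plan.updateLeaf_reg (r := .var x) (by simp)).trans ?_
          exact (congrFun env₁ x).trans i₃
        · rw [leaf_arr _ _ (.inl rfl), n₁.1, i₄]
        · rw [leaf_arr _ _ (.inr ⟨r, rfl⟩), n₁.1, i₅]
        · exact Plan.updateLeaf_inv hwf (Plan.trie_path _ _ _) (by simp [Plan.trie_leaves]) one₁
            (n₁.1 ▸ i₆)
        · have hl : ([x] ++ os).map (σ₁.env b) = s :: os.map ν := by
            rw [env₁, List.singleton_append, List.map_cons, i₃]
            exact congrArg _ (congrArg Prod.fst (hkey _ ν hν))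
          rw [Plan.updateLeaf_bit, hl, one₁, n₁.1]
          simp only [true_and, Set.mem_insert_iff, exists_eq_or_imp]
          split_ifs with h
          · refine iff_of_true one_ne_zero (.inr (.inl ⟨?_, h.symm⟩))
            intro e he
            obtain ⟨a, ha, rfl⟩ := List.mem_map.1 he
            rw [← hent a ha]
            exact hall a ha
          · rw [i₇, or_left_comm]
            exact (or_iff_right fun h' => h h'.2.symm).symm
      · have env₁ := n₁.reg (r := .var x) (by simp [matchRegs])
        have one₁ := (n₁.reg (r := .one) (by simp [matchRegs])).trans i₁
        refine ⟨one₁, ?_, env₁.trans i₃, ?_⟩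
        · rw [n₁.1]
          exact i₂
        · rw [n₁.1]
          refine ⟨i₄, i₅, i₆, fun l => ?_⟩
          simp only [Set.mem_insert_iff, exists_eq_or_imp]
          rw [i₇, or_left_comm]
          refine (or_iff_right fun h' => hall fun a ha => ?_).symm
          rw [hent a ha]
          exact h'.1 _ (List.mem_map_of_mem ha))
    (s := ∅) (σ := σ₂)
    ⟨(r₂ _ (by simp) (by simp) (by simp)).trans h1, fun r hr => by
        rw [a₂ _ (by have := Ar.le_code b .digit; omega), hin r hr],
      (r₂ (.var x) (by simp) (by simp) (by simp)).trans hsσ, rfl, fun _ => rfl,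
      Plan.inv_congr_arr (fun a _ => a₂ _ (by simp))
        (fun y _ => ⟨a₂ _ (by simp), a₂ _ (by simp), a₂ _ (by simp)⟩) hinv, by simp⟩
  refine ⟨_, σ', e₂.seq he, ?_, i₁, fun l => ?_⟩
  · have hsz : (matchAll b aid G body).size ≤ (stateFill b aid G dl x os).size := by
      simp only [stateFill, Prog.size, ← hbody]
      omega
    have hmono : ∀ n, nestCost B (matchAll b aid G body).size n ≤
        nestCost B (stateFill b aid G dl x os).size n := by
      intro n
      induction n with
      | zero => exact hsz
      | succ n ih => exact Nat.add_le_add_right (Nat.mul_le_mul_left _ (by omega)) _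
    have := hmono G.length
    simp only [List.length_cons, List.length_append]
    omega
  · rw [i₂, Set.empty_union, a₂ _ (by simp)]
    refine or_congr_right ?_
    simp only [Set.exists_mem_image, Set.mem_ofPred_eq, List.forall_mem_map]

/-- Insert the answers for all states into the trie. -/
def statesCode (b : ℕ) (aid : Atom S → ℕ) (G dl : List (Atom S)) (x : ℕ) (os : List ℕ) : Prog :=
  .forLoop (Rg.one.code b) ((Rg.var x).code b) (Rg.top.code b) (stateFill b aid G dl x os)

theorem statesCode_exec (L : Listing S) (hb : S.numRel ≤ b) {G dl : List (Atom S)} (hG : G.Nodup)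
    (hid : ∀ a ∈ G, ∀ a' ∈ G, aid a = aid a' → a = a')
    {B : ℕ} (hB : ∀ a ∈ G, (L.list a.rel).length ≤ B)
    (hdl : ∀ a ∈ dl, ∀ j, ∃ a' ∈ G, ∃ j', a'.args j' = a.args j) {x : ℕ}
    (hx : ∀ a ∈ G, ∀ j, a.args j ≠ x) {os : List ℕ} (hos : os.Nodup)
    (hov : ∀ y ∈ os, ∃ a ∈ G, ∃ j, a.args j = y) {W : Finset (ℕ × List ℕ)}
    {idx : ℕ × List ℕ → ℕ} (hW : ∀ ν : ℕ → ℕ, (∀ a ∈ G, (fun j => ν (a.args j)) ∈ L.db a.rel) →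
      ∀ a ∈ dl, a.entry ν ∈ W) {σ : Mem}
    (h1 : σ.reg (Rg.one.code b) = 1) (htop : σ.reg (Rg.top.code b) = 2 ^ W.card)
    (hin : ∀ r < S.numRel, σ.arr r = L.initMem.arr r) (hidx : IsNumbering b W idx σ.arr)
    (h0 : ∀ l, σ.arr ((Ar.bit 0).code b) l = 0)
    (h0' : ∀ y ∈ os, ∀ l, σ.arr ((Ar.pos y).code b) l = 0 ∧ σ.arr ((Ar.cnt y).code b) l = 0) :
    ∃ tr σ', (statesCode b aid G dl x os).Exec σ tr σ' ∧
      tr.length ≤ 2 ^ W.card * (9 * W.card + 9 +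
        (nestCost B (stateFill b aid G dl x os).size G.length +
          (stateFill b aid G dl x os).size) + 3) + 3 ∧
      (∀ A, (A ≠ Ar.digit.code b ∧ A ≠ (Ar.bit 0).code b ∧ ∀ y ∈ os, A ≠ (Ar.pos y).code b ∧
        A ≠ (Ar.cnt y).code b ∧ A ≠ (Ar.list y).code b) → σ'.arr A = σ.arr A) ∧
      (Plan.trie 0 [x] os).Inv b σ'.arr ∧
      ∀ l, σ'.arr ((Ar.bit 0).code b) l ≠ 0 ↔ ∃ s < 2 ^ W.card, ∃ ν : ℕ → ℕ,
        (∀ a ∈ G, (fun j => ν (a.args j)) ∈ L.db a.rel) ∧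
          (∀ a ∈ dl, s.testBit (idx (a.entry ν)) = true) ∧ s :: os.map ν = l := by
  have hw := fun r : Rg => stateFill_writes (b := b) (aid := aid) (dl := dl) (os := os) (r := r) hx
  obtain ⟨tr, σ', he, hl, i₁, -, i₂, i₃⟩ := Prog.exec_forLoop (o := Rg.one.code b)
    (i := (Rg.var x).code b) (n := Rg.top.code b) (body := stateFill b aid G dl x os)
    (N := 2 ^ W.card)
    (fun j σ' => (∀ A, (A ≠ Ar.digit.code b ∧ A ≠ (Ar.bit 0).code b ∧
        ∀ y ∈ os, A ≠ (Ar.pos y).code b ∧ A ≠ (Ar.cnt y).code b ∧ A ≠ (Ar.list y).code b) →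
          σ'.arr A = σ.arr A) ∧ σ'.reg (Rg.top.code b) = 2 ^ W.card ∧
      (Plan.trie 0 [x] os).Inv b σ'.arr ∧
      ∀ l, σ'.arr ((Ar.bit 0).code b) l ≠ 0 ↔ ∃ s < j, ∃ ν : ℕ → ℕ,
        (∀ a ∈ G, (fun j => ν (a.args j)) ∈ L.db a.rel) ∧
          (∀ a ∈ dl, s.testBit (idx (a.entry ν)) = true) ∧ s :: os.map ν = l)
    (by simp) (by simp) (fun h => (hw _ h).2.2 rfl) (fun h => (hw _ h).2.1 rfl)
    (fun h => (hw _ h).1 rfl)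
    (fun j σ v h => ⟨h.1, by simpa using h.2.1, h.2.2⟩)
    (by
      rintro j hj σ₁ ⟨i₁, i₂, i₃, i₄⟩ hjσ hone
      obtain ⟨tr, σ', he, hl, j₁, j₂⟩ := stateFill_exec L hb hG hid hB hdl hx hos hov hW hj hjσ
        hone i₂ (fun r hr => by
          rw [i₁, hin r hr]
          have := fun A => Ar.le_code b A
          refine ⟨?_, ?_, fun y _ => ⟨?_, ?_, ?_⟩⟩ <;> exact ((hr.trans_le hb).trans_le (this _)).ne)
        (hidx.congr (fun r => i₁ _ (by simp)) (i₁ _ (by simp))) i₃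
      refine ⟨tr, σ', he, hl, fun A hA => ?_, ?_, j₁, fun l => ?_⟩
      · rw [← i₁ A hA]
        refine he.arr_eq fun h => ?_
        rcases stateFill_stores h with h | h | ⟨y, hy, h⟩
        · exact hA.1 h
        · exact hA.2.1 h
        · have := hA.2.2 y hy
          tauto
      · rw [he.reg_eq fun h => (hw _ h).2.1 rfl, i₂]
      · rw [j₂, i₄]
        simp only [Nat.lt_succ_iff_lt_or_eq, or_and_right, exists_or, exists_eq_left])
    σ ⟨fun _ _ => rfl, htop, Plan.trie_inv_of_zero h0 h0', by simp [h0]⟩ htop h1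
  exact ⟨tr, σ', he, hl, i₁, i₂, i₃⟩

end states

/-! ### The current state -/

section states

variable {S : Schema} {b : ℕ}

/-- The registers that hold the tuple of the requested update. -/
def tupleRegs (k : ℕ) : List ℕ := (List.range k).map (· + 2)

/-- Apply the requested update of the relation `r` to the array `pres`, and add the weight of the
tuple to the number of the state, or subtract it. -/
def stateUpdate (b : ℕ) (r : Fin S.numRel) : Prog :=
  .load (Rg.tmp₁.code b) ((Ar.pres r).code b) (tupleRegs (S.arity r)) ;;
  .load (Rg.tmp₂.code b) ((Ar.weight r).code b) (tupleRegs (S.arity r)) ;;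
  .load (Rg.tmp₃.code b) (Ar.state.code b) [] ;;
  .ite (Rg.tmp₁.code b) 0
    (.store ((Ar.pres r).code b) (tupleRegs (S.arity r)) 0 ;;
      .add (Rg.tmp₃.code b) (Rg.tmp₃.code b) (Rg.tmp₂.code b) ;;
      .store (Ar.state.code b) [] (Rg.tmp₃.code b))
    (.ite 0 (Rg.tmp₁.code b)
      (.store ((Ar.pres r).code b) (tupleRegs (S.arity r)) 0 ;;
        .sub (Rg.tmp₃.code b) (Rg.tmp₃.code b) (Rg.tmp₂.code b) ;;
        .store (Ar.state.code b) [] (Rg.tmp₃.code b))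
      (skipCode b))

/-- Run the program for the relation of the requested update. -/
def dispatch (b : ℕ) (f : Fin S.numRel → Prog) : List (Fin S.numRel) → Prog
  | [] => skipCode b
  | r :: l => .const (Rg.tmp₁.code b) r ;;
      .ite (Rg.tmp₁.code b) 1 (dispatch b f l)
        (.ite 1 (Rg.tmp₁.code b) (dispatch b f l) (f r))

theorem dispatch_simple {f : Fin S.numRel → Prog} (hf : ∀ r, (f r).Simple)
    (l : List (Fin S.numRel)) : (dispatch b f l).Simple := by
  induction l with
  | nil => trivial
  | cons r l ih => exact ⟨trivial, ih, ih, hf r⟩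

theorem dispatch_writes {f : Fin S.numRel → Prog} {l : List (Fin S.numRel)} {y : ℕ}
    (h : (dispatch b f l).Writes y) : y = Rg.tmp₁.code b ∨ ∃ r, (f r).Writes y := by
  induction l with
  | nil => exact .inl h
  | cons r l ih =>
    rcases h with h | h | h | h
    exacts [.inl h, ih h, ih h, .inr ⟨r, h⟩]

theorem dispatch_stores {f : Fin S.numRel → Prog} {l : List (Fin S.numRel)} {A : ℕ}
    (h : (dispatch b f l).Stores A) : ∃ r, (f r).Stores A := by
  induction l with
  | nil => exact h.elim
  | cons r l ih =>
    rcases h with h | h | h | h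
    exacts [h.elim, ih h, ih h, ⟨r, h⟩]

theorem dispatch_eval {f : Fin S.numRel → Prog} {l : List (Fin S.numRel)} {r : Fin S.numRel}
    (hb : 2 ≤ b) {σ : Mem} (hσ : σ.reg 1 = r) (hr : r ∈ l) :
    ∃ σ₁, σ.Near b (matchRegs ∅) σ₁ ∧ (dispatch b f l).eval σ = (f r).eval σ₁ := by
  induction l generalizing σ with
  | nil => simp at hr
  | cons r' l ih =>
    have h1 := Rg.le_code b .tmp₁
    have hne : 1 ≠ Rg.tmp₁.code b := by omega
    have n₁ : σ.Near b (matchRegs ∅) (σ.setReg (Rg.tmp₁.code b) r') :=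
      Mem.near_setReg (by simp [matchRegs])
    have hσ₁ : (σ.setReg (Rg.tmp₁.code b) r').reg 1 = r := by simp [hne, hσ]
    simp only [dispatch, Prog.eval]
    by_cases hrr : r = r'
    · subst hrr
      refine ⟨_, n₁, ?_⟩
      simp [hne, hσ]
    · obtain ⟨σ₂, n₂, e₂⟩ := ih hσ₁ ((List.mem_cons.1 hr).resolve_left hrr)
      refine ⟨σ₂, n₁.trans n₂, ?_⟩
      have : (r : ℕ) ≠ r' := fun h => hrr (Fin.ext h)
      simp only [hσ₁, Mem.setReg_reg, if_true]
      split_ifs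
      · exact e₂
      · exact e₂
      · omega

theorem stateUpdate_simple (r : Fin S.numRel) : (stateUpdate b r).Simple :=
  ⟨trivial, trivial, trivial, ⟨trivial, trivial, trivial⟩, ⟨trivial, trivial, trivial⟩, trivial⟩

theorem stateUpdate_writes {r : Fin S.numRel} {y : ℕ} (h : (stateUpdate b r).Writes y) :
    y = Rg.tmp₁.code b ∨ y = Rg.tmp₂.code b ∨ y = Rg.tmp₃.code b := by
  simp only [stateUpdate, Prog.Writes, skipCode] at h
  tauto

theorem stateUpdate_stores {r : Fin S.numRel} {A : ℕ} (h : (stateUpdate b r).Stores A) :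
    A = (Ar.pres r).code b ∨ A = Ar.state.code b := by
  simp only [stateUpdate, Prog.Stores, skipCode] at h
  tauto

theorem stateUpdate_eval {r : Fin S.numRel} (hb : S.arity r + 2 ≤ b) {σ : Mem} {k : List ℕ}
    {v : ℕ} (hk : (tupleRegs (S.arity r)).map σ.reg = k) (h0 : σ.reg 0 = v) (hv : v ≤ 1)
    (hc : σ.arr ((Ar.pres r).code b) k ≤ 1) :
    (∀ r' l, ((stateUpdate b r).eval σ).arr ((Ar.pres r').code b) l =
      if (r', l) = ((r : ℕ), k) then v else σ.arr ((Ar.pres r').code b) l) ∧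
    ((stateUpdate b r).eval σ).arr (Ar.state.code b) [] =
      σ.arr (Ar.state.code b) [] + v * σ.arr ((Ar.weight r).code b) k -
        σ.arr ((Ar.pres r).code b) k * σ.arr ((Ar.weight r).code b) k := by
  have hle := Rg.le_code b
  have hm : ∀ (σ : Mem) (r' : Rg) (v : ℕ), (tupleRegs (S.arity r)).map (σ.setReg (r'.code b) v).reg =
      (tupleRegs (S.arity r)).map σ.reg := by
    intro σ r' v
    refine List.map_congr_left fun y hy => ?_
    obtain ⟨i, hi, rfl⟩ := List.mem_map.1 hy
    rw [List.mem_range] at hi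
    have := hle r'
    rw [Mem.setReg_reg, if_neg (by omega)]
  have hne : ∀ r' : Rg, 0 ≠ r'.code b := fun r' => by
    have := hle r'
    omega
  set c := σ.arr ((Ar.pres r).code b) k with hcdef
  set w := σ.arr ((Ar.weight r).code b) k with hwdef
  set s := σ.arr (Ar.state.code b) [] with hsdef
  have ev : (stateUpdate b r).eval σ =
      if c < v then ((((((σ.setReg (Rg.tmp₁.code b) c).setReg (Rg.tmp₂.code b) w).setReg
        (Rg.tmp₃.code b) s).setArr ((Ar.pres r).code b) k v).setReg (Rg.tmp₃.code b) (s + w)).setArr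
          (Ar.state.code b) [] (s + w))
      else if v < c then ((((((σ.setReg (Rg.tmp₁.code b) c).setReg (Rg.tmp₂.code b) w).setReg
        (Rg.tmp₃.code b) s).setArr ((Ar.pres r).code b) k v).setReg (Rg.tmp₃.code b) (s - w)).setArr
          (Ar.state.code b) [] (s - w))
      else (skipCode b).eval (((σ.setReg (Rg.tmp₁.code b) c).setReg (Rg.tmp₂.code b) w).setReg
        (Rg.tmp₃.code b) s) := by
    simp only [stateUpdate, Prog.eval, hm, hk, Mem.setReg_reg, Mem.setReg_arr, Mem.setArr_reg,
      hne, if_false, if_true, Rg.code_inj, reduceCtorEq, h0, List.map_nil, ← hcdef, ← hwdef,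
      ← hsdef]
  rw [ev]
  split_ifs with h₁ h₂
  · obtain ⟨rfl, hc0⟩ : v = 1 ∧ c = 0 := by omega
    refine ⟨fun r' l => ?_, ?_⟩
    · simp
    · simp [hc0]
  · obtain ⟨rfl, hc1⟩ : v = 0 ∧ c = 1 := by omega
    refine ⟨fun r' l => ?_, ?_⟩
    · simp
    · simp [hc1]
  · have hvc : v = c := by omega
    refine ⟨fun r' l => ?_, ?_⟩
    · simp only [skipCode, Prog.eval, Mem.setReg_arr]
      split_ifs with h
      · obtain ⟨rfl, rfl⟩ := Prod.mk.inj h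
        exact hvc.symm
      · rfl
    · simp [skipCode, Prog.eval, hvc, hsdef]

theorem tupleRegs_map {u : Update S} {σ : Mem}
    (h : ∀ j : Fin (S.arity u.rel), σ.reg (j + 2) = u.tuple j) :
    (tupleRegs (S.arity u.rel)).map σ.reg = List.ofFn u.tuple := by
  refine List.ext_getElem (by simp [tupleRegs]) fun i h₁ h₂ => ?_
  simp only [tupleRegs, List.map_map, List.getElem_map, List.getElem_range, List.getElem_ofFn,
    Function.comp_apply]
  exact h ⟨i, by simpa using h₂⟩

theorem testBit_sum_weights {W : Finset (ℕ × List ℕ)} {idx c : ℕ × List ℕ → ℕ}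
    (hinj : Set.InjOn idx W) (hc : ∀ e, c e ≤ 1) :
    ∑ e ∈ W, c e * 2 ^ idx e = ∑ i ∈ (W.filter fun e => c e = 1).image idx, 2 ^ i := by
  rw [Finset.sum_image fun e he e' he' h => hinj (Finset.filter_subset _ _ he)
    (Finset.filter_subset _ _ he') h, Finset.sum_filter]
  refine Finset.sum_congr rfl fun e _ => ?_
  have := hc e
  split_ifs with h
  · rw [h, one_mul]
  · rw [show c e = 0 by omega, zero_mul]

/-- The arrays encode the database `D`: `pres` holds the dynamic relations, the number of the current
state is the sum of the weights of the entries that are present, and the trie holds the answers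
for all states. -/
structure StateEnc (b : ℕ) (L : Listing S) (G dl : List (Atom S)) (x : ℕ) (os : List ℕ)
    (W : Finset (ℕ × List ℕ)) (idx : ℕ × List ℕ → ℕ) (D : Database S)
    (m : ℕ → List ℕ → ℕ) : Prop where
  numbering : IsNumbering b W idx m
  mem_iff : ∀ e, e ∈ W ↔ ∃ ν : ℕ → ℕ, (∀ a ∈ G, (fun j => ν (a.args j)) ∈ L.db a.rel) ∧
    ∃ a ∈ dl, e = a.entry ν
  pres_le : ∀ r l, m ((Ar.pres r).code b) l ≤ 1
  pres_iff : ∀ r : Fin S.numRel, S.isDyn r = true → ∀ t : S.Tuple r,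
    m ((Ar.pres r).code b) (List.ofFn t) = 1 ↔ t ∈ D r
  state : m (Ar.state.code b) [] = ∑ e ∈ W, m ((Ar.pres e.1).code b) e.2 * 2 ^ idx e
  inv : (Plan.trie 0 [x] os).Inv b m
  bit : ∀ l, m ((Ar.bit 0).code b) l ≠ 0 ↔ ∃ s < 2 ^ W.card, ∃ ν : ℕ → ℕ,
    (∀ a ∈ G, (fun j => ν (a.args j)) ∈ L.db a.rel) ∧
      (∀ a ∈ dl, s.testBit (idx (a.entry ν)) = true) ∧ s :: os.map ν = l
  static : ∀ r, S.isDyn r = false → D r = L.db r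

variable {L : Listing S} {G dl : List (Atom S)} {x : ℕ} {os : List ℕ}
  {W : Finset (ℕ × List ℕ)} {idx : ℕ × List ℕ → ℕ} {D : Database S}

theorem StateEnc.update (hb : ∀ r, S.arity r + 2 ≤ b) {u : Update S} {σ : Mem}
    (h : StateEnc b L G dl x os W idx D σ.arr) :
    StateEnc b L G dl x os W idx (u.apply D)
      ((dispatch b (stateUpdate b) (List.finRange S.numRel)).eval (u.request σ)).arr := by
  obtain ⟨q₁, q₂, q₃⟩ := u.request_reg σ
  have hbu := hb u.rel
  obtain ⟨σ₁, n₁, ev⟩ := dispatch_eval (b := b) (f := stateUpdate b) (by omega) q₂ (List.mem_finRange u.rel)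
  have harr : σ₁.arr = σ.arr := n₁.1
  set v := if u.insert then 1 else 0 with hv
  have hv1 : v ≤ 1 := by
    rw [hv]
    split_ifs <;> omega
  have hk : (tupleRegs (S.arity u.rel)).map σ₁.reg = List.ofFn u.tuple :=
    tupleRegs_map fun j => by rw [n₁.reg_lt (by omega), q₃]
  obtain ⟨e₁, e₂⟩ := stateUpdate_eval hbu hk (by rw [n₁.reg_lt (by omega), q₁]) hv1
    (harr ▸ h.pres_le _ _)
  have e₃ : ∀ A : Ar, A ≠ .pres u.rel → A ≠ .state →
      ((stateUpdate b u.rel).eval σ₁).arr (A.code b) = σ.arr (A.code b) := fun A h₁ h₂ => by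
    rw [(stateUpdate_simple u.rel).eval_arr σ₁, harr]
    intro hs
    have := stateUpdate_stores hs
    simp only [Ar.code_inj] at this
    tauto
  rw [harr] at e₁ e₂
  rw [ev]
  refine ⟨h.numbering.congr (fun r => e₃ _ (by simp) (by simp)) (e₃ _ (by simp) (by simp)),
    h.mem_iff, fun r l => ?_, fun r hr t => ?_, ?_, ?_, fun l => ?_, fun r hr => ?_⟩
  · rw [e₁]
    split_ifs
    · exact hv1
    · exact h.pres_le r l
  · rw [e₁]
    obtain ⟨ru, hd, ins, tu⟩ := u
    by_cases hrr : ru = r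
    · subst hrr
      by_cases ht : t = tu
      · subst ht
        cases ins <;> simp [hv, Update.apply]
      · rw [if_neg, h.pres_iff _ hr]
        · cases ins <;> simp [Update.apply, ht]
        · simpa [List.ofFn_inj] using ht
    · rw [if_neg, h.pres_iff _ hr]
      · simp [Update.apply, Function.update_of_ne (Ne.symm hrr)]
      · intro h'
        exact hrr (Fin.ext (Prod.mk.inj h').1.symm)
  · rw [e₂, h.state]
    set e := ((u.rel : ℕ), List.ofFn u.tuple) with he
    -- only the summand of the updated tuple changes, and its weight is zero if it is irrelevant
    have hoff : ∀ e' ∈ W, e' ≠ e →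
        ((stateUpdate b u.rel).eval σ₁).arr ((Ar.pres e'.1).code b) e'.2 * 2 ^ idx e' =
          σ.arr ((Ar.pres e'.1).code b) e'.2 * 2 ^ idx e' := fun e' _ hne => by
      rw [e₁, if_neg hne]
    by_cases hmem : e ∈ W
    · rw [← Finset.add_sum_erase _ _ hmem, ← Finset.add_sum_erase _ _ hmem,
        Finset.sum_congr rfl fun e' he' => (hoff e' (Finset.mem_of_mem_erase he')
          (Finset.ne_of_mem_erase he')), e₁, if_pos rfl, h.numbering.weight _ _ hmem]
      simp only [he]
      omega
    · rw [h.numbering.weight_zero _ _ hmem, Nat.mul_zero, Nat.mul_zero, Nat.add_zero, Nat.sub_zero]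
      exact Finset.sum_congr rfl fun e' he' => (hoff e' he' fun h => hmem (h ▸ he')).symm
  · exact Plan.inv_congr_arr (fun a _ => e₃ _ (by simp) (by simp)) (fun y _ =>
      ⟨e₃ _ (by simp) (by simp), e₃ _ (by simp) (by simp), e₃ _ (by simp) (by simp)⟩) h.inv
  · rw [e₃ _ (by simp) (by simp)]
    exact h.bit l
  · rw [← h.static r hr, Update.apply, Function.update_of_ne]
    rintro rfl
    simp [u.dyn] at hr

/-- Look up the answers for the current state. -/
def stateAnswer (b x : ℕ) (os head : List ℕ) : Prog :=
  .load ((Rg.var x).code b) (Ar.state.code b) [] ;; (Plan.trie 0 [x] os).answerCode b head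

theorem StateEnc.answer {Q : CQ S} (hG : ∀ a, a ∈ G ↔ a ∈ Q.stat.body)
    (hdl : ∀ a, a ∈ dl ↔ a ∈ Q.dyn.body) (hx : x ∉ Q.vars) (hos : os.Nodup)
    (hhead : ∀ y, y ∈ Q.head ↔ y ∈ os) {σ : Mem} (h : StateEnc b L G dl x os W idx D σ.arr) :
    ∃ tr σ', (stateAnswer b x os Q.head).Exec σ tr σ' ∧ (tr.filterMap id).Nodup ∧
      {t | t ∈ tr.filterMap id} = Q.result D ∧
      GapLE ((Plan.trie 0 [x] os).delay 1 + ((Plan.trie 0 [x] os).status b).size + 5 + 2) tr := by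
  have hxos : x ∉ os := fun hxo => by
    obtain ⟨a, ha, hxa⟩ := Q.head_subset x ((hhead x).2 hxo)
    exact hx (CQ.mem_vars.2 ⟨a, ha, hxa⟩)
  have hxa : ∀ a ∈ Q.body, ∀ j, a.args j ≠ x := fun a ha j hj =>
    hx (CQ.mem_vars.2 ⟨a, ha, hj ▸ a.args_mem_vars j⟩)
  set σ₁ := σ.setReg ((Rg.var x).code b) (σ.arr (Ar.state.code b) []) with hσ₁
  obtain ⟨tr, σ', he, hnd, hmem, hgap⟩ := Plan.answerCode_exec (b := b)
    (Plan.trie_WF (a := 0) (ks := [x]) (os := os) (by simpa using ⟨hxos, hos⟩)) (head := Q.head)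
    (fun y => by rw [Plan.trie_outs, hhead]) σ₁ h.inv
  refine ⟨_, σ', (Prog.Exec.load _ _ _ σ).seq he, by simpa using hnd, ?_, ?_⟩
  · have hfil : (none :: ([none] ++ tr)).filterMap id = tr.filterMap id := by simp
    have hstate : ∀ e ∈ W, (σ.arr (Ar.state.code b) []).testBit (idx e) = true ↔
        σ.arr ((Ar.pres e.1).code b) e.2 = 1 := by
      intro e he
      rw [h.state, testBit_sum_weights (c := fun e => σ.arr ((Ar.pres e.1).code b) e.2)
        h.numbering.inj (fun e => h.pres_le _ _), testBit_sum_two_pow, Finset.mem_image]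
      constructor
      · rintro ⟨e', he', hee⟩
        rw [Finset.mem_filter] at he'
        rw [← h.numbering.inj he'.1 he hee]
        exact he'.2
      · exact fun hp => ⟨e, Finset.mem_filter.2 ⟨he, hp⟩, rfl⟩
    have hlt : σ.arr (Ar.state.code b) [] < 2 ^ W.card := by
      rw [h.state, testBit_sum_weights (c := fun e => σ.arr ((Ar.pres e.1).code b) e.2)
        h.numbering.inj (fun e => h.pres_le _ _)]
      refine Nat.geomSum_lt le_rfl fun i hi => ?_
      obtain ⟨e, he, rfl⟩ := Finset.mem_image.1 hi
      exact h.numbering.lt e (Finset.mem_filter.1 he).1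
    -- a match of the static atoms satisfies the dynamic atoms if its entries are present
    have hdyn : ∀ ν : ℕ → ℕ, (∀ a ∈ G, (fun j => ν (a.args j)) ∈ L.db a.rel) →
        ((∀ a ∈ dl, (σ.arr (Ar.state.code b) []).testBit (idx (a.entry ν)) = true) ↔
          ∀ a ∈ Q.body, (fun j => ν (a.args j)) ∈ D a.rel) := by
      intro ν hν
      have key : ∀ a ∈ dl, (σ.arr (Ar.state.code b) []).testBit (idx (a.entry ν)) = true ↔
          (fun j => ν (a.args j)) ∈ D a.rel := by
        intro a ha
        have hd := (CQ.mem_dyn_body.1 ((hdl a).1 ha)).2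
        rw [hstate _ ((h.mem_iff _).2 ⟨ν, hν, a, ha, rfl⟩), ← h.pres_iff _ hd, Atom.entry,
          List.map_ofFn]
        rfl
      constructor
      · intro hall a ha
        by_cases hd : S.isDyn a.rel = true
        · have ha' := (hdl a).2 (CQ.mem_dyn_body.2 ⟨ha, hd⟩)
          exact (key a ha').1 (hall a ha')
        · rw [Bool.not_eq_true] at hd
          rw [h.static _ hd]
          exact hν a ((hG a).2 (CQ.mem_stat_body.2 ⟨ha, hd⟩))
      · exact fun hall a ha => (key a ha).2 (hall a (CQ.mem_dyn_body.1 ((hdl a).1 ha)).1)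
    ext t
    rw [hfil, Set.mem_ofPred_eq, hmem]
    simp only [Plan.trie_fv, List.mem_singleton, forall_eq, Plan.trie_sat, List.singleton_append,
      List.map_cons]
    have hx₁ : σ₁.env b x = σ.arr (Ar.state.code b) [] := by simp [hσ₁]
    constructor
    · rintro ⟨μ, h₁, h₂, rfl⟩
      obtain ⟨s, -, ν, hν, hbits, hl⟩ := (h.bit _).1 h₂
      obtain ⟨hs, hl⟩ := List.cons.inj hl
      rw [hs, h₁, hx₁] at hbits
      refine ⟨ν, (hdyn ν hν).1 hbits, Plan.map_congr_of_agree fun y hy => ?_⟩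
      exact (List.map_inj_left.1 hl y ((hhead y).1 hy)).symm
    · rintro ⟨ν, hν, rfl⟩
      have hstat : ∀ a ∈ G, (fun j => ν (a.args j)) ∈ L.db a.rel := fun a ha => by
        obtain ⟨hb, hd⟩ := CQ.mem_stat_body.1 ((hG a).1 ha)
        rw [← h.static _ hd]
        exact hν a hb
      have hne : ∀ y ∈ os, y ≠ x := fun y hy hyx => hxos (hyx ▸ hy)
      refine ⟨Function.update ν x (σ.arr (Ar.state.code b) []), by simp [hx₁], ?_, ?_⟩
      · refine (h.bit _).2 ⟨_, hlt, ν, hstat, (hdyn ν hstat).2 hν, ?_⟩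
        rw [Function.update_self]
        exact congrArg _ (Plan.map_congr_of_agree fun y hy => by simp [hne y hy])
      · exact Plan.map_congr_of_agree fun y hy => by simp [hne y ((hhead y).1 hy)]
  · intro w hw hn
    have := (GapLE.append (GapLE.of_length (c := 2) (tr := [none, none]) (by simp)) hgap) w hw hn
    omega

end states

/-! ### Maintenance of the queries of the class -/

section main

variable {S : Schema}

theorem Listing.card_db (L : Listing S) (r : Fin S.numRel) :
    (L.db r).card = (L.list r).length :=
  List.toFinset_card_of_nodup (L.nodup r)

/-- If all variables of dynamic atoms occur in static atoms, then there are few relevant dynamic tuples,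
and the answers for all sets of relevant tuples can be computed in advance. -/
theorem exists_maintenance_of_subset {Q : CQ S} (hQ : Q.dyn.vars ⊆ Q.stat.vars) :
    ∃ (A : Maintenance) (f : ℕ → ℕ) (k : ℕ), ExpBdd f ∧
      A.PreprocessingTime S (fun N M => f (Q.sizeBound N) + k + k * M) ∧ A.UpdateTime S k ∧
      A.EnumerationDelay Q k := by
  classical
  obtain ⟨b, hb, hba⟩ := exists_base S
  obtain ⟨aid, hid⟩ := Set.countable_iff_exists_injOn.1 Q.body.countable_toSet
  obtain ⟨x, hx⟩ := Infinite.exists_notMem_finset Q.vars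
  set G := Q.stat.body.toList with hG
  set dl := Q.dyn.body.toList with hdl
  set os := Q.head.dedup with hos
  have mem_G : ∀ a, a ∈ G ↔ a ∈ Q.stat.body := fun a => Finset.mem_toList
  have mem_dl : ∀ a, a ∈ dl ↔ a ∈ Q.dyn.body := fun a => Finset.mem_toList
  have hGid : ∀ a ∈ G, ∀ a' ∈ G, aid a = aid a' → a = a' := fun a ha a' ha' h =>
    hid (CQ.mem_stat_body.1 ((mem_G a).1 ha)).1 (CQ.mem_stat_body.1 ((mem_G a').1 ha')).1 h
  have hGx : ∀ a ∈ G, ∀ j, a.args j ≠ x := fun a ha j hj =>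
    hx (CQ.mem_vars.2 ⟨a, (CQ.mem_stat_body.1 ((mem_G a).1 ha)).1, hj ▸ a.args_mem_vars j⟩)
  have hstat : ∀ y ∈ Q.stat.vars, ∃ a ∈ G, ∃ j, a.args j = y := fun y hy => by
    obtain ⟨a, ha, hya⟩ := CQ.mem_vars.1 hy
    exact ⟨a, (mem_G a).2 ha, Atom.mem_vars_iff.1 hya⟩
  have hdlv : ∀ a ∈ dl, ∀ j, a.args j ∈ Q.stat.vars := fun a ha j =>
    hQ (CQ.mem_vars.2 ⟨a, (mem_dl a).1 ha, a.args_mem_vars j⟩)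
  have hosv : ∀ y ∈ os, ∃ a ∈ G, ∃ j, a.args j = y := fun y hy => hstat y <| by
    obtain ⟨a, ha, hya⟩ := Q.head_subset y (List.mem_dedup.1 hy)
    by_cases hd : S.isDyn a.rel = true
    · exact hQ (CQ.mem_vars.2 ⟨a, CQ.mem_dyn_body.2 ⟨ha, hd⟩, hya⟩)
    · exact CQ.mem_vars.2 ⟨a, CQ.mem_stat_body.2 ⟨ha, by simpa using hd⟩, hya⟩
  set s₁ := (matchAll b aid G (weightCodes b dl)).size with hs₁
  set s₂ := (stateFill b aid G dl x os).size with hs₂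
  set f : ℕ → ℕ := fun B => nestCost B s₁ G.length + s₁ + (2 ^ (dl.length * B) *
    (9 * (dl.length * B) + 9 + (nestCost B s₂ G.length + s₂) + 3) + 3) + 5 with hf
  have hfb : ExpBdd f := by
    have hlin : ExpBdd fun B => dl.length * B := (ExpBdd.const _).mul .id
    exact ((((ExpBdd.const _).nestCost _).add (.const _)).add (((ExpBdd.two_pow _).mul
      (((((ExpBdd.const 9).mul hlin).add (.const 9)).add
        (((ExpBdd.const _).nestCost _).add (.const _))).add (.const 3))).add (.const 3))).add
      (.const 5)
  suffices H : ∃ (A : Maintenance) (k : ℕ),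
      A.PreprocessingTime S (fun N M => f (Q.sizeBound N) + k + k * M) ∧
      A.UpdateTime S k ∧ A.EnumerationDelay Q k by
    obtain ⟨A, k, h⟩ := H
    exact ⟨A, f, k, hfb, h⟩
  refine exists_maintenance (Q := Q) (b := b)
    (prep := .const (Rg.one.code b) 1 ;; .const (Rg.top.code b) 1 ;;
      matchAll b aid G (weightCodes b dl) ;; statesCode b aid G dl x os)
    (upd := dispatch b (stateUpdate b) (List.finRange S.numRel))
    (enum := stateAnswer b x os Q.head) (f := fun N => f (Q.sizeBound N))
    (c := (Plan.trie 0 [x] os).delay 1 + ((Plan.trie 0 [x] os).status b).size + 5 + 2)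
    (Enc := fun L D m => ∃ W idx, StateEnc b L G dl x os W idx D m)
    hba ?prep (dispatch_simple stateUpdate_simple _) ?_ ?_ ?upd ?_ ?enum
  case prep =>
    intro L
    have hB : ∀ a ∈ G, (L.list a.rel).length ≤ Q.sizeBound L.db.staticSize := fun a ha => by
      obtain ⟨h₁, h₂⟩ := CQ.mem_stat_body.1 ((mem_G a).1 ha)
      rw [← L.card_db]
      exact CQ.card_le_sizeBound _ h₁ h₂
    set σ₀ := (L.initMem.setReg (Rg.one.code b) 1).setReg (Rg.top.code b) 1 with hσ₀
    have z : ∀ (A : Ar) (l : List ℕ), σ₀.arr (A.code b) l = 0 := fun A l =>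
      L.initMem_arr_ge (hb.trans (Ar.le_code b A)) l
    obtain ⟨t₁, σ₁, e₁, l₁, o₁, n₁, W, idx, hW, htop, hmem⟩ := weigh_exec (b := b) (σ := σ₀) L hb
      (Finset.nodup_toList _) hGid hB (fun a ha j => hstat _ (hdlv a ha j)) (by simp [hσ₀])
      (by simp [hσ₀]) (fun _ _ => rfl) (fun r l => z _ l)
    have k₁ : ∀ A : Ar, (∀ r, A ≠ .weight r) → A ≠ .half → σ₁.arr (A.code b) = σ₀.arr (A.code b) :=
      fun A h₁ h₂ => e₁.arr_eq fun h => by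
        rcases weightCodes_stores (matchAll_stores h) with ⟨r, h⟩ | h <;> rw [Ar.code_inj] at h
        exacts [h₁ r h, h₂ h]
    obtain ⟨t₂, σ₂, e₂, l₂, k₂, i₂, b₂⟩ := statesCode_exec L hb (Finset.nodup_toList _) hGid hB
      (fun a ha j => hstat _ (hdlv a ha j)) hGx Q.head.nodup_dedup hosv
      (fun ν hν a ha => (hmem _).2 ⟨ν, hν, a, ha, rfl⟩) o₁ htop n₁ hW
      (fun l => by rw [k₁ _ (by simp) (by simp), z])
      (fun y _ l => by
        rw [k₁ _ (by simp) (by simp), k₁ _ (by simp) (by simp), z, z]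
        exact ⟨rfl, rfl⟩)
    have k₃ : ∀ A : Ar, (∀ r, A ≠ .weight r) → A ≠ .half → A ≠ .digit → A ≠ .bit 0 →
        (∀ y, A ≠ .pos y ∧ A ≠ .cnt y ∧ A ≠ .list y) → ∀ l, σ₂.arr (A.code b) l = 0 :=
      fun A h₁ h₂ h₃ h₄ h₅ l => by
        rw [k₂ _ ⟨by simpa using h₃, by simpa using h₄, fun y _ => by simpa using h₅ y⟩,
          k₁ A h₁ h₂, z]
    -- for every dynamic atom there are at most as many entries as matches of the static atoms
    have hcard : W.card ≤ dl.length * Q.sizeBound L.db.staticSize := by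
      have hsub : W ⊆ Q.dyn.body.biUnion fun a => W.filter fun e =>
          ∃ ν : ℕ → ℕ, (∀ a ∈ G, (fun j => ν (a.args j)) ∈ L.db a.rel) ∧ a.entry ν = e := by
        intro e he
        obtain ⟨ν, hν, a, ha, h⟩ := (hmem e).1 he
        exact Finset.mem_biUnion.2 ⟨a, (mem_dl a).1 ha, Finset.mem_filter.2 ⟨he, ν, hν, h.symm⟩⟩
      refine (Finset.card_le_card hsub).trans (Finset.card_biUnion_le_card_mul _ _ _ fun a ha => ?_)
        |>.trans_eq (by rw [hdl, Finset.length_toList])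
      refine CQ.card_image_le_sizeBound L.db (key := fun ν => a.entry ν) (fun ν ν' h => ?_)
        fun e he => ?_
      · exact Atom.entry_congr fun j => h _ (hdlv a ((mem_dl a).2 ha) j)
      · obtain ⟨-, ν, hν, h⟩ := Finset.mem_filter.1 he
        exact ⟨ν, fun a ha => hν a ((mem_G a).2 ha), h⟩
    refine ⟨_, σ₂, (Prog.Exec.const _ _ _).seq ((Prog.Exec.const _ _ _).seq (e₁.seq e₂)), ?_,
      fun r hr => ?_, W, idx, ⟨hW.congr (fun r => k₂ _ (by simp)) (k₂ _ (by simp)), hmem,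
        fun r l => ?_, fun r hr t => ?_, ?_, i₂, b₂, fun r hr => ?_⟩⟩
    · replace l₁ : t₁.length ≤ nestCost (Q.sizeBound L.db.staticSize) s₁ G.length + s₁ := l₁
      replace l₂ : t₂.length ≤ 2 ^ W.card * (9 * W.card + 9 +
        (nestCost (Q.sizeBound L.db.staticSize) s₂ G.length + s₂) + 3) + 3 := l₂
      simp only [List.length_cons, List.length_append, List.length_nil, hf]
      have := Nat.mul_le_mul (Nat.pow_le_pow_right two_pos hcard)
        (show 9 * W.card + 9 + (nestCost (Q.sizeBound L.db.staticSize) s₂ G.length + s₂) + 3 ≤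
          9 * (dl.length * Q.sizeBound L.db.staticSize) + 9 +
            (nestCost (Q.sizeBound L.db.staticSize) s₂ G.length + s₂) + 3 by omega)
      omega
    · rw [k₂, n₁ r hr]
      have := fun A => Ar.le_code b A
      refine ⟨?_, ?_, fun y _ => ⟨?_, ?_, ?_⟩⟩ <;>
        exact ((hr.trans_le hb).trans_le (this _)).ne
    · rw [k₃ _ (by simp) (by simp) (by simp) (by simp) (by simp)]
      exact Nat.zero_le 1
    · rw [k₃ _ (by simp) (by simp) (by simp) (by simp) (by simp)]
      simp [Database.staticPart, hr]
    · rw [k₃ _ (by simp) (by simp) (by simp) (by simp) (by simp)]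
      refine (Finset.sum_eq_zero fun e _ => ?_).symm
      rw [k₃ _ (by simp) (by simp) (by simp) (by simp) (by simp), zero_mul]
    · simp [Database.staticPart, hr]
  case upd =>
    rintro L D u σ ⟨W, idx, h⟩
    exact ⟨W, idx, h.update hba⟩
  case enum =>
    rintro L D σ ⟨W, idx, h⟩
    exact h.answer mem_G mem_dl hx Q.head.nodup_dedup fun y => List.mem_dedup.symm
  · intro a
    constructor <;> intro h <;> rcases dispatch_writes h with h | ⟨r, h⟩
    · simp at h
    · simpa using stateUpdate_writes h
    · simp at h
    · simpa using stateUpdate_writes h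
  · intro A hA h
    have := fun A => Ar.le_code b A
    obtain ⟨r, h⟩ := dispatch_stores h
    rcases stateUpdate_stores h with h | h
    · have := this (.pres r)
      omega
    · have := this .state
      omega
  · rintro A (h | h)
    · exact h
    · exact Plan.answerCode_stores _ _ A h

/-- Each query of the class has a maintenance algorithm whose preprocessing time is at most exponential in
the size bound. -/
theorem exists_maintenance_of_mem_Cexp {Q : CQ S} (hQ : Q ∈ CQ.Cexp) :
    ∃ (A : Maintenance) (f : ℕ → ℕ) (k : ℕ), ExpBdd f ∧
      A.PreprocessingTime S (fun N M => f (Q.sizeBound N) + k + k * M) ∧ A.UpdateTime S k ∧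
      A.EnumerationDelay Q k := by
  by_cases hne : Q.body.Nonempty
  · rcases hQ with hQ | hQ
    · refine exists_maintenance_of_wellBehaved hQ hne Q.sizeBound fun L a ha hd => ?_
      rw [← L.card_db]
      exact CQ.card_le_sizeBound _ ha hd
    · exact exists_maintenance_of_subset hQ
  · refine exists_maintenance_of_subset fun x hx => ?_
    obtain ⟨a, ha, -⟩ := CQ.mem_vars.1 hx
    exact (hne ⟨a, (CQ.mem_dyn_body.1 ha).1⟩).elim

end main

theorem mainTheorem3 (S : Schema) (Q : CQ S) (hQ : Q ∈ CQ.Cexp) :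
    ∃ (A : Maintenance) (p : ℕ → ℕ) (c : ℕ),
      (fun N => (p N : ℝ)) =O[atTop] (fun N : ℕ => (N : ℝ) ^ Q.stat.rhoStar) ∧
      A.PreprocessingTime S (fun N M => 2 ^ p N * p N ^ 2 + c * M) ∧
      A.UpdateTime S c ∧
      A.EnumerationDelay Q c := by
  obtain ⟨A, f, k, hf, h₁, h₂, h₃⟩ := exists_maintenance_of_mem_Cexp hQ
  obtain ⟨p, hp, hfp⟩ := Q.exists_time_bound (hf.add (.const k))
  refine ⟨A, p, k, hp, fun L => ?_, h₂, h₃⟩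
  obtain ⟨tr, σ, hrun, hlen⟩ := h₁ L
  exact ⟨tr, σ, hrun, hlen.trans (Nat.add_le_add_right (hfp _) _)⟩
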